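/- **Setting.** All Hilbert spaces are complex, separable and infinite dimensional. For a bounded operator $A$ on $H$ let $\mu(k,A)$, $k\ge 0$, be its singular values (for compact $A$, the eigenvalues of $|A|$ in non-increasing order with multiplicities), put $\mu(s,A)=\mu(\lfloor s\rfloor,A)$ for real $s\geq 0$, and let $\mathcal L_{1,\infty}=\{A:\ \mu(k,A)=O(\frac1{k+1})\}$. A spectral triple $(\mathcal A,H,D)$ consists of a $*$-algebra $\mathcal A$ of bounded operators on $H$ and a self-adjoint operator $D$ with compact resolvent such that every $a\in\mathcal A$ preserves $\mathrm{dom}\,D$ and $[D,a]$ is bounded; it is $(p,\infty)$-summable ($p>0$) if $(1+D^2)^{-p/2}\in\mathcal L_{1,\infty}$. On $L_\infty(0,\infty)$ let $(Mx)(t)=\frac1{\log t}\int_1^t x(s)\frac{ds}{s}$ and, for $u>0$, $(P_ux)(t)=x(t^u)$. For a state $\omega$ on $L_\infty(0,\infty)$ which vanishes on all functions with bounded support, ${\rm Tr}_\omega$ is the linear functional on $\mathcal L_{1,\infty}$ which extends $${\rm Tr}_\omega(A)=\omega\Big(t\mapsto \frac1{\log(1+t)}\int_0^t\mu(s,A)\,ds\Big),\qquad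 0\le A\in\mathcal L_{1,\infty}.$$ **Theorem 1.8.** Let $\omega$ be a state on $L_\infty(0,\infty)$ which vanishes on all functions with bounded support and satisfies $\omega=\omega\circ M$; write $\omega^u=\omega\circ P_u$. Let $p_1,p_2>0$ and let $(\mathcal A_i,H_i,D_i)$ be a $(p_i,\infty)$-summable spectral triple, $i=1,2$. Suppose that for $i=1$ or for $i=2$ the following holds: for every $T\in\mathcal A_i$ there is $c(T)\in\mathbb C$ such that $$t^{p_i}\,{\rm Tr}(Te^{-(tD_i)^2})\to c(T),\qquad t\to 0^+.$$ Then for all $T_1\in\mathcal A_1$ and $T_2\in\mathcal A_2$ the operator $(T_1\otimes T_2)(1+D_1^2\otimes1+1\otimes D_2^2)^{-\frac{p_1+p_2}2}$ on the Hilbert space tensor product $H_1\otimes H_2$ belongs to $\mathcal L_{1,\infty}$, and $$\Gamma\Big(1+\frac{p_1+p_2}2\Big)\,{\rm Tr}_{\omega^{p_1+p_2}}\Big((T_1\otimes T_2)(1+D_1^2\otimes1+1\otimes D_2^2)^{-\frac{p_1+p_2}2}\Big)$$ $$=\Gamma\Big(1+\frac{p_1}2\Big)\,{\rm Tr}_{\omega^{p_1}}\Big(T_1(1+D_1^2)^{-\frac{p_1}2}\Big)\cdot\Gamma\Big(1+\frac{p_2}2\Big)\,{\rm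 Tr}_{\omega^{p_2}}\Big(T_2(1+D_2^2)^{-\frac{p_2}2}\Big).$$ Here $D_1^2\otimes 1+1\otimes D_2^2$ denotes the closure of the operator defined on the algebraic tensor product of $\mathrm{dom}\,D_1^2$ and $\mathrm{dom}\,D_2^2$. -/

import Mathlib

open scoped ENNReal TensorProduct InnerProductSpace

namespace NCG

noncomputable section

/-! ### Functions on the half-line -/

/-- Lebesgue measure on the half-line `(0, ∞)`. -/
abbrev halfLine : MeasureTheory.Measure ℝ :=
  MeasureTheory.volume.restrict (Set.Ioi 0)

/-- The space `L_∞(0, ∞)` of classes of complex valued functions. -/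
abbrev Linfty : Type := MeasureTheory.Lp ℂ ∞ halfLine

/-- The class in `L_∞(0, ∞)` of a function `f`
(to be used only for measurable, essentially bounded `f`). -/
def toLinfty (f : ℝ → ℂ) : Linfty :=
  open scoped Classical in
  if h : MeasureTheory.MemLp f ∞ halfLine then h.toLp f else 0

theorem ae_norm_le (x : Linfty) : ∀ᵐ t ∂halfLine, ‖x t‖ ≤ ‖x‖ := by
  have h := MeasureTheory.Lp.memLp x
  filter_upwards [MeasureTheory.ae_le_eLpNormEssSup (f := x) (μ := halfLine)] with t ht
  rw [MeasureTheory.Lp.norm_def, MeasureTheory.eLpNorm_exponent_top]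
  have h2 : MeasureTheory.eLpNormEssSup x halfLine ≠ ∞ := by
    have := h.2.ne
    rwa [MeasureTheory.eLpNorm_exponent_top] at this
  have := ENNReal.toReal_mono h2 ht
  simpa using this

theorem norm_log_integral_le (x : Linfty) {a b : ℝ} (ha : 0 < a) (hb : 0 < b) :
    ‖∫ s in a..b, x s / s‖ ≤ ‖x‖ * |Real.log (b / a)| := by
  have hsub : Set.uIoc a b ⊆ Set.Ioi 0 := fun s hs => lt_of_lt_of_le (lt_min ha hb) hs.1.le
  have h0 : (0 : ℝ) ∉ Set.uIcc a b := fun h => absurd h.1 (not_le.2 (lt_min ha hb))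
  have h : ‖∫ s in a..b, x s / s‖ ≤ |∫ s in a..b, ‖x‖ * s⁻¹| := by
    apply intervalIntegral.norm_integral_le_abs_of_norm_le
    · have h1 := MeasureTheory.ae_restrict_of_ae_restrict_of_subset hsub (ae_norm_le x)
      filter_upwards [h1, MeasureTheory.ae_restrict_mem measurableSet_uIoc] with s hs hm
      have hs0 : 0 < s := hsub hm
      rw [norm_div, Complex.norm_real, Real.norm_of_nonneg hs0.le, div_eq_mul_inv]
      gcongr
    · exact (intervalIntegral.intervalIntegrable_inv (fun s hs => fun h => h0 (h ▸ hs))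
        continuousOn_id).const_mul _
  rwa [intervalIntegral.integral_const_mul, integral_inv h0, abs_mul,
    abs_of_nonneg (norm_nonneg x)] at h

theorem intervalIntegrable_div (x : Linfty) {a b : ℝ} (ha : 0 < a) (hb : 0 < b) :
    IntervalIntegrable (fun s : ℝ => x s / s) MeasureTheory.volume a b := by
  have hsub : Set.uIoc a b ⊆ Set.Ioi 0 := fun s hs => lt_of_lt_of_le (lt_min ha hb) hs.1.le
  have h0 : (0 : ℝ) ∉ Set.uIcc a b := fun h => absurd h.1 (not_le.2 (lt_min ha hb))
  have hg : IntervalIntegrable (fun s : ℝ => ‖x‖ * s⁻¹) MeasureTheory.volume a b :=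
    (intervalIntegral.intervalIntegrable_inv (fun s hs => fun h => h0 (h ▸ hs))
        continuousOn_id).const_mul _
  refine hg.mono_fun ?_ ?_
  · have h1 : MeasureTheory.AEStronglyMeasurable x halfLine :=
      (MeasureTheory.Lp.memLp x).1
    have h2 := h1.mono_measure (MeasureTheory.Measure.restrict_mono_set MeasureTheory.volume hsub)
    exact h2.div₀ (Complex.measurable_ofReal.aestronglyMeasurable)
  · have h1 := MeasureTheory.ae_restrict_of_ae_restrict_of_subset hsub (ae_norm_le x)
    filter_upwards [h1, MeasureTheory.ae_restrict_mem measurableSet_uIoc] with s hs hm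
    have hs0 : 0 < s := hsub hm
    rw [norm_div, Complex.norm_real, Real.norm_of_nonneg hs0.le, div_eq_mul_inv, norm_mul,
      norm_norm, norm_inv, Real.norm_of_nonneg hs0.le]
    gcongr

theorem memLp_logMean (x : Linfty) :
    MeasureTheory.MemLp (fun t : ℝ => (1 / (Real.log t : ℂ)) * ∫ s in (1 : ℝ)..t, x s / s)
      ∞ halfLine := by
  have hcont : ContinuousOn (fun t : ℝ => ∫ s in (1 : ℝ)..t, x s / s) (Set.Ioi 0) := by
    intro t (ht : 0 < t)
    have hmin : 0 < min 1 t / 2 := by positivity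
    have h1 : min 1 t / 2 < 1 := by linarith [min_le_left 1 t, lt_min one_pos ht]
    have h2 : min 1 t / 2 < t := by linarith [min_le_right 1 t, lt_min one_pos ht]
    have hle : min 1 t / 2 ≤ max 1 t + 1 := by linarith [le_max_left 1 t]
    have h := intervalIntegral.continuousOn_primitive_interval'
      (intervalIntegrable_div x hmin (show 0 < max 1 t + 1 by positivity))
      (a := 1) (by rw [Set.uIcc_of_le hle]; exact ⟨h1.le, by linarith [le_max_left 1 t]⟩)
    refine (h.continuousAt ?_).continuousWithinAt
    rw [Set.uIcc_of_le hle]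
    exact Icc_mem_nhds h2 (by linarith [le_max_right 1 t])
  refine MeasureTheory.memLp_top_of_bound ?_ ‖x‖ ?_
  · refine MeasureTheory.AEStronglyMeasurable.mul ?_
      (hcont.aestronglyMeasurable measurableSet_Ioi)
    exact Measurable.aestronglyMeasurable (by fun_prop)
  · filter_upwards [MeasureTheory.ae_restrict_mem measurableSet_Ioi] with t (ht : 0 < t)
    have h := norm_log_integral_le x one_pos ht
    rw [div_one] at h
    rw [norm_mul, norm_div, norm_one, Complex.norm_real, Real.norm_eq_abs]
    rcases eq_or_ne (Real.log t) 0 with h0 | h0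
    · simp [h0]
    · rw [one_div, inv_mul_le_iff₀ (abs_pos.2 h0), mul_comm]
      exact h

/-- The logarithmic mean `(M x)(t) = (1 / log t) ∫₁ᵗ x(s) ds/s` on `L_∞(0, ∞)`. -/
def logMean (x : Linfty) : Linfty :=
  (memLp_logMean x).toLp
    (fun t : ℝ => (1 / (Real.log t : ℂ)) * ∫ s in (1 : ℝ)..t, x s / s)

theorem quasiMeasurePreserving_rpow {u : ℝ} (hu : 0 < u) :
    MeasureTheory.Measure.QuasiMeasurePreserving (fun t : ℝ => t ^ u) halfLine halfLine := by
  refine ⟨by fun_prop, ?_⟩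
  refine MeasureTheory.Measure.AbsolutelyContinuous.mk fun s hs h => ?_
  rw [MeasureTheory.Measure.restrict_apply hs] at h
  have hm : Measurable fun t : ℝ => t ^ u := by fun_prop
  rw [MeasureTheory.Measure.map_apply hm hs, MeasureTheory.Measure.restrict_apply (hm hs)]
  have himg := MeasureTheory.addHaar_image_eq_zero_of_differentiableOn_of_addHaar_eq_zero
    (μ := MeasureTheory.volume) (f := fun t : ℝ => t ^ u⁻¹) (s := s ∩ Set.Ioi 0)
    (fun t ht => ((Real.hasDerivAt_rpow_const (p := u⁻¹)
      (Or.inl (ne_of_gt ht.2))).differentiableAt).differentiableWithinAt) h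
  refine MeasureTheory.measure_mono_null ?_ himg
  rintro t ⟨hts, ht⟩
  refine ⟨t ^ u, ⟨hts, Real.rpow_pos_of_pos ht u⟩, ?_⟩
  exact Real.rpow_rpow_inv (le_of_lt ht) hu.ne'

theorem memLp_powAct {u : ℝ} (hu : 0 < u) (x : Linfty) :
    MeasureTheory.MemLp (fun t : ℝ => x (t ^ u)) ∞ halfLine := by
  have hq := quasiMeasurePreserving_rpow hu
  refine MeasureTheory.memLp_top_of_bound ?_ ‖x‖ ?_
  · exact (MeasureTheory.Lp.memLp x).1.comp_quasiMeasurePreserving hq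
  · exact hq.ae (ae_norm_le x)

/-- The operator `(P_u x)(t) = x(t ^ u)` on `L_∞(0, ∞)`, for `u > 0`. -/
def powAct (u : ℝ) (hu : 0 < u) : Linfty →ₗ[ℂ] Linfty where
  toFun x := (memLp_powAct hu x).toLp (fun t : ℝ => x (t ^ u))
  map_add' x y := by
    rw [← MeasureTheory.MemLp.toLp_add]
    refine MeasureTheory.MemLp.toLp_congr _ _ ?_
    exact (quasiMeasurePreserving_rpow hu).ae_eq_comp (MeasureTheory.Lp.coeFn_add x y)
  map_smul' c x := by
    rw [RingHom.id_apply, ← MeasureTheory.MemLp.toLp_const_smul]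
    refine MeasureTheory.MemLp.toLp_congr _ _ ?_
    exact (quasiMeasurePreserving_rpow hu).ae_eq_comp (MeasureTheory.Lp.coeFn_smul c x)

/-- A state on `L_∞(0, ∞)`: a linear functional which is non-negative on (classes of) non-negative
functions and takes the value `1` on the constant function `1`. -/
structure IsState (ω : Linfty →ₗ[ℂ] ℂ) : Prop where
  nonneg : ∀ x : Linfty, (∀ᵐ t ∂halfLine, 0 ≤ (x t).re ∧ (x t).im = 0) →
    0 ≤ (ω x).re ∧ (ω x).im = 0
  map_one : ω (toLinfty fun _ => 1) = 1

/-- The functional `ω` lives at infinity: it vanishes on functions with bounded support. -/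
def VanishesOnBounded (ω : Linfty →ₗ[ℂ] ℂ) : Prop :=
  ∀ (x : Linfty) (N : ℝ), (∀ᵐ t ∂halfLine, N < t → x t = 0) → ω x = 0

/-! ### Operators on a Hilbert space -/

section Operators

variable {H : Type*} [NormedAddCommGroup H] [InnerProductSpace ℂ H]

/-- The `k`-th singular value `μ(k, A)`, `k = 0, 1, 2, …`: the distance in operator norm from `A`
to the operators of rank at most `k`. -/
def singularValue (k : ℕ) (A : H →L[ℂ] H) : ℝ :=
  ⨅ F : {F : H →L[ℂ] H // LinearMap.rank (F : H →ₗ[ℂ] H) ≤ k}, ‖A - F‖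

/-- Membership in the ideal `L_{1,∞}`, i.e. `μ(k, A) = O(1 / (k + 1))`. -/
def IsWeakL1 (A : H →L[ℂ] H) : Prop :=
  ∃ C : ℝ, ∀ k : ℕ, singularValue k A ≤ C / (k + 1)

/-- The function `t ↦ (1 / log (1 + t)) ∫₀ᵗ μ(s, A) ds`, where `μ(s, A) = μ(⌊s⌋, A)`. -/
def dixmierMean (A : H →L[ℂ] H) (t : ℝ) : ℝ :=
  (1 / Real.log (1 + t)) * ∫ s in (0 : ℝ)..t, singularValue ⌊s⌋₊ A

theorem singularValue_nonneg (k : ℕ) (A : H →L[ℂ] H) : 0 ≤ singularValue k A :=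
  Real.iInf_nonneg fun _ => norm_nonneg _

theorem singularValue_antitone (A : H →L[ℂ] H) : Antitone fun k => singularValue k A := by
  intro k l hkl
  have : Nonempty {F : H →L[ℂ] H // LinearMap.rank (F : H →ₗ[ℂ] H) ≤ k} :=
    ⟨⟨0, by simp⟩⟩
  refine le_ciInf fun F => ?_
  exact ciInf_le ⟨0, by rintro _ ⟨G, rfl⟩; exact norm_nonneg _⟩
    (⟨F.1, F.2.trans (by exact_mod_cast hkl)⟩ :
      {F : H →L[ℂ] H // LinearMap.rank (F : H →ₗ[ℂ] H) ≤ l})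

theorem memLp_dixmierMean {A : H →L[ℂ] H} (hA : IsWeakL1 A) :
    MeasureTheory.MemLp (fun t => (dixmierMean A t : ℂ)) ∞ halfLine := by
  obtain ⟨C, hC⟩ := hA
  have hanti : Antitone fun s : ℝ => singularValue ⌊s⌋₊ A :=
    (singularValue_antitone A).comp_monotone Nat.floor_mono
  have hint : ∀ a b : ℝ, IntervalIntegrable (fun s : ℝ => singularValue ⌊s⌋₊ A)
      MeasureTheory.volume a b := fun a b => hanti.intervalIntegrable
  have hC0 : 0 ≤ C := by simpa using (singularValue_nonneg 0 A).trans (hC 0)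
  refine MeasureTheory.memLp_top_of_bound ?_ (2 * C) ?_
  · refine Measurable.aestronglyMeasurable ?_
    have := (intervalIntegral.continuous_primitive hint 0).measurable
    unfold dixmierMean
    fun_prop
  · filter_upwards [MeasureTheory.ae_restrict_mem measurableSet_Ioi] with t (ht : 0 < t)
    have hlog : 0 < Real.log (1 + t) := Real.log_pos (by linarith)
    have h0 : 0 ≤ ∫ s in (0 : ℝ)..t, singularValue ⌊s⌋₊ A :=
      intervalIntegral.integral_nonneg ht.le fun s _ => singularValue_nonneg _ _
    have hne : ∀ s ∈ Set.uIcc 0 t, (1 + s : ℝ) ≠ 0 := by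
      intro s hs
      rw [Set.uIcc_of_le ht.le] at hs
      linarith [hs.1]
    have hle : ∫ s in (0 : ℝ)..t, singularValue ⌊s⌋₊ A ≤ ∫ s in (0 : ℝ)..t, 2 * C * (1 + s)⁻¹ := by
      refine intervalIntegral.integral_mono_on ht.le (hint 0 t) ?_ ?_
      · exact (intervalIntegral.intervalIntegrable_inv hne (by fun_prop)).const_mul _
      · intro s hs
        refine (hC _).trans ?_
        have h1 := Nat.lt_floor_add_one s
        have h2 : (0 : ℝ) ≤ ⌊s⌋₊ := Nat.cast_nonneg _
        rw [← div_eq_mul_inv, div_le_div_iff₀ (by positivity) (by linarith [hs.1])]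
        nlinarith
    have hval : ∫ s in (0 : ℝ)..t, 2 * C * (1 + s)⁻¹ = 2 * C * Real.log (1 + t) := by
      rw [intervalIntegral.integral_const_mul,
        intervalIntegral.integral_comp_add_left (fun s : ℝ => s⁻¹) 1, integral_inv]
      · simp
      · rw [add_zero, Set.uIcc_of_le (by linarith)]
        exact fun h => by linarith [h.1]
    rw [Complex.norm_real, Real.norm_eq_abs, dixmierMean, abs_of_nonneg (by positivity),
      one_div, inv_mul_le_iff₀ hlog]
    linarith

/-- The value of `Tr_ω` on a positive operator `A` of `L_{1,∞}`. -/
def dixmierPos (ω : Linfty →ₗ[ℂ] ℂ) (A : H →L[ℂ] H) : ℂ :=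
  ω (toLinfty fun t => (dixmierMean A t : ℂ))

/-- The functional `Tr_ω` on `L_{1,∞}`: the linear extension of its values on the positive cone,
through the decomposition `A = (Re A)₊ - (Re A)₋ + i ((Im A)₊ - (Im A)₋)`. -/
def dixmierTrace [CompleteSpace H] (ω : Linfty →ₗ[ℂ] ℂ) (A : H →L[ℂ] H) : ℂ :=
  dixmierPos ω (realPart A : H →L[ℂ] H)⁺ - dixmierPos ω (realPart A : H →L[ℂ] H)⁻
    + Complex.I * (dixmierPos ω (imaginaryPart A : H →L[ℂ] H)⁺
      - dixmierPos ω (imaginaryPart A : H →L[ℂ] H)⁻)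

/-- The standard trace `Tr A = ∑ ⟨e_i, A e_i⟩` of a trace class operator `A`, computed in some
orthonormal basis of `H`. -/
def trace [CompleteSpace H] (A : H →L[ℂ] H) : ℂ :=
  ∑' e : (exists_hilbertBasis ℂ H).choose, ⟪(e : H), A (e : H)⟫_ℂ

/-- The bounded operator `R` is the (two-sided) inverse of the unbounded operator `L`. -/
def IsBoundedInverse (L : H →ₗ.[ℂ] H) (R : H →L[ℂ] H) : Prop :=
  (∀ y : H, ∃ h : R y ∈ L.domain, L ⟨R y, h⟩ = y) ∧ ∀ x : L.domain, R (L x) = x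

/-- The bounded inverse of an unbounded operator, if there is one. -/
def boundedInverse (L : H →ₗ.[ℂ] H) : H →L[ℂ] H :=
  open scoped Classical in
  if h : ∃ R : H →L[ℂ] H, IsBoundedInverse L R then h.choose else 0

/-- The functional calculus `f(L)` of a non-negative self-adjoint operator `L`, for a continuous
function `f` on `[0, ∞)` vanishing at infinity. With the bounded operator `R = (1 + L)⁻¹`, whose
spectrum lies in `[0, 1]`, it is `g(R)` where `g(r) = f(1 / r - 1)` for `r > 0` and `g(0) = 0`. -/
def funcCalc [CompleteSpace H] (L : H →ₗ.[ℂ] H) (f : ℝ → ℝ) : H →L[ℂ] H :=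
  cfc (fun r : ℝ => if 0 < r then f (1 / r - 1) else 0)
    (boundedInverse ((LinearMap.id : H →ₗ[ℂ] H) +ᵥ L))

/-- `(1 + L) ^ (-q)` for a non-negative self-adjoint operator `L` and `q > 0`. -/
def resolventPow [CompleteSpace H] (L : H →ₗ.[ℂ] H) (q : ℝ) : H →L[ℂ] H :=
  funcCalc L fun s => (1 + s) ^ (-q)

/-- `exp(-a L)` for a non-negative self-adjoint operator `L` with compact resolvent and `a > 0`. -/
def heat [CompleteSpace H] (L : H →ₗ.[ℂ] H) (a : ℝ) : H →L[ℂ] H :=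
  funcCalc L fun s => Real.exp (-(a * s))

/-- The square of an unbounded operator `D`, with domain `{x ∈ dom D | D x ∈ dom D}`. -/
def square (D : H →ₗ.[ℂ] H) : H →ₗ.[ℂ] H where
  domain := (D.domain.comap D.toFun).map D.domain.subtype
  toFun := D.toFun ∘ₗ
    (D.toFun.restrict (p := D.domain.comap D.toFun) (q := D.domain) fun _ h => h) ∘ₗ
    ((D.domain.comap D.toFun).equivMapOfInjective D.domain.subtype
      D.domain.injective_subtype).symm.toLinearMap

end Operators

/-! ### Spectral triples -/

/-- A spectral triple `(𝒜, H, D)`: a `*`-algebra `𝒜` of bounded operators on `H` and a self-adjoint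
(hence densely defined) operator `D` with compact resolvent such that every `a ∈ 𝒜` preserves
`dom D` and has bounded commutator `[D, a]`. -/
structure SpectralTriple (H : Type*) [NormedAddCommGroup H] [InnerProductSpace ℂ H]
    [CompleteSpace H] where
  /-- the algebra -/
  alg : NonUnitalStarSubalgebra ℂ (H →L[ℂ] H)
  /-- the operator -/
  D : H →ₗ.[ℂ] H
  selfAdjoint : IsSelfAdjoint D
  compact_resolvent : ∃ R : H →L[ℂ] H, IsCompactOperator R ∧
    IsBoundedInverse ((Complex.I • (LinearMap.id : H →ₗ[ℂ] H)) +ᵥ D) R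
  bounded_commutator : ∀ a ∈ alg, ∃ hdom : ∀ x : D.domain, a x ∈ D.domain,
    ∃ C : ℝ, ∀ x : D.domain, ‖D ⟨a x, hdom x⟩ - a (D x)‖ ≤ C * ‖(x : H)‖

section Triples

variable {H : Type*} [NormedAddCommGroup H] [InnerProductSpace ℂ H] [CompleteSpace H]

/-- `(p, ∞)`-summability: `(1 + D²) ^ (-p/2) ∈ L_{1,∞}`. -/
def SpectralTriple.IsSummable (X : SpectralTriple H) (p : ℝ) : Prop :=
  IsWeakL1 (resolventPow (square X.D) (p / 2))

/-- Convergence in the theta function formula: for every `T ∈ 𝒜` there is `c(T)` such that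
`t ^ p Tr(T exp(-(t D)²)) → c(T)` as `t → 0`, `t > 0`. -/
def SpectralTriple.ThetaConvergent (X : SpectralTriple H) (p : ℝ) : Prop :=
  ∀ T ∈ X.alg, ∃ c : ℂ, Filter.Tendsto
    (fun t : ℝ => ((t ^ p : ℝ) : ℂ) * trace (T * heat (square X.D) (t ^ 2)))
    (nhdsWithin 0 (Set.Ioi 0)) (nhds c)

end Triples

/-! ### Tensor products -/

section Tensor

variable (H₁ H₂ : Type*) [NormedAddCommGroup H₁] [InnerProductSpace ℂ H₁]
  [NormedAddCommGroup H₂] [InnerProductSpace ℂ H₂]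

/-- The tensor product of Hilbert spaces: the completion of the algebraic tensor product. -/
abbrev HilbertTensor : Type _ := UniformSpace.Completion (H₁ ⊗[ℂ] H₂)

variable {H₁ H₂}

/-- The elementary tensor `x ⊗ y` in the Hilbert space tensor product. -/
def tmul (x : H₁) (y : H₂) : HilbertTensor H₁ H₂ := ((x ⊗ₜ[ℂ] y : H₁ ⊗[ℂ] H₂) :)

theorem inner_map_add_inner_map [CompleteSpace H₁] [CompleteSpace H₂]
    (A B : H₁ →ₗ[ℂ] H₁) (A' B' : H₂ →ₗ[ℂ] H₂) (c : ℂ)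
    (h : ∀ x x' y y', ⟪A x, A x'⟫_ℂ * ⟪A' y, A' y'⟫_ℂ + ⟪B x, B x'⟫_ℂ * ⟪B' y, B' y'⟫_ℂ
      = c * (⟪x, x'⟫_ℂ * ⟪y, y'⟫_ℂ)) (z w : H₁ ⊗[ℂ] H₂) :
    ⟪TensorProduct.map A A' z, TensorProduct.map A A' w⟫_ℂ
      + ⟪TensorProduct.map B B' z, TensorProduct.map B B' w⟫_ℂ = c * ⟪z, w⟫_ℂ := by
  induction z with
  | zero => simp
  | add z z' hz hz' =>
    simp only [map_add, inner_add_left, mul_add, ← hz, ← hz']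
    ring
  | tmul x y =>
    induction w with
    | zero => simp
    | add w w' hw hw' =>
      simp only [map_add, inner_add_right, mul_add, ← hw, ← hw']
      ring
    | tmul x' y' => simpa using h x x' y y'

theorem exists_defect {H : Type*} [NormedAddCommGroup H] [InnerProductSpace ℂ H]
    [CompleteSpace H] (T : H →L[ℂ] H) : ∃ S : H →L[ℂ] H, ∀ x y,
      ⟪T x, T y⟫_ℂ + ⟪S x, S y⟫_ℂ = ((‖T‖ ^ 2 : ℝ) : ℂ) * ⟪x, y⟫_ℂ := by
  have h : 0 ≤ algebraMap ℝ (H →L[ℂ] H) (‖T‖ ^ 2) - star T * T :=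
    sub_nonneg.2 (CStarAlgebra.star_mul_le_algebraMap_norm_sq (a := T))
  obtain ⟨S, hS⟩ := CStarAlgebra.nonneg_iff_eq_star_mul_self.1 h
  refine ⟨S, fun x y => ?_⟩
  have h1 : ⟪x, (algebraMap ℝ (H →L[ℂ] H) (‖T‖ ^ 2) - star T * T) y⟫_ℂ = ⟪x, (star S * S) y⟫_ℂ := by
    rw [hS]
  simp only [sub_apply, inner_sub_right, mul_apply_eq_comp,
    ContinuousLinearMap.star_eq_adjoint, ContinuousLinearMap.adjoint_inner_right,
    Algebra.algebraMap_eq_smul_one, smul_apply,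
    one_apply_eq_self] at h1
  rw [← h1, ← Complex.coe_smul, inner_smul_right]
  ring

theorem norm_map_le [CompleteSpace H₁] [CompleteSpace H₂] (T₁ : H₁ →L[ℂ] H₁) (T₂ : H₂ →L[ℂ] H₂)
    (z : H₁ ⊗[ℂ] H₂) :
    ‖TensorProduct.map (T₁ : H₁ →ₗ[ℂ] H₁) (T₂ : H₂ →ₗ[ℂ] H₂) z‖ ≤ ‖T₁‖ * ‖T₂‖ * ‖z‖ := by
  obtain ⟨S₁, hS₁⟩ := exists_defect T₁
  obtain ⟨S₂, hS₂⟩ := exists_defect T₂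
  have key : ∀ (a : ℝ) (z u v : H₁ ⊗[ℂ] H₂), 0 ≤ a →
      ⟪u, u⟫_ℂ + ⟪v, v⟫_ℂ = ((a ^ 2 : ℝ) : ℂ) * ⟪z, z⟫_ℂ → ‖u‖ ≤ a * ‖z‖ := by
    intro a z u v ha h
    have hn : ∀ w : H₁ ⊗[ℂ] H₂, ⟪w, w⟫_ℂ = (‖w‖ : ℂ) ^ 2 := fun w =>
      inner_self_eq_norm_sq_to_K w
    rw [hn, hn, hn] at h
    have h' : ‖u‖ ^ 2 + ‖v‖ ^ 2 = a ^ 2 * ‖z‖ ^ 2 := by exact_mod_cast h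
    refine abs_le_of_sq_le_sq' ?_ (by positivity) |>.2
    nlinarith [sq_nonneg ‖v‖]
  have h1 : ∀ z : H₁ ⊗[ℂ] H₂, ‖TensorProduct.map (T₁ : H₁ →ₗ[ℂ] H₁) LinearMap.id z‖
      ≤ ‖T₁‖ * ‖z‖ := fun z =>
    key _ z _ _ (norm_nonneg _) (inner_map_add_inner_map (T₁ : H₁ →ₗ[ℂ] H₁) (S₁ : H₁ →ₗ[ℂ] H₁)
      LinearMap.id LinearMap.id _ (fun x x' y y' => by
        have := hS₁ x x'
        simp only [ContinuousLinearMap.coe_coe, LinearMap.id_apply]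
        rw [← add_mul, this, mul_assoc]) z z)
  have h2 : ∀ z : H₁ ⊗[ℂ] H₂, ‖TensorProduct.map LinearMap.id (T₂ : H₂ →ₗ[ℂ] H₂) z‖
      ≤ ‖T₂‖ * ‖z‖ := fun z =>
    key _ z _ _ (norm_nonneg _) (inner_map_add_inner_map LinearMap.id LinearMap.id
      (T₂ : H₂ →ₗ[ℂ] H₂) (S₂ : H₂ →ₗ[ℂ] H₂) _ (fun x x' y y' => by
        have := hS₂ y y'
        simp only [ContinuousLinearMap.coe_coe, LinearMap.id_apply]
        rw [← mul_add, this]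
        ring) z z)
  have h3 : TensorProduct.map (T₁ : H₁ →ₗ[ℂ] H₁) (T₂ : H₂ →ₗ[ℂ] H₂) z =
      TensorProduct.map (T₁ : H₁ →ₗ[ℂ] H₁) LinearMap.id
        (TensorProduct.map LinearMap.id (T₂ : H₂ →ₗ[ℂ] H₂) z) := by
    rw [← LinearMap.comp_apply, ← TensorProduct.map_comp]
    simp
  rw [h3, mul_assoc]
  exact (h1 _).trans (mul_le_mul_of_nonneg_left (h2 z) (norm_nonneg _))

/-- The operator `T₁ ⊗ T₂` on the Hilbert space tensor product: the continuous extension of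
`x ⊗ y ↦ T₁ x ⊗ T₂ y`. -/
def tensorOp [CompleteSpace H₁] [CompleteSpace H₂] (T₁ : H₁ →L[ℂ] H₁) (T₂ : H₂ →L[ℂ] H₂) :
    HilbertTensor H₁ H₂ →L[ℂ] HilbertTensor H₁ H₂ :=
  ((TensorProduct.map (T₁ : H₁ →ₗ[ℂ] H₁) (T₂ : H₂ →ₗ[ℂ] H₂)).mkContinuous (‖T₁‖ * ‖T₂‖)
    (norm_map_le T₁ T₂)).completion

/-- The operator `L₁ ⊗ 1 + 1 ⊗ L₂` on the Hilbert space tensor product: the closure of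
`x ⊗ y ↦ L₁ x ⊗ y + x ⊗ L₂ y` on the algebraic tensor product of the domains, given by
its graph. -/
def tensorSum (L₁ : H₁ →ₗ.[ℂ] H₁) (L₂ : H₂ →ₗ.[ℂ] H₂) :
    HilbertTensor H₁ H₂ →ₗ.[ℂ] HilbertTensor H₁ H₂ :=
  (Submodule.span ℂ (Set.range fun v : L₁.domain × L₂.domain =>
    (tmul (v.1 : H₁) (v.2 : H₂),
      tmul (L₁ v.1) (v.2 : H₂) + tmul (v.1 : H₁) (L₂ v.2)))).topologicalClosure.toLinearPMap

end Tensor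

end

end NCG

/-!
The proof rests on one formula. Let `L ≥ 0` have eigenvalues `A k - 1` in a sorted Hilbert basis
`e`, with `A k ^ (-p / 2) = O(1 / (k + 1))`, and let `T` be bounded. Then

  `Γ(1 + p / 2) Tr_{ω^p} (T (1 + L) ^ (-p / 2)) = ω (h)`,
  `h(s) = s ^ (-p) ∑_k ⟪e k, T (e k)⟫ exp (-A k / s²)`,

and `h(s)` is `s ^ (-p) exp (-1 / s²) Tr (T exp (-L / s²))`. The formula is
`gamma_mul_dixmierTrace_eq`, and it has two ingredients.

* The Dixmier trace of `T V`, `V = (1 + L) ^ (-p / 2)`, is computed by the diagonal entries of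
  `T V` in the eigenbasis of `V`, although these are not its eigenvalues (`dixmierTrace_mul_eq`). For
  a self-adjoint `A = Re (T V)`, the quadratic form of `A` is `O(1 / n)` both on the complement of
  the first `n` eigenvectors of `V` and on the complement of the first eigenvectors of `A⁺` and
  `A⁻`. So the corresponding two sums of diagonal entries of `A` both differ by `O(1)` from the
  trace of the compression of `A` to the span of all these vectors
  (`exists_abs_sum_singularValue_sub_le`), and `O(1)` is negligible against `log (1 + t)`. This
  also yields linearity of the Dixmier trace where it is needed.
* Since `∫₀^∞ s ^ (-p) exp (-A / s²) ds / s = Γ(1 + p / 2) / p · A ^ (-p / 2)`, the primitive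
  `∫₁ᵗ h(s) ds / s` is, up to `O(1)`, `Γ(1 + p / 2) / p` times the sum of the first `t ^ p` diagonal
  entries (`exists_norm_integral_heatMean_sub_le`). So the logarithmic mean of `h` at `t` is, up
  to `o(1)`, `Γ(1 + p / 2)` times the mean in the definition of the Dixmier trace at `t ^ p`
  (`tendsto_logMean_heatMean_sub`), and `ω = ω ∘ M` applies.

The operator `L = D₁² ⊗ 1 + 1 ⊗ D₂²` has the eigenbasis `e i ⊗ f j`; counting its eigenvalues
shows that `(1 + L) ^ (-(p₁ + p₂) / 2)` is again in `L_{1,∞}` (`exists_hasSortedBasis_tensorSum`).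
Its heat trace against `T₁ ⊗ T₂` is the product of the two heat traces
(`trace_tensorOp_mul_heat`), so the function `h` of the product is `exp (1 / s²) h₁(s) h₂(s)`. If
`h₁` or `h₂` converges at infinity, then `ω` is multiplicative on this product
(`state_mul_of_tendsto`), which is the theorem.
-/

namespace NCG

/-! ### Singular values and sorted eigenvectors of compact positive operators -/

section Spectral

variable {H : Type*} [NormedAddCommGroup H] [InnerProductSpace ℂ H]

theorem singularValue_le {k : ℕ} {A F : H →L[ℂ] H}
    (hF : LinearMap.rank (F : H →ₗ[ℂ] H) ≤ k) : singularValue k A ≤ ‖A - F‖ :=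
  ciInf_le ⟨0, by rintro _ ⟨G, rfl⟩; exact norm_nonneg _⟩
    (⟨F, hF⟩ : {F : H →L[ℂ] H // LinearMap.rank (F : H →ₗ[ℂ] H) ≤ k})

theorem le_singularValue_of_forall {k : ℕ} {A : H →L[ℂ] H} {c : ℝ}
    (h : ∀ F : H →L[ℂ] H, LinearMap.rank (F : H →ₗ[ℂ] H) ≤ k → c ≤ ‖A - F‖) :
    c ≤ singularValue k A := by
  have : Nonempty {F : H →L[ℂ] H // LinearMap.rank (F : H →ₗ[ℂ] H) ≤ k} := ⟨⟨0, by simp⟩⟩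
  exact le_ciInf fun F => h F.1 F.2

theorem exists_rank_le_norm_lt {k : ℕ} {A : H →L[ℂ] H} {c : ℝ} (h : singularValue k A < c) :
    ∃ F : H →L[ℂ] H, LinearMap.rank (F : H →ₗ[ℂ] H) ≤ k ∧ ‖A - F‖ < c := by
  by_contra! hc
  exact absurd (le_singularValue_of_forall hc) (not_le.2 h)

theorem singularValue_mul_le (T A : H →L[ℂ] H) (k : ℕ) :
    singularValue k (T * A) ≤ ‖T‖ * singularValue k A := by
  refine le_of_forall_pos_le_add fun ε hε => ?_
  have hpos : 0 < ‖T‖ + 1 := by positivity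
  obtain ⟨F, hF, hlt⟩ := exists_rank_le_norm_lt
    (show singularValue k A < singularValue k A + ε / (‖T‖ + 1) by
      linarith [div_pos hε hpos])
  have hr : LinearMap.rank ((T * F : H →L[ℂ] H) : H →ₗ[ℂ] H) ≤ k :=
    (LinearMap.rank_comp_le_right (F : H →ₗ[ℂ] H) (T : H →ₗ[ℂ] H)).trans hF
  refine (singularValue_le hr).trans ?_
  rw [← mul_sub]
  refine (norm_mul_le _ _).trans ?_
  calc ‖T‖ * ‖A - F‖ ≤ ‖T‖ * (singularValue k A + ε / (‖T‖ + 1)) := by gcongr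
    _ = ‖T‖ * singularValue k A + ε * (‖T‖ / (‖T‖ + 1)) := by ring
    _ ≤ ‖T‖ * singularValue k A + ε * 1 := by
      gcongr
      rw [div_le_one hpos]
      linarith
    _ = _ := by ring

/-- An operator with `n + 1` orthonormal eigenvectors for eigenvalues of modulus at least `c`
cannot be approximated to within less than `c` by an operator of rank `n`. -/
theorem le_singularValue {n : ℕ} {A : H →L[ℂ] H} {v : Fin (n + 1) → H} (hv : Orthonormal ℂ v)
    {m : Fin (n + 1) → ℂ} (hm : ∀ i, A (v i) = m i • v i) {c : ℝ} (hc : ∀ i, c ≤ ‖m i‖) :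
    c ≤ singularValue n A := by
  rcases le_total c 0 with h0 | h0
  · exact h0.trans (singularValue_nonneg _ _)
  refine le_singularValue_of_forall fun F hF => ?_
  let φ : (Fin (n + 1) → ℂ) →ₗ[ℂ] H := (F : H →ₗ[ℂ] H) ∘ₗ Fintype.linearCombination ℂ v
  have hφ : LinearMap.rank φ ≤ n := (LinearMap.rank_comp_le_left _ _).trans hF
  have hker : LinearMap.ker φ ≠ ⊥ := by
    intro hbot
    have h1 := LinearMap.finrank_range_of_inj (LinearMap.ker_eq_bot.1 hbot)
    have h2 : Module.finrank ℂ (LinearMap.range φ) ≤ n := Module.finrank_le_of_rank_le hφ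
    rw [h1, Module.finrank_fin_fun] at h2
    omega
  obtain ⟨a, ha, ha0⟩ := Submodule.exists_mem_ne_zero_of_ne_bot hker
  have hnorm : ∀ b : Fin (n + 1) → ℂ, ‖∑ i, b i • v i‖ ^ 2 = ∑ i, ‖b i‖ ^ 2 := by
    intro b
    have h1 := hv.inner_sum b b Finset.univ
    rw [inner_self_eq_norm_sq_to_K] at h1
    have h2 : ((‖∑ i, b i • v i‖ ^ 2 : ℝ) : ℂ) = ((∑ i, ‖b i‖ ^ 2 : ℝ) : ℂ) := by
      push_cast
      rw [show ((‖∑ i, b i • v i‖ : ℝ) : ℂ) ^ 2 = _ from h1]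
      exact Finset.sum_congr rfl fun i _ => by rw [Complex.conj_mul']
    exact_mod_cast h2
  set z : H := ∑ i, a i • v i with hz
  have hFz : F z = 0 := by
    have : φ a = 0 := ha
    simpa [φ, Fintype.linearCombination_apply, hz] using this
  have hAz : A z = ∑ i, (a i * m i) • v i := by
    simp only [hz, map_sum, map_smul, hm, smul_smul]
  have hz0 : z ≠ 0 := by
    intro h
    have h1 := hnorm a
    rw [← hz, h] at h1
    simp only [norm_zero, ne_eq, OfNat.ofNat_ne_zero, not_false_eq_true, zero_pow] at h1
    refine ha0 (funext fun i => ?_)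
    have h2 := (Finset.sum_eq_zero_iff_of_nonneg (fun i _ => sq_nonneg ‖a i‖)).1 h1.symm i
      (Finset.mem_univ _)
    simpa using h2
  have hle : c * ‖z‖ ≤ ‖A z‖ := by
    refine abs_le_of_sq_le_sq' ?_ (norm_nonneg _) |>.2
    rw [mul_pow, hz, hnorm, ← hz, hAz, hnorm, Finset.mul_sum]
    refine Finset.sum_le_sum fun i _ => ?_
    rw [norm_mul, mul_pow, mul_comm]
    gcongr
    exact hc i
  have h3 : ‖A z‖ ≤ ‖A - F‖ * ‖z‖ := by
    simpa [hFz] using (A - F).le_opNorm z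
  exact le_of_mul_le_mul_right (hle.trans h3) (norm_pos_iff.2 hz0)

/-- `x` is an orthonormal sequence of eigenvectors of `B` for the eigenvalues
`l 0 ≥ l 1 ≥ … ≥ 0`, and `B` has norm at most `l n` on the orthogonal complement of
`x 0, …, x (n - 1)`. -/
structure SortedEigen (B : H →L[ℂ] H) (x : ℕ → H) (l : ℕ → ℝ) : Prop where
  orth : Orthonormal ℂ x
  anti : Antitone l
  nonneg : ∀ k, 0 ≤ l k
  eig : ∀ k, B (x k) = (l k : ℂ) • x k
  bound : ∀ n y, (∀ k < n, ⟪x k, y⟫_ℂ = 0) → ‖B y‖ ≤ l n * ‖y‖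

theorem rank_sum_le {ι : Type*} (s : Finset ι) (x y : ι → H) :
    LinearMap.rank ((∑ k ∈ s, (innerSL ℂ (x k)).smulRight (y k) : H →L[ℂ] H) : H →ₗ[ℂ] H) ≤
      s.card := by
  classical
  refine le_trans (Submodule.rank_mono (t := Submodule.span ℂ
    ((s.image y : Finset H) : Set H)) ?_) ?_
  · rintro _ ⟨z, rfl⟩
    simp only [ContinuousLinearMap.coe_coe, sum_apply,
      ContinuousLinearMap.smulRight_apply]
    refine Submodule.sum_mem _ fun k hk => Submodule.smul_mem _ _ (Submodule.subset_span ?_)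
    simpa using ⟨k, hk, rfl⟩
  · refine (rank_span_finset_le _).trans ?_
    exact_mod_cast Finset.card_image_le

theorem inner_sub_sum_eq_zero {ι : Type*} {x : ι → H} (hx : Orthonormal ℂ x) (s : Finset ι) (y : H)
    {k : ι} (hk : k ∈ s) : ⟪x k, y - ∑ j ∈ s, ⟪x j, y⟫_ℂ • x j⟫_ℂ = 0 := by
  classical
  rw [inner_sub_right, inner_sum]
  simp only [inner_smul_right, orthonormal_iff_ite.1 hx]
  simp [hk]

theorem norm_sub_sum_le {ι : Type*} {x : ι → H} (hx : Orthonormal ℂ x) (s : Finset ι) (y : H) :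
    ‖y - ∑ j ∈ s, ⟪x j, y⟫_ℂ • x j‖ ≤ ‖y‖ := by
  set p := ∑ j ∈ s, ⟪x j, y⟫_ℂ • x j with hp
  have h0 : ⟪p, y - p⟫_ℂ = 0 := by
    nth_rw 1 [hp]
    rw [sum_inner]
    refine Finset.sum_eq_zero fun k hk => ?_
    rw [inner_smul_left, inner_sub_sum_eq_zero hx s y hk, mul_zero]
  have h1 := norm_add_sq_eq_norm_sq_add_norm_sq_of_inner_eq_zero p (y - p) h0
  rw [add_sub_cancel] at h1
  nlinarith [norm_nonneg y, norm_nonneg (y - p), mul_self_nonneg ‖p‖]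

/-- If `B` has norm at most `d` on the orthogonal complement of an orthonormal family, then its
truncation to that family approximates it to within `d`. -/
theorem singularValue_le_of_bound {B : H →L[ℂ] H} {ι : Type*} {x : ι → H} (hx : Orthonormal ℂ x)
    (s : Finset ι) {d : ℝ} (hd : 0 ≤ d)
    (h : ∀ y, (∀ k ∈ s, ⟪x k, y⟫_ℂ = 0) → ‖B y‖ ≤ d * ‖y‖) : singularValue s.card B ≤ d := by
  refine (singularValue_le (rank_sum_le s x fun k => B (x k))).trans ?_
  refine ContinuousLinearMap.opNorm_le_bound _ hd fun y => ?_
  have h1 : (B - ∑ k ∈ s, (innerSL ℂ (x k)).smulRight (B (x k))) y =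
      B (y - ∑ j ∈ s, ⟪x j, y⟫_ℂ • x j) := by
    simp
  rw [h1]
  refine (h _ fun k hk => inner_sub_sum_eq_zero hx s y hk).trans ?_
  gcongr
  exact norm_sub_sum_le hx s y

theorem SortedEigen.singularValue_eq {B : H →L[ℂ] H} {x : ℕ → H} {l : ℕ → ℝ}
    (h : SortedEigen B x l) (n : ℕ) : singularValue n B = l n := by
  refine le_antisymm ?_ ?_
  · have := singularValue_le_of_bound h.orth (Finset.range n) (h.nonneg n)
      fun y hy => h.bound n y fun k hk => hy k (Finset.mem_range.2 hk)
    rwa [Finset.card_range] at this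
  refine le_singularValue (v := fun i : Fin (n + 1) => x i) (m := fun i => (l i : ℂ))
    (h.orth.comp _ Fin.val_injective) (fun i => h.eig i) fun i => ?_
  rw [Complex.norm_real, Real.norm_of_nonneg (h.nonneg _)]
  exact h.anti (by omega)

theorem inner_apply_right_of_nonneg {K : H →L[ℂ] H} (h0 : 0 ≤ K) (x y : H) :
    ⟪K x, y⟫_ℂ = ⟪x, K y⟫_ℂ :=
  ((ContinuousLinearMap.nonneg_iff_isPositive K).1 h0).isSymmetric x y

/-- The square root of a positive operator has the same sorted eigenvectors. -/
theorem SortedEigen.sqrt {B : H →L[ℂ] H} (h0 : 0 ≤ B) {x : ℕ → H} {l : ℕ → ℝ}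
    (h : SortedEigen (B * B) x l) : SortedEigen B x fun k => √(l k) := by
  have hsq : ∀ y, ((‖B y‖ ^ 2 : ℝ) : ℂ) = ⟪y, (B * B) y⟫_ℂ := by
    intro y
    change _ = ⟪y, B (B y)⟫_ℂ
    rw [← inner_apply_right_of_nonneg h0, inner_self_eq_norm_sq_to_K]
    simp
  refine ⟨h.orth, fun i j hij => Real.sqrt_le_sqrt (h.anti hij), fun k => Real.sqrt_nonneg _,
    fun k => ?_, fun n y hy => ?_⟩
  · rcases (h.nonneg k).eq_or_lt with hl | hl
    · have h1 := hsq (x k)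
      rw [h.eig, ← hl] at h1
      have h2 : B (x k) = 0 := by simpa using h1
      simp [h2, ← hl]
    · -- `B + √l` is injective and `(B + √l) (B - √l) x = 0`
      set s := √(l k) with hs
      have hs0 : 0 < s := Real.sqrt_pos.2 hl
      have hss : (s : ℂ) * s = l k := by
        rw [← Complex.ofReal_mul, hs, Real.mul_self_sqrt hl.le]
      set w := B (x k) - (s : ℂ) • x k with hw
      have hBw : B w = -(s : ℂ) • w := by
        have : B (B (x k)) = (l k : ℂ) • x k := h.eig k
        rw [hw, map_sub, map_smul, this, smul_sub, smul_smul, neg_mul, hss, neg_smul, neg_smul]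
        abel
      have hpos : 0 ≤ (⟪w, B w⟫_ℂ).re :=
        ((ContinuousLinearMap.nonneg_iff_isPositive B).1 h0).re_inner_nonneg_right w
      rw [hBw, inner_smul_right, inner_self_eq_norm_sq_to_K] at hpos
      have h3 : (-(s : ℂ) * ((‖w‖ : ℝ) : ℂ) ^ 2).re = -s * ‖w‖ ^ 2 := by
        rw [← Complex.ofReal_neg, ← Complex.ofReal_pow, ← Complex.ofReal_mul, Complex.ofReal_re]
      have h4 : 0 ≤ -s * ‖w‖ ^ 2 := h3 ▸ hpos
      have h5 : ‖w‖ = 0 := by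
        by_contra hne
        have : 0 < ‖w‖ ^ 2 := by positivity
        nlinarith
      exact sub_eq_zero.1 (norm_eq_zero.1 h5)
  · refine abs_le_of_sq_le_sq' ?_ (by have := norm_nonneg y; positivity) |>.2
    have h1 : ‖B y‖ ^ 2 ≤ ‖y‖ * ‖(B * B) y‖ := by
      have h2 := norm_inner_le_norm (𝕜 := ℂ) y ((B * B) y)
      rwa [← hsq, Complex.norm_real, Real.norm_of_nonneg (sq_nonneg _)] at h2
    rw [mul_pow, Real.sq_sqrt (h.nonneg n)]
    refine h1.trans ?_
    have := mul_le_mul_of_nonneg_left (h.bound n y hy) (norm_nonneg y)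
    linarith

theorem isCompactOperator_of_rank_le {F : H →L[ℂ] H} {k : ℕ}
    (hF : LinearMap.rank (F : H →ₗ[ℂ] H) ≤ k) : IsCompactOperator F := by
  have hfin : FiniteDimensional ℂ (LinearMap.range (F : H →ₗ[ℂ] H)) :=
    Module.rank_lt_aleph0_iff.1 (lt_of_le_of_lt hF (Cardinal.natCast_lt_aleph0 (n := k)))
  have : ProperSpace (LinearMap.range (F : H →ₗ[ℂ] H)) := FiniteDimensional.proper ℂ _
  let G := F.codRestrict (LinearMap.range (F : H →ₗ[ℂ] H)) fun y => LinearMap.mem_range_self _ _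
  have h1 : IsCompactOperator G := isCompactOperator_of_locallyCompactSpace_dom G
  exact h1.clm_comp (LinearMap.range (F : H →ₗ[ℂ] H)).subtypeL

variable [CompleteSpace H]

theorem isCompactOperator_of_singularValue {A : H →L[ℂ] H}
    (h : ∀ ε > 0, ∃ n, singularValue n A < ε) : IsCompactOperator A := by
  have h1 : ∀ j : ℕ, ∃ F : H →L[ℂ] H, IsCompactOperator F ∧ ‖A - F‖ < 1 / ((j : ℝ) + 1) := by
    intro j
    obtain ⟨n, hn⟩ := h (1 / ((j : ℝ) + 1)) (by positivity)
    obtain ⟨F, hF, hlt⟩ := exists_rank_le_norm_lt hn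
    exact ⟨F, isCompactOperator_of_rank_le hF, hlt⟩
  choose F hF hlt using h1
  refine isCompactOperator_of_tendsto (l := Filter.atTop) (F := F) ?_
    (Filter.Eventually.of_forall hF)
  rw [tendsto_iff_norm_sub_tendsto_zero]
  refine squeeze_zero (fun _ => norm_nonneg _) (fun j => ?_)
    (tendsto_one_div_add_atTop_nhds_zero_nat (𝕜 := ℝ))
  rw [norm_sub_rev]
  exact (hlt j).le

theorem exists_eigenvector_norm {K : H →L[ℂ] H} (hK : IsCompactOperator K) (h0 : 0 ≤ K)
    (hne : K ≠ 0) : ∃ x : H, ‖x‖ = 1 ∧ K x = ((‖K‖ : ℝ) : ℂ) • x := by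
  have : Nontrivial (H →L[ℂ] H) := ⟨K, 0, hne⟩
  have h1 : ‖K‖ ∈ spectrum ℝ K := CStarAlgebra.norm_mem_spectrum_of_nonneg
  have h2 : ((‖K‖ : ℝ) : ℂ) ∈ spectrum ℂ K := by
    have := spectrum.algebraMap_mem ℂ h1
    simpa using this
  have hn : ((‖K‖ : ℝ) : ℂ) ≠ 0 := by simpa using hne
  obtain ⟨v, hv, hv0⟩ := ((hK.hasEigenvalue_iff_mem_spectrum hn).2 h2).exists_hasEigenvector
  have hv' : K v = ((‖K‖ : ℝ) : ℂ) • v := Module.End.mem_eigenspace_iff.1 hv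
  refine ⟨((‖v‖⁻¹ : ℝ) : ℂ) • v, ?_, ?_⟩
  · rw [norm_smul, Complex.norm_real, norm_inv, norm_norm, inv_mul_cancel₀ (norm_ne_zero_iff.2 hv0)]
  · rw [map_smul, hv', smul_comm]

/-- On the orthogonal complement of an invariant finite dimensional subspace, a compact positive
operator attains its norm at an eigenvector. -/
theorem exists_max_eigenvector {B : H →L[ℂ] H} (hB : IsCompactOperator B) (h0 : 0 ≤ B)
    (hH : ¬ FiniteDimensional ℂ H) (U : Submodule ℂ H) [FiniteDimensional ℂ U]
    (hU : ∀ u ∈ U, B u ∈ U) :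
    ∃ (x : H) (l : ℝ), x ∈ Uᗮ ∧ ‖x‖ = 1 ∧ 0 ≤ l ∧ B x = (l : ℂ) • x ∧
      ∀ y ∈ Uᗮ, ‖B y‖ ≤ l * ‖y‖ := by
  set P : H →L[ℂ] H := Uᗮ.starProjection with hP
  have hPsa : star P = P := (isStarProjection_starProjection (U := Uᗮ)).isSelfAdjoint
  have hinv : ∀ y ∈ Uᗮ, B y ∈ Uᗮ := by
    intro y hy u hu
    rw [← inner_apply_right_of_nonneg h0]
    exact hy _ (hU u hu)
  have hPy : ∀ y ∈ Uᗮ, P y = y := fun y hy => Submodule.starProjection_eq_self_iff.2 hy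
  set K : H →L[ℂ] H := P * B * P with hKdef
  have hK0 : 0 ≤ K := by
    have := star_left_conjugate_nonneg h0 P
    rwa [hPsa] at this
  have hKc : IsCompactOperator K := (hB.clm_comp P).comp_clm P
  have hKy : ∀ y ∈ Uᗮ, K y = B y := by
    intro y hy
    change P (B (P y)) = B y
    rw [hPy y hy, hPy _ (hinv y hy)]
  by_cases hK : K = 0
  · have hne : Uᗮ ≠ ⊥ := by
      intro h
      rw [Submodule.orthogonal_eq_bot_iff] at h
      refine hH ?_
      have : FiniteDimensional ℂ (⊤ : Submodule ℂ H) := h ▸ inferInstance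
      exact Module.finite_def.2 (Module.Finite.iff_fg.1 this)
    obtain ⟨v, hv, hv0⟩ := Submodule.exists_mem_ne_zero_of_ne_bot hne
    have hB0 : ∀ y ∈ Uᗮ, B y = 0 := fun y hy => by rw [← hKy y hy, hK]; rfl
    refine ⟨((‖v‖⁻¹ : ℝ) : ℂ) • v, 0, Submodule.smul_mem _ _ hv, ?_, le_rfl, ?_, fun y hy => ?_⟩
    · rw [norm_smul, Complex.norm_real, norm_inv, norm_norm,
        inv_mul_cancel₀ (norm_ne_zero_iff.2 hv0)]
    · simp [hB0 v hv]
    · simp [hB0 y hy]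
  · obtain ⟨x, hx1, hx⟩ := exists_eigenvector_norm hKc hK0 hK
    have hn : ((‖K‖ : ℝ) : ℂ) ≠ 0 := by simpa using hK
    have hxU : x ∈ Uᗮ := by
      have h1 : x = ((‖K‖ : ℝ) : ℂ)⁻¹ • P (B (P x)) := by
        rw [show P (B (P x)) = K x from rfl, hx, smul_smul, inv_mul_cancel₀ hn, one_smul]
      rw [h1]
      exact Submodule.smul_mem _ _ (Submodule.starProjection_apply_mem _ _)
    refine ⟨x, ‖K‖, hxU, hx1, norm_nonneg _, ?_, fun y hy => ?_⟩
    · rw [← hKy x hxU, hx]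
    · rw [← hKy y hy]
      exact K.le_opNorm y

/-- Spectral theorem for compact positive operators, in the form of a maximising sequence:
the next eigenvector is one at which `B` attains its norm on the orthogonal complement of its
predecessors. -/
theorem exists_sortedEigen {B : H →L[ℂ] H} (hB : IsCompactOperator B) (h0 : 0 ≤ B)
    (hH : ¬ FiniteDimensional ℂ H) : ∃ (x : ℕ → H) (l : ℕ → ℝ), SortedEigen B x l := by
  have step : ∀ U : {U : Submodule ℂ H // FiniteDimensional ℂ U ∧ ∀ u ∈ U, B u ∈ U},
      ∃ (x : H) (l : ℝ), x ∈ U.1ᗮ ∧ ‖x‖ = 1 ∧ 0 ≤ l ∧ B x = (l : ℂ) • x ∧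
        ∀ y ∈ U.1ᗮ, ‖B y‖ ≤ l * ‖y‖ := by
    rintro ⟨U, hfin, hU⟩
    exact exists_max_eigenvector hB h0 hH U hU
  choose X l hXm hX1 hl hXe hXb using step
  let next : {U : Submodule ℂ H // FiniteDimensional ℂ U ∧ ∀ u ∈ U, B u ∈ U} →
      {U : Submodule ℂ H // FiniteDimensional ℂ U ∧ ∀ u ∈ U, B u ∈ U} := fun U =>
    ⟨U.1 ⊔ Submodule.span ℂ {X U}, by
      have := U.2.1
      infer_instance, by
      intro u hu
      obtain ⟨a, ha, b, hb, rfl⟩ := Submodule.mem_sup.1 hu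
      obtain ⟨c, rfl⟩ := Submodule.mem_span_singleton.1 hb
      rw [map_add, map_smul, hXe]
      exact Submodule.add_mem_sup (U.2.2 a ha) (Submodule.smul_mem _ _
        (Submodule.smul_mem _ _ (Submodule.mem_span_singleton_self _)))⟩
  -- `W n` is spanned by the first `n` eigenvectors
  let W : ℕ → {U : Submodule ℂ H // FiniteDimensional ℂ U ∧ ∀ u ∈ U, B u ∈ U} := fun n =>
    next^[n] ⟨⊥, inferInstance, by simp⟩
  have hW : ∀ n, (W (n + 1)).1 = (W n).1 ⊔ Submodule.span ℂ {X (W n)} := by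
    intro n
    simp only [W, Function.iterate_succ_apply']
    rfl
  have hmono : Monotone fun n => (W n).1 :=
    monotone_nat_of_le_succ fun n => by rw [hW]; exact le_sup_left
  have hmem : ∀ {k n}, k < n → X (W k) ∈ (W n).1 := fun {k n} hkn =>
    hmono (show k + 1 ≤ n from hkn)
      (by
        change X (W k) ∈ (W (k + 1)).1
        rw [hW]
        exact Submodule.mem_sup_right (Submodule.mem_span_singleton_self _))
  have hperp : ∀ n y, (∀ k < n, ⟪X (W k), y⟫_ℂ = 0) → y ∈ (W n).1ᗮ := by
    intro n y
    induction n with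
    | zero =>
      intro _
      change y ∈ (⊥ : Submodule ℂ H)ᗮ
      simp
    | succ n ih =>
      intro h
      rw [hW, ← Submodule.inf_orthogonal]
      refine ⟨ih fun k hk => h k (by omega), ?_⟩
      exact Submodule.mem_orthogonal_singleton_iff_inner_right.2 (h n (by omega))
  refine ⟨fun n => X (W n), fun n => l (W n), ⟨fun n => hX1 _, ?_⟩, ?_, fun n => hl _,
    fun n => hXe _, fun n y hy => hXb _ _ (hperp n y hy)⟩
  · intro i j hij
    rcases lt_or_gt_of_ne hij with h | h
    · exact hXm (W j) _ (hmem h)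
    · rw [← inner_conj_symm]
      change (starRingEnd ℂ) ⟪X (W j), X (W i)⟫_ℂ = 0
      rw [hXm (W i) _ (hmem h), map_zero]
  · refine antitone_nat_of_succ_le fun n => ?_
    have h1 := hXb (W n) (X (W (n + 1)))
      (Submodule.orthogonal_le (hmono n.le_succ) (hXm (W (n + 1))))
    rwa [hXe, norm_smul, hX1, mul_one, mul_one, Complex.norm_real,
      Real.norm_of_nonneg (hl _)] at h1

end Spectral

/-! ### Partial sums of eigenvalues and of diagonal entries -/

section PartialSums

variable {H : Type*} [NormedAddCommGroup H] [InnerProductSpace ℂ H]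

/-- If the quadratic form of `A` is at most `d` on the orthogonal complement of an orthonormal
family in a finite dimensional subspace `U`, then the sum of its diagonal entries differs from the
trace of the compression of `A` to `U` by at most `d` times the codimension. -/
theorem abs_trace_compression_sub_le (A : H →L[ℂ] H) (U : Submodule ℂ H) [FiniteDimensional ℂ U]
    {ι : Type*} [Fintype ι] {s : ι → H} (hs : Orthonormal ℂ s) (hsU : ∀ i, s i ∈ U) {d : ℝ}
    (h : ∀ z, ‖z‖ = 1 → (∀ i, ⟪s i, z⟫_ℂ = 0) → |(⟪z, A z⟫_ℂ).re| ≤ d) :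
    |(LinearMap.trace ℂ U ((U.orthogonalProjectionOnto : H →L[ℂ] U) ∘L A ∘L U.subtypeL :
      U →ₗ[ℂ] U)).re - ∑ i, (⟪s i, A (s i)⟫_ℂ).re| ≤
      d * ((Module.finrank ℂ U : ℝ) - Fintype.card ι) := by
  classical
  let s' : ι → U := fun i => ⟨s i, hsU i⟩
  have hs' : Orthonormal ℂ s' := by
    rw [orthonormal_iff_ite] at hs ⊢
    intro i j
    exact hs i j
  obtain ⟨u, b, hvu, hb⟩ := hs'.toSubtypeRange.exists_orthonormalBasis_extension
  have hcard : u.card = Module.finrank ℂ U := by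
    rw [Module.finrank_eq_card_basis b.toBasis, Fintype.card_coe]
  rw [LinearMap.trace_eq_sum_inner _ b, Complex.re_sum]
  have hterm : ∀ x : u, (⟪b x, (((U.orthogonalProjectionOnto : H →L[ℂ] U) ∘L A ∘L U.subtypeL :
      U →ₗ[ℂ] U)) (b x)⟫_ℂ).re = (⟪((x : U) : H), A ((x : U) : H)⟫_ℂ).re := by
    intro x
    rw [hb]
    congr 1
    exact Submodule.inner_orthogonalProjectionOnto_eq_of_mem_left (x : U) (A ((x : U) : H))
  rw [Finset.sum_congr rfl fun x _ => hterm x,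
    Finset.sum_coe_sort u fun x : U => (⟪(x : H), A (x : H)⟫_ℂ).re]
  have himg : Finset.univ.image s' ⊆ u := by
    intro x hx
    obtain ⟨i, -, rfl⟩ := Finset.mem_image.1 hx
    exact hvu ⟨i, rfl⟩
  have hinj : Function.Injective s' := hs'.linearIndependent.injective
  rw [← Finset.sum_sdiff himg, Finset.sum_image fun i _ j _ hij => hinj hij]
  simp only [s', add_sub_cancel_right]
  have hc2 : ((u \ Finset.univ.image s').card : ℝ) =
      (Module.finrank ℂ U : ℝ) - Fintype.card ι := by
    rw [Finset.card_sdiff_of_subset himg, Finset.card_image_of_injective _ hinj, Nat.cast_sub,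
      hcard, Finset.card_univ]
    rw [← Finset.card_image_of_injective _ hinj]
    exact Finset.card_le_card himg
  rw [← hc2, mul_comm, ← nsmul_eq_mul]
  refine (Finset.abs_sum_le_sum_abs _ _).trans (Finset.sum_le_card_nsmul _ _ _ fun x hx => ?_)
  obtain ⟨hxu, hxs⟩ := Finset.mem_sdiff.1 hx
  have hbx : b ⟨x, hxu⟩ = x := by rw [hb]
  refine h _ ?_ fun i => ?_
  · have := b.orthonormal.1 ⟨x, hxu⟩
    rwa [hbx] at this
  · have hne : (⟨s' i, hvu ⟨i, rfl⟩⟩ : u) ≠ ⟨x, hxu⟩ := by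
      intro he
      exact hxs (Finset.mem_image.2 ⟨i, Finset.mem_univ _, congrArg Subtype.val he⟩)
    have := b.orthonormal.2 hne
    rw [hb] at this
    exact this

/-- Two orthonormal families, on the orthogonal complement of each of which the quadratic form of
`A` is small, have almost the same sum of diagonal entries of `A`: both sums are compared with the
trace of the compression of `A` to the span of the two families. -/
theorem abs_sum_inner_sub_sum_inner_le (A : H →L[ℂ] H) {ι κ : Type*} [Fintype ι] [Fintype κ]
    {s : ι → H} {t : κ → H} (hs : Orthonormal ℂ s) (ht : Orthonormal ℂ t) {d : ℝ} (hd : 0 ≤ d)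
    (h : ∀ z, ‖z‖ = 1 → (∀ i, ⟪s i, z⟫_ℂ = 0) → |(⟪z, A z⟫_ℂ).re| ≤ d)
    (h' : ∀ z, ‖z‖ = 1 → (∀ i, ⟪t i, z⟫_ℂ = 0) → |(⟪z, A z⟫_ℂ).re| ≤ d) :
    |∑ i, (⟪s i, A (s i)⟫_ℂ).re - ∑ i, (⟪t i, A (t i)⟫_ℂ).re| ≤
      d * (Fintype.card ι + Fintype.card κ) := by
  set U : Submodule ℂ H := Submodule.span ℂ (Set.range s) ⊔ Submodule.span ℂ (Set.range t)
  have : FiniteDimensional ℂ (Submodule.span ℂ (Set.range s)) :=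
    FiniteDimensional.span_of_finite ℂ (Set.finite_range s)
  have : FiniteDimensional ℂ (Submodule.span ℂ (Set.range t)) :=
    FiniteDimensional.span_of_finite ℂ (Set.finite_range t)
  have h1 := abs_trace_compression_sub_le A U hs
    (fun i => Submodule.mem_sup_left (Submodule.subset_span ⟨i, rfl⟩)) h
  have h2 := abs_trace_compression_sub_le A U ht
    (fun i => Submodule.mem_sup_right (Submodule.subset_span ⟨i, rfl⟩)) h'
  have hU : (Module.finrank ℂ U : ℝ) ≤ Fintype.card ι + Fintype.card κ := by
    have := Submodule.finrank_add_le_finrank_add_finrank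
      (Submodule.span ℂ (Set.range s)) (Submodule.span ℂ (Set.range t))
    have h3 := finrank_range_le_card (R := ℂ) s
    have h4 := finrank_range_le_card (R := ℂ) t
    simp only [Set.finrank] at h3 h4
    exact_mod_cast this.trans (add_le_add h3 h4)
  rw [abs_le] at h1 h2 ⊢
  have := mul_le_mul_of_nonneg_left hU hd
  constructor <;> nlinarith [h1.1, h1.2, h2.1, h2.2]

/-- In `SortedEigen.bound`, only the eigenvectors of positive eigenvalues matter. -/
theorem SortedEigen.bound_of_pos {B : H →L[ℂ] H} {x : ℕ → H} {l : ℕ → ℝ} (h : SortedEigen B x l)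
    (n : ℕ) (y : H) (hy : ∀ k < n, 0 < l k → ⟪x k, y⟫_ℂ = 0) : ‖B y‖ ≤ l n * ‖y‖ := by
  classical
  by_cases hp : ∀ k < n, 0 < l k
  · exact h.bound n y fun k hk => hy k hk (hp k hk)
  · push Not at hp
    obtain ⟨hlt, hle⟩ := Nat.find_spec hp
    have h1 := h.bound (Nat.find hp) y fun k hk => by
      have := Nat.find_min hp hk
      push Not at this
      exact hy k (hk.trans hlt) (this (hk.trans hlt))
    refine h1.trans ?_
    have := h.nonneg n
    gcongr
    linarith

/-- Weyl's inequality: if the quadratic form of `A` is at most `c` on a subspace of codimension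
`n`, then of `n + 1` orthonormal eigenvectors at least one has eigenvalue at most `c`. -/
theorem eigenvalue_le_of_form_le {A : H →L[ℂ] H} {e x : ℕ → H} (hx : Orthonormal ℂ x) {n : ℕ}
    {b : ℕ → ℝ} (hb : ∀ k ≤ n, A (x k) = (b k : ℂ) • x k) (hmono : ∀ k ≤ n, b n ≤ b k) {c : ℝ}
    (h : ∀ z, (∀ k < n, ⟪e k, z⟫_ℂ = 0) → (⟪z, A z⟫_ℂ).re ≤ c * ‖z‖ ^ 2) : b n ≤ c := by
  let φ : (Fin (n + 1) → ℂ) →ₗ[ℂ] (Fin n → ℂ) :=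
    LinearMap.pi (fun k : Fin n => (innerSL ℂ (e k) : H →ₗ[ℂ] ℂ)) ∘ₗ
      Fintype.linearCombination ℂ (fun i : Fin (n + 1) => x i)
  have hker : LinearMap.ker φ ≠ ⊥ := LinearMap.ker_ne_bot_of_finrank_lt (by simp)
  obtain ⟨a, ha, ha0⟩ := Submodule.exists_mem_ne_zero_of_ne_bot hker
  have hx' : Orthonormal ℂ fun i : Fin (n + 1) => x i := hx.comp _ Fin.val_injective
  set z : H := ∑ i, a i • x (i : Fin (n + 1)) with hz
  have hAz : A z = ∑ i, (a i * (b i : ℂ)) • x (i : Fin (n + 1)) := by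
    rw [hz, map_sum]
    refine Finset.sum_congr rfl fun i _ => ?_
    rw [map_smul, hb i (by omega), smul_smul]
  have hze : ∀ k < n, ⟪e k, z⟫_ℂ = 0 := by
    intro k hk
    have h1 : φ a ⟨k, hk⟩ = 0 := by rw [LinearMap.mem_ker.1 ha]; rfl
    simpa [φ, Fintype.linearCombination_apply, hz] using h1
  have h1 := hx'.inner_sum a a Finset.univ
  have h2 := hx'.inner_sum a (fun i => a i * (b i : ℂ)) Finset.univ
  rw [← hz, inner_self_eq_norm_sq_to_K] at h1
  rw [← hz, ← hAz] at h2
  have h1' : ‖z‖ ^ 2 = ∑ i, ‖a i‖ ^ 2 := by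
    have : ((‖z‖ ^ 2 : ℝ) : ℂ) = ((∑ i, ‖a i‖ ^ 2 : ℝ) : ℂ) := by
      push_cast
      rw [show ((‖z‖ : ℝ) : ℂ) ^ 2 = _ from h1]
      exact Finset.sum_congr rfl fun i _ => by rw [Complex.conj_mul']
    exact_mod_cast this
  have h2' : (⟪z, A z⟫_ℂ).re = ∑ i : Fin (n + 1), ‖a i‖ ^ 2 * b i := by
    have : ⟪z, A z⟫_ℂ = ((∑ i : Fin (n + 1), ‖a i‖ ^ 2 * b i : ℝ) : ℂ) := by
      push_cast
      rw [h2]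
      exact Finset.sum_congr rfl fun i _ => by rw [← mul_assoc, Complex.conj_mul']
    rw [this, Complex.ofReal_re]
  have hle : b n * ‖z‖ ^ 2 ≤ c * ‖z‖ ^ 2 := by
    refine le_trans ?_ (h z hze)
    rw [h1', h2', Finset.mul_sum]
    refine Finset.sum_le_sum fun i _ => ?_
    rw [mul_comm]
    gcongr
    exact hmono i (by omega)
  refine le_of_mul_le_mul_right hle ?_
  rw [h1']
  obtain ⟨i, hi⟩ := Function.ne_iff.1 ha0
  exact Finset.sum_pos' (fun i _ => sq_nonneg _)
    ⟨i, Finset.mem_univ _, by have := norm_pos_iff.2 hi; positivity⟩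

variable [CompleteSpace H]

/-- The eigenvectors of `A⁺` for positive eigenvalues are eigenvectors of `A`. -/
theorem exists_sortedEigen_posPart {A : H →L[ℂ] H} (hA : IsSelfAdjoint A)
    (hc : IsCompactOperator A) (hH : ¬ FiniteDimensional ℂ H) :
    ∃ (x : ℕ → H) (b : ℕ → ℝ), SortedEigen A⁺ x b ∧ ∀ k, 0 < b k → A (x k) = (b k : ℂ) • x k := by
  have h0 : (0 : H →L[ℂ] H) ≤ A⁺ := CFC.posPart_nonneg A
  have hsub : A⁺ - A⁻ = A := CFC.posPart_sub_negPart A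
  have hmul : A * A⁺ = A⁺ * A⁺ := by
    nth_rw 1 [← hsub]
    rw [sub_mul, CFC.negPart_mul_posPart, sub_zero]
  -- compactness is inherited by `A⁺ * A⁺ = A * A⁺`, whose square root is `A⁺`
  have hc2 : IsCompactOperator (A⁺ * A⁺ : H →L[ℂ] H) := by
    rw [← hmul]
    exact hc.comp_clm (A⁺)
  have h02 : (0 : H →L[ℂ] H) ≤ A⁺ * A⁺ := (IsSelfAdjoint.of_nonneg h0).mul_self_nonneg
  obtain ⟨x, l, hx⟩ := exists_sortedEigen hc2 h02 hH
  have hs := hx.sqrt h0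
  refine ⟨x, _, hs, fun k hk => ?_⟩
  have h1 : A (A⁺ (x k)) = A⁺ (A⁺ (x k)) := congrArg (fun S : H →L[ℂ] H => S (x k)) hmul
  have hne : ((√(l k) : ℝ) : ℂ) ≠ 0 := by exact_mod_cast hk.ne'
  rw [hs.eig, map_smul, map_smul, hs.eig] at h1
  exact smul_right_injective H hne h1

theorem exists_sortedEigen_negPart {A : H →L[ℂ] H} (hA : IsSelfAdjoint A)
    (hc : IsCompactOperator A) (hH : ¬ FiniteDimensional ℂ H) :
    ∃ (x : ℕ → H) (b : ℕ → ℝ), SortedEigen A⁻ x b ∧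
      ∀ k, 0 < b k → A (x k) = -(b k : ℂ) • x k := by
  obtain ⟨x, b, h1, h2⟩ := exists_sortedEigen_posPart hA.neg (A := -A) hc.neg hH
  rw [CFC.posPart_neg] at h1
  refine ⟨x, b, h1, fun k hk => ?_⟩
  have := h2 k hk
  rw [neg_smul, ← this]
  simp

theorem realPart_apply_form (B : H →L[ℂ] H) (z : H) :
    (⟪z, (realPart B : H →L[ℂ] H) z⟫_ℂ).re = (⟪z, B z⟫_ℂ).re := by
  rw [realPart_apply_coe, ContinuousLinearMap.star_eq_adjoint]
  have : ((2 : ℝ)⁻¹ • (B + ContinuousLinearMap.adjoint B)) z =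
      ((2⁻¹ : ℝ) : ℂ) • (B z + ContinuousLinearMap.adjoint B z) := by
    rw [Complex.coe_smul]
    rfl
  rw [this, inner_smul_right, inner_add_right, ContinuousLinearMap.adjoint_inner_right,
    ← inner_conj_symm (B z) z, Complex.re_ofReal_mul, Complex.add_re, Complex.conj_re]
  ring

/-- For `A = Re (T V)`, where `V` is positive and compact with eigenvalues `O(1 / (k + 1))`: the
partial sums of the eigenvalues of `A` differ from those of the diagonal entries of `A` in the
sorted eigenbasis of `V` by a bounded amount. Off the first `n` vectors of either family the form of
`A` is `O(1 / n)`, and the two families span at most `3 n` dimensions. -/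
theorem exists_abs_sum_singularValue_sub_le (hH : ¬ FiniteDimensional ℂ H) {V : H →L[ℂ] H}
    (hV0 : 0 ≤ V) {e : ℕ → H} {v : ℕ → ℝ} (hV : SortedEigen V e v) {C : ℝ}
    (hC : ∀ k : ℕ, v k ≤ C / (k + 1)) (T : H →L[ℂ] H) :
    IsWeakL1 (realPart (T * V) : H →L[ℂ] H)⁺ ∧ IsWeakL1 (realPart (T * V) : H →L[ℂ] H)⁻ ∧
    ∃ K : ℝ, ∀ n : ℕ,
      |∑ k ∈ Finset.range n, (⟪e k, T (e k)⟫_ℂ).re * v k -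
        (∑ k ∈ Finset.range n, singularValue k (realPart (T * V) : H →L[ℂ] H)⁺ -
          ∑ k ∈ Finset.range n, singularValue k (realPart (T * V) : H →L[ℂ] H)⁻)| ≤ K := by
  have hC0 : 0 ≤ C := by simpa using (hV.nonneg 0).trans (hC 0)
  set A : H →L[ℂ] H := (realPart (T * V) : H →L[ℂ] H) with hA
  have hAsa : IsSelfAdjoint A := (realPart (T * V)).2
  have hVc : IsCompactOperator V := by
    refine isCompactOperator_of_singularValue fun ε hε => ?_
    obtain ⟨n, hn⟩ := exists_nat_gt (C / ε)
    refine ⟨n, ?_⟩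
    rw [hV.singularValue_eq]
    refine (hC n).trans_lt ?_
    rw [div_lt_iff₀ (by positivity)]
    rw [div_lt_iff₀ hε] at hn
    nlinarith
  have hAc : IsCompactOperator A := by
    have h1 : IsCompactOperator (T * V : H →L[ℂ] H) := hVc.clm_comp T
    have h2 : IsCompactOperator (star (T * V) : H →L[ℂ] H) := by
      rw [star_mul, (IsSelfAdjoint.of_nonneg hV0).star_eq]
      exact hVc.comp_clm (star T)
    rw [hA, realPart_apply_coe]
    exact (h1.add h2).smul (2⁻¹ : ℝ)
  -- the quadratic form is small away from the first `n` eigenvectors of `V`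
  have hform : ∀ n z, (∀ k < n, ⟪e k, z⟫_ℂ = 0) →
      |(⟪z, A z⟫_ℂ).re| ≤ ‖T‖ * v n * ‖z‖ ^ 2 := by
    intro n z hz
    rw [hA, realPart_apply_form]
    refine (Complex.abs_re_le_norm _).trans ((norm_inner_le_norm _ _).trans ?_)
    have h1 : ‖(T * V) z‖ ≤ ‖T‖ * (v n * ‖z‖) :=
      (T.le_opNorm _).trans (mul_le_mul_of_nonneg_left (hV.bound n z hz) (norm_nonneg _))
    calc ‖z‖ * ‖(T * V) z‖ ≤ ‖z‖ * (‖T‖ * (v n * ‖z‖)) := by gcongr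
      _ = _ := by ring
  obtain ⟨x, b, hx, hxA⟩ := exists_sortedEigen_posPart hAsa hAc hH
  obtain ⟨y, g, hy, hyA⟩ := exists_sortedEigen_negPart hAsa hAc hH
  have hb : ∀ n, b n ≤ ‖T‖ * v n := by
    intro n
    rcases (hx.nonneg n).eq_or_lt with h0 | h0
    · rw [← h0]
      exact mul_nonneg (norm_nonneg _) (hV.nonneg _)
    · exact eigenvalue_le_of_form_le (A := A) (e := e) hx.orth
        (fun k hk => hxA k (h0.trans_le (hx.anti hk))) (fun k hk => hx.anti hk)
        fun z hz => (le_abs_self _).trans (hform n z hz)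
  have hg : ∀ n, g n ≤ ‖T‖ * v n := by
    intro n
    rcases (hy.nonneg n).eq_or_lt with h0 | h0
    · rw [← h0]
      exact mul_nonneg (norm_nonneg _) (hV.nonneg _)
    · refine eigenvalue_le_of_form_le (A := -A) (e := e) hy.orth
        (fun k hk => ?_) (fun k hk => hy.anti hk) fun z hz => ?_
      · rw [neg_apply, hyA k (h0.trans_le (hy.anti hk)), neg_smul, neg_neg]
      · rw [neg_apply, inner_neg_right, Complex.neg_re]
        exact (neg_le_abs _).trans (hform n z hz)
  have hTv : ∀ n : ℕ, ‖T‖ * v n ≤ ‖T‖ * C / (n + 1) := fun n => by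
    rw [mul_div_assoc]
    exact mul_le_mul_of_nonneg_left (hC n) (norm_nonneg _)
  refine ⟨⟨‖T‖ * C, fun k => ?_⟩, ⟨‖T‖ * C, fun k => ?_⟩, 6 * (‖T‖ * C), fun n => ?_⟩
  · rw [hx.singularValue_eq]
    exact (hb k).trans (hTv k)
  · rw [hy.singularValue_eq]
    exact (hg k).trans (hTv k)
  simp only [hx.singularValue_eq, hy.singularValue_eq]
  -- the eigenvectors of `A` for the non-zero ones among the first `n` eigenvalues of `A⁺` and `A⁻`
  let t : {k : Fin n // 0 < b k} ⊕ {k : Fin n // 0 < g k} → H :=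
    Sum.elim (fun k => x k.1) fun k => y k.1
  have hcross : ∀ j k, 0 < b j → 0 < g k → ⟪x j, y k⟫_ℂ = 0 := by
    intro j k hj hk
    have h1 : ⟪A (x j), y k⟫_ℂ = ⟪x j, A (y k)⟫_ℂ := by
      rw [← ContinuousLinearMap.adjoint_inner_right, ← ContinuousLinearMap.star_eq_adjoint,
        hAsa.star_eq]
    rw [hxA j hj, hyA k hk, inner_smul_left, inner_smul_right, Complex.conj_ofReal] at h1
    have h2 : ((b j + g k : ℝ) : ℂ) * ⟪x j, y k⟫_ℂ = 0 := by
      push_cast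
      linear_combination h1
    refine (mul_eq_zero.1 h2).resolve_left ?_
    exact_mod_cast (add_pos hj hk).ne'
  have ht : Orthonormal ℂ t := by
    refine ⟨?_, ?_⟩
    · rintro (k | k)
      · exact hx.orth.1 _
      · exact hy.orth.1 _
    · rintro (j | j) (k | k) hjk
      · refine hx.orth.2 fun h => hjk ?_
        rw [Subtype.ext (Fin.ext h)]
      · exact hcross _ _ j.2 k.2
      · change ⟪y j.1, x k.1⟫_ℂ = 0
        rw [← inner_conj_symm, hcross _ _ k.2 j.2, map_zero]
      · refine hy.orth.2 fun h => hjk ?_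
        rw [Subtype.ext (Fin.ext h)]
  have hs : Orthonormal ℂ fun k : Fin n => e k := hV.orth.comp _ Fin.val_injective
  have hd0 : 0 ≤ 2 * (‖T‖ * C / (n + 1)) := by positivity
  have hmain := abs_sum_inner_sub_sum_inner_le A hs ht (d := 2 * (‖T‖ * C / (n + 1))) hd0
    (fun z hz1 hz => by
      refine (hform n z fun k hk => hz ⟨k, hk⟩).trans ?_
      rw [hz1, one_pow, mul_one]
      have := hTv n
      linarith)
    (fun z hz1 hz => by
      have hA' : A z = A⁺ z - A⁻ z := by
        rw [← sub_apply, CFC.posPart_sub_negPart A]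
      have h1 := hx.bound_of_pos n z fun k hk hpos => hz (Sum.inl ⟨⟨k, hk⟩, hpos⟩)
      have h2 := hy.bound_of_pos n z fun k hk hpos => hz (Sum.inr ⟨⟨k, hk⟩, hpos⟩)
      rw [hz1, mul_one] at h1 h2
      refine (Complex.abs_re_le_norm _).trans ((norm_inner_le_norm _ _).trans ?_)
      rw [hz1, one_mul, hA']
      refine (norm_sub_le _ _).trans ?_
      linarith [hb n, hg n, hTv n])
  have hsum1 : ∑ i : Fin n, (⟪e i, A (e i)⟫_ℂ).re =
      ∑ k ∈ Finset.range n, (⟪e k, T (e k)⟫_ℂ).re * v k := by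
    rw [Finset.sum_range fun k => (⟪e k, T (e k)⟫_ℂ).re * v k]
    refine Finset.sum_congr rfl fun k _ => ?_
    rw [hA, realPart_apply_form]
    change (⟪e k, T (V (e k))⟫_ℂ).re = _
    rw [hV.eig, map_smul, inner_smul_right, Complex.re_ofReal_mul, mul_comm]
  have hpos : ∀ f : ℕ → ℝ, (∀ k, 0 ≤ f k) →
      ∑ k : {k : Fin n // 0 < f k}, f k.1 = ∑ k ∈ Finset.range n, f k := by
    intro f hf
    rw [Finset.sum_range fun k => f k,
      ← Finset.sum_subtype (p := fun k : Fin n => 0 < f k) (Finset.univ.filter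
        fun k : Fin n => 0 < f k) (by simp) (fun k : Fin n => f k), Finset.sum_filter]
    refine Finset.sum_congr rfl fun k _ => ?_
    split_ifs with h
    · rfl
    · exact le_antisymm (hf k) (not_lt.1 h)
  have hsum2 : ∑ i, (⟪t i, A (t i)⟫_ℂ).re =
      ∑ k ∈ Finset.range n, b k - ∑ k ∈ Finset.range n, g k := by
    rw [Fintype.sum_sum_type, ← hpos b hx.nonneg, ← hpos g hy.nonneg, sub_eq_add_neg,
      ← Finset.sum_neg_distrib]
    have hself : ∀ w : H, ‖w‖ = 1 → ∀ r : ℝ, (⟪w, (r : ℂ) • w⟫_ℂ).re = r := by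
      intro w hw r
      rw [inner_smul_right, inner_self_eq_norm_sq_to_K, hw]
      simp
    congr 1
    · refine Finset.sum_congr rfl fun k _ => ?_
      change (⟪x k.1, A (x k.1)⟫_ℂ).re = _
      rw [hxA _ k.2, hself _ (hx.orth.1 _)]
    · refine Finset.sum_congr rfl fun k _ => ?_
      change (⟪y k.1, A (y k.1)⟫_ℂ).re = _
      rw [hyA _ k.2, ← Complex.ofReal_neg, hself _ (hy.orth.1 _)]
  rw [hsum1, hsum2] at hmain
  refine hmain.trans ?_
  have hcard : ((Fintype.card (Fin n) : ℝ) +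
      Fintype.card ({k : Fin n // 0 < b k} ⊕ {k : Fin n // 0 < g k})) ≤ 3 * (n + 1) := by
    rw [Fintype.card_sum, Fintype.card_fin]
    have h1 := Fintype.card_subtype_le fun k : Fin n => 0 < b k
    have h2 := Fintype.card_subtype_le fun k : Fin n => 0 < g k
    rw [Fintype.card_fin] at h1 h2
    have h1' : (Fintype.card {k : Fin n // 0 < b k} : ℝ) ≤ n := by exact_mod_cast h1
    have h2' : (Fintype.card {k : Fin n // 0 < g k} : ℝ) ≤ n := by exact_mod_cast h2
    push_cast
    linarith
  refine (mul_le_mul_of_nonneg_left hcard hd0).trans (le_of_eq ?_)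
  field_simp
  ring

end PartialSums

/-! ### States on `L_∞(0, ∞)` that live at infinity -/

section States

open MeasureTheory Filter Topology

theorem toLinfty_eq {f : ℝ → ℂ} (hf : MemLp f ∞ halfLine) : toLinfty f = hf.toLp f := dif_pos hf

theorem toLinfty_coeFn {f : ℝ → ℂ} (hf : MemLp f ∞ halfLine) : toLinfty f =ᵐ[halfLine] f := by
  rw [toLinfty_eq hf]
  exact hf.coeFn_toLp

theorem toLinfty_add {f g : ℝ → ℂ} (hf : MemLp f ∞ halfLine) (hg : MemLp g ∞ halfLine) :
    toLinfty (fun t => f t + g t) = toLinfty f + toLinfty g := by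
  have h : MemLp (fun t => f t + g t) ∞ halfLine := hf.add hg
  rw [toLinfty_eq hf, toLinfty_eq hg, toLinfty_eq h]
  rfl

theorem toLinfty_sub {f g : ℝ → ℂ} (hf : MemLp f ∞ halfLine) (hg : MemLp g ∞ halfLine) :
    toLinfty (fun t => f t - g t) = toLinfty f - toLinfty g := by
  have h : MemLp (fun t => f t - g t) ∞ halfLine := hf.sub hg
  rw [toLinfty_eq hf, toLinfty_eq hg, toLinfty_eq h]
  rfl

theorem toLinfty_const_mul {f : ℝ → ℂ} (hf : MemLp f ∞ halfLine) (c : ℂ) :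
    toLinfty (fun t => c * f t) = c • toLinfty f := by
  rw [toLinfty_eq hf, toLinfty_eq (hf.const_mul c)]
  rfl

theorem memLp_const_halfLine (c : ℂ) : MemLp (fun _ : ℝ => c) ∞ halfLine :=
  memLp_top_of_bound aestronglyMeasurable_const ‖c‖ (Eventually.of_forall fun _ => le_rfl)

theorem logMean_toLinfty {f : ℝ → ℂ} (hf : MemLp f ∞ halfLine) :
    ∃ h : MemLp (fun t : ℝ => (1 / (Real.log t : ℂ)) * ∫ s in (1 : ℝ)..t, f s / s) ∞ halfLine,
      logMean (toLinfty f) = h.toLp _ := by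
  have hae : (fun t : ℝ => (1 / (Real.log t : ℂ)) * ∫ s in (1 : ℝ)..t, (toLinfty f) s / s)
      =ᵐ[halfLine] fun t : ℝ => (1 / (Real.log t : ℂ)) * ∫ s in (1 : ℝ)..t, f s / s := by
    filter_upwards [ae_restrict_mem measurableSet_Ioi] with t (ht : 0 < t)
    congr 1
    refine intervalIntegral.integral_congr_ae_restrict ?_
    have hsub : Set.uIoc 1 t ⊆ Set.Ioi 0 := fun s hs =>
      lt_of_lt_of_le (lt_min one_pos ht) hs.1.le
    have h1 := ae_restrict_of_ae_restrict_of_subset hsub (toLinfty_coeFn hf)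
    filter_upwards [h1] with s hs
    rw [hs]
  refine ⟨(memLp_congr_ae hae).1 (memLp_logMean _), ?_⟩
  exact MemLp.toLp_congr _ _ hae

theorem memLp_comp_rpow {f : ℝ → ℂ} (hf : MemLp f ∞ halfLine) {u : ℝ} (hu : 0 < u) :
    MemLp (fun t => f (t ^ u)) ∞ halfLine :=
  (memLp_congr_ae ((quasiMeasurePreserving_rpow hu).ae_eq_comp (toLinfty_coeFn hf))).1
    (memLp_powAct hu (toLinfty f))

theorem powAct_toLinfty {f : ℝ → ℂ} (hf : MemLp f ∞ halfLine) {u : ℝ} (hu : 0 < u) :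
    powAct u hu (toLinfty f) = toLinfty fun t => f (t ^ u) := by
  rw [toLinfty_eq (memLp_comp_rpow hf hu)]
  exact MemLp.toLp_congr (memLp_powAct hu (toLinfty f)) _
    ((quasiMeasurePreserving_rpow hu).ae_eq_comp (toLinfty_coeFn hf))

theorem IsState.comp_powAct {ω : Linfty →ₗ[ℂ] ℂ} (hω : IsState ω) {u : ℝ} (hu : 0 < u) :
    IsState (ω ∘ₗ powAct u hu) where
  nonneg x hx := by
    refine hω.nonneg _ ?_
    have h1 : (powAct u hu x : ℝ → ℂ) =ᵐ[halfLine] fun t => x (t ^ u) :=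
      (memLp_powAct hu x).coeFn_toLp
    filter_upwards [h1, (quasiMeasurePreserving_rpow hu).ae hx] with t h2 h3
    rw [h2]
    exact h3
  map_one := by
    rw [LinearMap.comp_apply, powAct_toLinfty (memLp_const_halfLine 1)]
    exact hω.map_one

theorem VanishesOnBounded.comp_powAct {ω : Linfty →ₗ[ℂ] ℂ} (hω : VanishesOnBounded ω) {u : ℝ}
    (hu : 0 < u) : VanishesOnBounded (ω ∘ₗ powAct u hu) := by
  intro x N hx
  refine hω _ (max N 0 ^ u⁻¹) ?_
  have h1 : (powAct u hu x : ℝ → ℂ) =ᵐ[halfLine] fun t => x (t ^ u) :=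
    (memLp_powAct hu x).coeFn_toLp
  filter_upwards [h1, (quasiMeasurePreserving_rpow hu).ae hx] with t h2 h3 ht
  rw [h2]
  refine h3 (lt_of_le_of_lt (le_max_left N 0) ?_)
  have h4 := Real.rpow_lt_rpow (by positivity) ht hu
  rwa [Real.rpow_inv_rpow (le_max_right _ _) hu.ne'] at h4

variable {ω : Linfty →ₗ[ℂ] ℂ} (hω : IsState ω) (hω' : VanishesOnBounded ω)

include hω hω'

/-- A state at infinity only sees the values of a function beyond any given `N`. -/
theorem norm_state_ofReal_le {g : ℝ → ℝ} (hg : MemLp (fun t => (g t : ℂ)) ∞ halfLine) {ε N : ℝ}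
    (hN : ∀ t, N < t → |g t| ≤ ε) (hε : 0 ≤ ε) : ‖ω (toLinfty fun t => (g t : ℂ))‖ ≤ ε := by
  set g' : ℝ → ℝ := (Set.Ioi N).indicator g with hg'def
  have hle : ∀ t, |g' t| ≤ ε := by
    intro t
    by_cases ht : N < t
    · rw [hg'def, Set.indicator_of_mem (show t ∈ Set.Ioi N from ht)]
      exact hN t ht
    · rw [hg'def, Set.indicator_of_notMem (show t ∉ Set.Ioi N from ht), abs_zero]
      exact hε
  have hg' : MemLp (fun t => (g' t : ℂ)) ∞ halfLine := by
    have h1 := hg.indicator (s := Set.Ioi N) measurableSet_Ioi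
    refine (memLp_congr_ae (Eventually.of_forall fun t => ?_)).1 h1
    by_cases ht : t ∈ Set.Ioi N
    · simp only [hg'def, Set.indicator_of_mem ht]
    · simp only [hg'def, Set.indicator_of_notMem ht, Complex.ofReal_zero]
  have h1 : ω (toLinfty fun t => (g t : ℂ)) = ω (toLinfty fun t => (g' t : ℂ)) := by
    rw [← sub_eq_zero, ← map_sub, ← toLinfty_sub hg hg']
    refine hω' _ N ?_
    filter_upwards [toLinfty_coeFn (hg.sub hg')] with t ht hNt
    have h2 : (toLinfty fun t => (g t : ℂ) - (g' t : ℂ)) t = (g t : ℂ) - (g' t : ℂ) := ht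
    rw [h2, hg'def, Set.indicator_of_mem (show t ∈ Set.Ioi N from hNt), sub_self]
  have hone := memLp_const_halfLine 1
  have hsgn : ∀ σ : ℝ, |σ| = 1 → 0 ≤ ((ε : ℂ) - σ * ω (toLinfty fun t => (g' t : ℂ))).re ∧
      ((ε : ℂ) - σ * ω (toLinfty fun t => (g' t : ℂ))).im = 0 := by
    intro σ hσ
    have h2 : (ε : ℂ) - σ * ω (toLinfty fun t => (g' t : ℂ)) =
        ω ((ε : ℂ) • toLinfty (fun _ => 1) - (σ : ℂ) • toLinfty fun t => (g' t : ℂ)) := by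
      rw [map_sub, map_smul, map_smul, hω.map_one, smul_eq_mul, smul_eq_mul, mul_one]
    rw [h2, ← toLinfty_const_mul hone, ← toLinfty_const_mul hg',
      ← toLinfty_sub (hone.const_mul (ε : ℂ)) (hg'.const_mul (σ : ℂ))]
    refine hω.nonneg _ ?_
    filter_upwards [toLinfty_coeFn ((hone.const_mul (ε : ℂ)).sub (hg'.const_mul (σ : ℂ)))]
      with t ht
    have h3 : (toLinfty fun t => (ε : ℂ) * 1 - (σ : ℂ) * (g' t : ℂ)) t =
        ((ε - σ * g' t : ℝ) : ℂ) := by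
      refine Eq.trans ht ?_
      simp
    rw [h3, Complex.ofReal_re, Complex.ofReal_im]
    refine ⟨?_, rfl⟩
    have h4 : |σ * g' t| ≤ ε := by rw [abs_mul, hσ, one_mul]; exact hle t
    linarith [le_abs_self (σ * g' t)]
  have hp := hsgn 1 (by simp)
  have hm := hsgn (-1) (by simp)
  rw [h1]
  set z := ω (toLinfty fun t => (g' t : ℂ))
  simp only [Complex.sub_re, Complex.sub_im, Complex.ofReal_re, Complex.ofReal_im,
    Complex.re_ofReal_mul, Complex.im_ofReal_mul] at hp hm
  have him : z.im = 0 := by linarith [hp.2]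
  have hz : z = ((z.re : ℝ) : ℂ) := Complex.ext rfl (by simp [him])
  rw [hz, Complex.norm_real, Real.norm_eq_abs, abs_le]
  constructor <;> linarith [hp.1, hm.1]

theorem state_eq_zero_of_tendsto {f : ℝ → ℂ} (hf : MemLp f ∞ halfLine)
    (h : Tendsto f atTop (𝓝 0)) : ω (toLinfty f) = 0 := by
  have hreal : ∀ g : ℝ → ℝ, MemLp (fun t => (g t : ℂ)) ∞ halfLine → Tendsto g atTop (𝓝 0) →
      ω (toLinfty fun t => (g t : ℂ)) = 0 := by
    intro g hg hg0
    refine norm_le_zero_iff.1 (le_of_forall_pos_le_add fun ε hε => ?_)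
    obtain ⟨N, hN⟩ := eventually_atTop.1 (Metric.tendsto_nhds.1 hg0 ε hε)
    rw [zero_add]
    refine norm_state_ofReal_le hω hω' hg (N := N) (fun t ht => ?_) hε.le
    have := hN t ht.le
    rw [dist_zero_right, Real.norm_eq_abs] at this
    exact this.le
  have hre : MemLp (fun t => ((f t).re : ℂ)) ∞ halfLine := hf.re.ofReal
  have him : MemLp (fun t => ((f t).im : ℂ)) ∞ halfLine := hf.im.ofReal
  have h1 := hreal _ hre ((Complex.continuous_re.tendsto' 0 0 rfl).comp h)
  have h2 := hreal _ him ((Complex.continuous_im.tendsto' 0 0 rfl).comp h)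
  have h3 : f = fun t => ((f t).re : ℂ) + Complex.I * ((f t).im : ℂ) := by
    funext t
    rw [mul_comm, Complex.re_add_im]
  rw [h3, toLinfty_add hre (him.const_mul Complex.I), map_add, h1, zero_add]
  rw [toLinfty_const_mul him, map_smul, h2, smul_zero]

theorem state_congr_of_tendsto {f g : ℝ → ℂ} (hf : MemLp f ∞ halfLine) (hg : MemLp g ∞ halfLine)
    (h : Tendsto (fun t => f t - g t) atTop (𝓝 0)) : ω (toLinfty f) = ω (toLinfty g) := by
  rw [← sub_eq_zero, ← map_sub, ← toLinfty_sub hf hg]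
  exact state_eq_zero_of_tendsto hω hω' (hf.sub hg) h

end States

/-! ### Dixmier traces of `T V` through diagonal entries -/

section Dixmier

open MeasureTheory Filter Topology

/-- The function `t ↦ (1 / log (1 + t)) ∑_{k < ⌊t⌋} w_k`, a discrete version of `dixmierMean`. -/
noncomputable def discreteMean (w : ℕ → ℂ) (t : ℝ) : ℂ :=
  (1 / (Real.log (1 + t) : ℂ)) * ∑ k ∈ Finset.range ⌊t⌋₊, w k

theorem sum_range_inv_le (n : ℕ) :
    ∑ k ∈ Finset.range n, (1 : ℝ) / (k + 1) ≤ 1 + Real.log n := by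
  have h := harmonic_le_one_add_log n
  rw [harmonic] at h
  push_cast at h
  simpa [one_div] using h

theorem memLp_discreteMean {w : ℕ → ℂ} {C : ℝ} (hw : ∀ k : ℕ, ‖w k‖ ≤ C / (k + 1)) :
    MemLp (discreteMean w) ∞ halfLine := by
  have hC : 0 ≤ C := by simpa using (norm_nonneg _).trans (hw 0)
  refine memLp_top_of_bound (C := C * (1 / Real.log 2 + 1)) ?_ ?_
  · refine Measurable.aestronglyMeasurable ?_
    have h1 : Measurable fun t : ℝ => ∑ k ∈ Finset.range ⌊t⌋₊, w k :=
      (measurable_from_nat (f := fun n => ∑ k ∈ Finset.range n, w k)).comp Nat.measurable_floor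
    unfold discreteMean
    fun_prop
  · filter_upwards [ae_restrict_mem measurableSet_Ioi] with t (ht : 0 < t)
    have hlog2 : 0 < Real.log 2 := Real.log_pos (by norm_num)
    rcases lt_or_ge t 1 with h1 | h1
    · rw [discreteMean, Nat.floor_eq_zero.2 h1]
      simp only [Finset.range_zero, Finset.sum_empty, mul_zero, norm_zero]
      positivity
    · have hlog : 0 < Real.log (1 + t) := Real.log_pos (by linarith)
      rw [discreteMean, norm_mul, norm_div, norm_one, Complex.norm_real,
        Real.norm_of_nonneg hlog.le, one_div, inv_mul_le_iff₀ hlog]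
      have hn : (1 : ℝ) ≤ ⌊t⌋₊ := by exact_mod_cast Nat.le_floor (by simpa using h1)
      have h2 : ‖∑ k ∈ Finset.range ⌊t⌋₊, w k‖ ≤ C * (1 + Real.log (1 + t)) := by
        calc ‖∑ k ∈ Finset.range ⌊t⌋₊, w k‖ ≤ ∑ k ∈ Finset.range ⌊t⌋₊, C * (1 / (k + 1)) := by
              refine (norm_sum_le _ _).trans (Finset.sum_le_sum fun k _ => ?_)
              rw [mul_one_div]
              exact hw k
          _ ≤ C * (1 + Real.log ⌊t⌋₊) := by
              rw [← Finset.mul_sum]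
              exact mul_le_mul_of_nonneg_left (sum_range_inv_le _) hC
          _ ≤ C * (1 + Real.log (1 + t)) := by
              gcongr
              linarith [Nat.floor_le ht.le]
      refine h2.trans ?_
      have h3 : Real.log 2 ≤ Real.log (1 + t) := Real.log_le_log (by norm_num) (by linarith)
      have h4 : 1 ≤ Real.log (1 + t) * (1 / Real.log 2) := by
        rw [mul_one_div, le_div_iff₀ hlog2]
        linarith
      nlinarith

theorem abs_integral_floor_sub_sum_le {f : ℕ → ℝ} (hf : Antitone f) (h0 : ∀ k, 0 ≤ f k) {t : ℝ}
    (ht : 0 ≤ t) :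
    |(∫ s in (0 : ℝ)..t, f ⌊s⌋₊) - ∑ k ∈ Finset.range ⌊t⌋₊, f k| ≤ f 0 := by
  have hanti : Antitone fun s : ℝ => f ⌊s⌋₊ := hf.comp_monotone Nat.floor_mono
  have hint : ∀ a b : ℝ, IntervalIntegrable (fun s : ℝ => f ⌊s⌋₊) volume a b :=
    fun a b => hanti.intervalIntegrable
  have h1 : ∫ s in (0 : ℝ)..(⌊t⌋₊ : ℝ), f ⌊s⌋₊ = ∑ k ∈ Finset.range ⌊t⌋₊, f k := by
    have := intervalIntegral.sum_integral_adjacent_intervals (a := fun k : ℕ => (k : ℝ))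
      (n := ⌊t⌋₊) (f := fun s : ℝ => f ⌊s⌋₊) (μ := volume) (fun k _ => hint _ _)
    rw [Nat.cast_zero] at this
    rw [← this]
    refine Finset.sum_congr rfl fun k _ => ?_
    have h2 : ∫ s in (k : ℝ)..((k + 1 : ℕ) : ℝ), f ⌊s⌋₊ =
        ∫ s in (k : ℝ)..((k + 1 : ℕ) : ℝ), f k := by
      rw [intervalIntegral.integral_of_le (by simp), intervalIntegral.integral_of_le (by simp),
        ← integral_Ico_eq_integral_Ioc, ← integral_Ico_eq_integral_Ioc]
      refine setIntegral_congr_fun measurableSet_Ico fun s hs => ?_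
      have : ⌊s⌋₊ = k := (Nat.floor_eq_iff ((Nat.cast_nonneg k).trans hs.1)).2
        ⟨hs.1, by simpa using hs.2⟩
      simp only [this]
    rw [h2]
    simp
  rw [← intervalIntegral.integral_add_adjacent_intervals (hint 0 ⌊t⌋₊) (hint ⌊t⌋₊ t), h1,
    add_sub_cancel_left]
  have hle := Nat.floor_le ht
  have h3 : 0 ≤ ∫ s in (⌊t⌋₊ : ℝ)..t, f ⌊s⌋₊ := intervalIntegral.integral_nonneg hle
    fun s _ => h0 _
  have h4 : ∫ s in (⌊t⌋₊ : ℝ)..t, f ⌊s⌋₊ ≤ ∫ s in (⌊t⌋₊ : ℝ)..t, f 0 :=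
    intervalIntegral.integral_mono_on hle (hint _ _) intervalIntegrable_const
      fun s _ => hf (Nat.zero_le _)
  rw [intervalIntegral.integral_const, smul_eq_mul] at h4
  rw [abs_of_nonneg h3]
  have h5 := Nat.lt_floor_add_one t
  nlinarith [h0 0]

theorem tendsto_inv_log_one_add : Tendsto (fun t : ℝ => 1 / Real.log (1 + t)) atTop (𝓝 0) := by
  simp only [one_div]
  exact tendsto_inv_atTop_zero.comp (Real.tendsto_log_atTop.comp (tendsto_atTop_add_const_left _ _
    tendsto_id))

variable {H : Type*} [NormedAddCommGroup H] [InnerProductSpace ℂ H]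

theorem IsWeakL1.mul_left {A : H →L[ℂ] H} (hA : IsWeakL1 A) (T : H →L[ℂ] H) :
    IsWeakL1 (T * A) := by
  obtain ⟨C, hC⟩ := hA
  refine ⟨‖T‖ * C, fun k => (singularValue_mul_le T A k).trans ?_⟩
  rw [mul_div_assoc]
  exact mul_le_mul_of_nonneg_left (hC k) (norm_nonneg _)

theorem norm_inner_apply_self_le (T : H →L[ℂ] H) {x : H} (hx : ‖x‖ = 1) : ‖⟪x, T x⟫_ℂ‖ ≤ ‖T‖ := by
  refine (norm_inner_le_norm _ _).trans ?_
  have := T.le_opNorm x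
  rwa [hx, mul_one, ← one_mul ‖T x‖, ← hx] at this

theorem norm_diag_mul_le {V : H →L[ℂ] H} {e : ℕ → H} {v : ℕ → ℝ} (hV : SortedEigen V e v) {C : ℝ}
    (hC : ∀ k : ℕ, v k ≤ C / (k + 1)) (T : H →L[ℂ] H) (k : ℕ) :
    ‖⟪e k, T (e k)⟫_ℂ * v k‖ ≤ ‖T‖ * C / (k + 1) := by
  rw [norm_mul, Complex.norm_real, Real.norm_of_nonneg (hV.nonneg k), mul_div_assoc]
  exact mul_le_mul (norm_inner_apply_self_le T (hV.orth.1 k)) (hC k) (hV.nonneg k) (norm_nonneg _)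

variable [CompleteSpace H] {ω : Linfty →ₗ[ℂ] ℂ} (hω : IsState ω) (hω' : VanishesOnBounded ω)
  (hH : ¬ FiniteDimensional ℂ H) {V : H →L[ℂ] H} (hV0 : 0 ≤ V) {e : ℕ → H} {v : ℕ → ℝ}
  (hV : SortedEigen V e v) {C : ℝ} (hC : ∀ k : ℕ, v k ≤ C / (k + 1))

include hω hω' hH hV0 hV hC in
/-- The real part of `T V`: the sums of singular values in the Dixmier traces of its positive and
negative parts are within a bounded distance of the sums of its diagonal entries, and a bounded
distance does not matter after division by `log (1 + t)`. -/
theorem dixmierPos_realPart (T : H →L[ℂ] H) :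
    dixmierPos ω (realPart (T * V) : H →L[ℂ] H)⁺ - dixmierPos ω (realPart (T * V) : H →L[ℂ] H)⁻ =
      ω (toLinfty (discreteMean fun k => (((⟪e k, T (e k)⟫_ℂ).re * v k : ℝ) : ℂ))) := by
  obtain ⟨hP, hN, K, hK⟩ := exists_abs_sum_singularValue_sub_le hH hV0 hV hC T
  set P : H →L[ℂ] H := (realPart (T * V) : H →L[ℂ] H)⁺
  set N : H →L[ℂ] H := (realPart (T * V) : H →L[ℂ] H)⁻
  rw [dixmierPos, dixmierPos, ← map_sub, ← toLinfty_sub (memLp_dixmierMean hP)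
    (memLp_dixmierMean hN)]
  have hw : ∀ k : ℕ, ‖(((⟪e k, T (e k)⟫_ℂ).re * v k : ℝ) : ℂ)‖ ≤ ‖T‖ * C / (k + 1) := by
    intro k
    refine le_trans ?_ (norm_diag_mul_le hV hC T k)
    rw [Complex.norm_real, norm_mul, norm_mul, Complex.norm_real]
    gcongr
    exact Complex.abs_re_le_norm _
  refine state_congr_of_tendsto hω hω' ((memLp_dixmierMean hP).sub (memLp_dixmierMean hN))
    (memLp_discreteMean hw) ?_
  have hlim := tendsto_inv_log_one_add.mul_const (singularValue 0 P + singularValue 0 N + K)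
  rw [zero_mul] at hlim
  refine squeeze_zero_norm' ?_ hlim
  filter_upwards [eventually_gt_atTop 0] with t ht
  have hlog : 0 < Real.log (1 + t) := Real.log_pos (by linarith)
  have hP' := abs_integral_floor_sub_sum_le (singularValue_antitone P)
    (fun k => singularValue_nonneg k P) ht.le
  have hN' := abs_integral_floor_sub_sum_le (singularValue_antitone N)
    (fun k => singularValue_nonneg k N) ht.le
  have hKt := hK ⌊t⌋₊
  have h1 : (dixmierMean P t : ℂ) - (dixmierMean N t : ℂ) -
      discreteMean (fun k => (((⟪e k, T (e k)⟫_ℂ).re * v k : ℝ) : ℂ)) t =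
      ((1 / Real.log (1 + t) * ((∫ s in (0 : ℝ)..t, singularValue ⌊s⌋₊ P) -
        (∫ s in (0 : ℝ)..t, singularValue ⌊s⌋₊ N) -
        ∑ k ∈ Finset.range ⌊t⌋₊, (⟪e k, T (e k)⟫_ℂ).re * v k) : ℝ) : ℂ) := by
    rw [dixmierMean, dixmierMean, discreteMean]
    push_cast
    ring
  rw [h1, Complex.norm_real, norm_mul, Real.norm_of_nonneg (by positivity), Real.norm_eq_abs]
  refine mul_le_mul_of_nonneg_left ?_ (by positivity)
  rw [abs_le] at hP' hN' hKt ⊢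
  constructor <;> linarith [hP'.1, hP'.2, hN'.1, hN'.2, hKt.1, hKt.2]

theorem realPart_neg_I_mul (T V : H →L[ℂ] H) :
    realPart (((-Complex.I) • T) * V) = imaginaryPart (T * V) := by
  rw [smul_mul_assoc, neg_smul, map_neg, realPart_I_smul, neg_neg]

include hω hω' hH hV0 hV hC in
/-- The Dixmier trace of `T V` is computed by the diagonal entries of `T V` in the sorted
eigenbasis of `V`. -/
theorem dixmierTrace_mul_eq (T : H →L[ℂ] H) :
    dixmierTrace ω (T * V) = ω (toLinfty (discreteMean fun k => ⟪e k, T (e k)⟫_ℂ * v k)) := by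
  have h1 := dixmierPos_realPart hω hω' hH hV0 hV hC T
  -- the imaginary part of `T V` is the real part of `(-i T) V`
  have h2 := dixmierPos_realPart hω hω' hH hV0 hV hC ((-Complex.I) • T)
  rw [realPart_neg_I_mul] at h2
  rw [dixmierTrace, h1, h2, ← smul_eq_mul, ← map_smul, ← map_add]
  have hw : ∀ S : H →L[ℂ] H, ∀ k : ℕ,
      ‖(((⟪e k, S (e k)⟫_ℂ).re * v k : ℝ) : ℂ)‖ ≤ ‖S‖ * C / (k + 1) := by
    intro S k
    refine le_trans ?_ (norm_diag_mul_le hV hC S k)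
    rw [Complex.norm_real, norm_mul, norm_mul, Complex.norm_real]
    gcongr
    exact Complex.abs_re_le_norm _
  have hm1 := memLp_discreteMean (hw T)
  have hm2 := memLp_discreteMean (hw ((-Complex.I) • T))
  rw [← toLinfty_const_mul hm2, ← toLinfty_add hm1 (hm2.const_mul Complex.I)]
  congr 2
  funext t
  rw [discreteMean, discreteMean, discreteMean, mul_left_comm, ← mul_add, Finset.mul_sum,
    ← Finset.sum_add_distrib]
  congr 1
  refine Finset.sum_congr rfl fun k _ => ?_
  have h3 : (⟪e k, ((-Complex.I) • T) (e k)⟫_ℂ).re = (⟪e k, T (e k)⟫_ℂ).im := by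
    rw [smul_apply, inner_smul_right]
    simp
  rw [h3]
  push_cast
  rw [← Complex.re_add_im ⟪e k, T (e k)⟫_ℂ]
  simp only [Complex.add_re, Complex.ofReal_re, Complex.mul_re, Complex.I_re, Complex.I_im,
    Complex.ofReal_im, Complex.add_im, Complex.mul_im]
  push_cast
  ring

end Dixmier

/-! ### Logarithmic means of heat traces -/

section HeatMean

open MeasureTheory Filter Topology

/-- The scaled Gaussian weight `s ^ (-p) exp (-A / s²)`. -/
noncomputable def gaussWeight (p A s : ℝ) : ℝ := s ^ (-p) * Real.exp (-A / s ^ 2)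

theorem gaussWeight_nonneg {p A s : ℝ} (hs : 0 ≤ s) : 0 ≤ gaussWeight p A s :=
  mul_nonneg (Real.rpow_nonneg hs _) (Real.exp_nonneg _)

theorem gaussWeight_le {p A s : ℝ} (hA : 0 ≤ A) (hs : 0 ≤ s) : gaussWeight p A s ≤ s ^ (-p) := by
  refine mul_le_of_le_one_right (Real.rpow_nonneg hs _) (Real.exp_le_one_iff.2 ?_)
  rw [neg_div]
  have : 0 ≤ A / s ^ 2 := by positivity
  linarith

theorem measurable_gaussWeight (p A : ℝ) : Measurable (gaussWeight p A) := by
  unfold gaussWeight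
  fun_prop

theorem exists_rpow_mul_exp_neg_le {p : ℝ} (hp : 0 < p) :
    ∃ D : ℝ, 0 < D ∧ ∀ x : ℝ, 0 < x → Real.exp (-x) ≤ D * x ^ (-p) := by
  obtain ⟨n, hn⟩ := exists_nat_ge p
  refine ⟨n.factorial + 1, by positivity, fun x hx => ?_⟩
  rw [Real.exp_neg, Real.rpow_neg hx.le, ← div_eq_mul_inv, inv_eq_one_div,
    div_le_div_iff₀ (Real.exp_pos _) (by positivity), one_mul]
  have hexp := Real.one_le_exp hx.le
  rcases le_total x 1 with h | h
  · have h1 : x ^ p ≤ 1 := Real.rpow_le_one hx.le h hp.le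
    have h2 : (0 : ℝ) ≤ n.factorial := by positivity
    nlinarith
  · have h1 : x ^ p ≤ x ^ n := by
      rw [← Real.rpow_natCast]
      exact Real.rpow_le_rpow_of_exponent_le h hn
    have h2 := Real.pow_div_factorial_le_exp x hx.le n
    rw [div_le_iff₀ (by positivity)] at h2
    have h3 := Real.exp_pos x
    nlinarith

/-- A bound for small `s`. It is quadratic in `A ^ (-(p / 2))`, hence summable over eigenvalues for
which `A_k ^ (-(p / 2))` is `O(1 / (k + 1))`. -/
theorem exists_gaussWeight_le {p : ℝ} (hp : 0 < p) :
    ∃ D : ℝ, 0 < D ∧ ∀ A s : ℝ, 0 < A → 0 < s →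
      gaussWeight p A s ≤ D * (A ^ (-(p / 2))) ^ 2 * s ^ p := by
  obtain ⟨D, hD, h⟩ := exists_rpow_mul_exp_neg_le hp
  refine ⟨D, hD, fun A s hA hs => ?_⟩
  have h1 := h (A / s ^ 2) (by positivity)
  rw [gaussWeight, neg_div]
  calc s ^ (-p) * Real.exp (-(A / s ^ 2)) ≤ s ^ (-p) * (D * (A / s ^ 2) ^ (-p)) := by gcongr
    _ = D * (A ^ (-(p / 2))) ^ 2 * s ^ p := by
      have h2 : (s ^ 2) ^ p = s ^ p * s ^ p := by
        rw [← Real.rpow_natCast s 2, ← Real.rpow_mul hs.le, ← Real.rpow_add hs]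
        congr 1
        push_cast
        ring
      have h3 : (A ^ (-(p / 2))) ^ 2 = A ^ (-p) := by
        rw [← Real.rpow_natCast, ← Real.rpow_mul hA.le]
        congr 1
        push_cast
        ring
      rw [h3, Real.div_rpow hA.le (by positivity), Real.rpow_neg (sq_nonneg s), h2,
        Real.rpow_neg hs.le]
      have : 0 < s ^ p := Real.rpow_pos_of_pos hs p
      field_simp

/-- Euler's integral for the Gamma function, after the substitution `s ↦ 1 / s`. -/
theorem integral_gaussWeight {p A : ℝ} (hp : 0 < p) (hA : 0 < A) :
    ∫ s in Set.Ioi (0 : ℝ), gaussWeight p A s / s =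
      Real.Gamma (1 + p / 2) / p * A ^ (-(p / 2)) := by
  have h1 := integral_rpow_mul_exp_neg_mul_rpow (p := 2) (q := p - 1) (b := A) (by norm_num)
    (by linarith) hA
  have h2 := integral_comp_rpow_Ioi (fun y : ℝ => y ^ (p - 1) * Real.exp (-A * y ^ (2 : ℝ)))
    (p := -1) (by norm_num)
  rw [h1] at h2
  have h3 : ∫ s in Set.Ioi (0 : ℝ), gaussWeight p A s / s =
      ∫ x in Set.Ioi (0 : ℝ), (|(-1 : ℝ)| * x ^ ((-1 : ℝ) - 1)) •
        ((x ^ (-1 : ℝ)) ^ (p - 1) * Real.exp (-A * (x ^ (-1 : ℝ)) ^ (2 : ℝ))) := by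
    refine setIntegral_congr_fun measurableSet_Ioi fun x (hx : 0 < x) => ?_
    have e1 : -A * (x ^ (-1 : ℝ)) ^ (2 : ℝ) = -A / x ^ 2 := by
      rw [Real.rpow_neg_one, Real.rpow_two, inv_pow, div_eq_mul_inv]
    have e2 : x ^ ((-1 : ℝ) - 1) * (x ^ (-1 : ℝ)) ^ (p - 1) = x ^ (-p) / x := by
      rw [← Real.rpow_mul hx.le, ← Real.rpow_add hx, ← Real.rpow_sub_one hx.ne']
      congr 1
      ring
    simp only [gaussWeight]
    rw [e1, abs_neg, abs_one, one_mul, smul_eq_mul, ← mul_assoc, e2]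
    ring
  rw [h3, h2, add_comm 1 (p / 2), Real.Gamma_add_one (by positivity)]
  have e3 : p - 1 + 1 = p := by ring
  rw [e3, neg_div]
  field_simp

theorem integrableOn_gaussWeight {p A : ℝ} (hp : 0 < p) (hA : 0 < A) :
    IntegrableOn (fun s => gaussWeight p A s / s) (Set.Ioi 0) := by
  refine Integrable.of_integral_ne_zero ?_
  rw [integral_gaussWeight hp hA]
  have : 0 < Real.Gamma (1 + p / 2) := Real.Gamma_pos_of_pos (by positivity)
  positivity

theorem integral_rpow_sub_one_Ioc {p t : ℝ} (hp : 0 < p) (ht : 0 ≤ t) :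
    IntegrableOn (fun s : ℝ => s ^ (p - 1)) (Set.Ioc 0 t) ∧
      ∫ s in Set.Ioc 0 t, s ^ (p - 1) = t ^ p / p := by
  have h1 : IntervalIntegrable (fun s : ℝ => s ^ (p - 1)) volume 0 t :=
    intervalIntegral.intervalIntegrable_rpow' (by linarith)
  refine ⟨(intervalIntegrable_iff_integrableOn_Ioc_of_le ht).1 h1, ?_⟩
  rw [← intervalIntegral.integral_of_le ht, integral_rpow (Or.inl (by linarith))]
  rw [sub_add_cancel, Real.zero_rpow hp.ne', sub_zero]

/-- The integral of the weight over `(0, t]`, with `D` the constant of `exists_gaussWeight_le`. -/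
theorem setIntegral_gaussWeight_le {p A D : ℝ} (hp : 0 < p) (hA : 0 < A)
    (hD : ∀ A s : ℝ, 0 < A → 0 < s → gaussWeight p A s ≤ D * (A ^ (-(p / 2))) ^ 2 * s ^ p)
    {t : ℝ} (ht : 0 ≤ t) :
    ∫ s in Set.Ioc 0 t, gaussWeight p A s / s ≤ D * (A ^ (-(p / 2))) ^ 2 * (t ^ p / p) := by
  obtain ⟨h1, h2⟩ := integral_rpow_sub_one_Ioc hp ht
  rw [← h2, ← integral_const_mul]
  refine setIntegral_mono_on ((integrableOn_gaussWeight hp hA).mono_set Set.Ioc_subset_Ioi_self)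
    (h1.const_mul _) measurableSet_Ioc fun s hs => ?_
  rw [Real.rpow_sub_one hs.1.ne', ← mul_div_assoc]
  exact div_le_div_of_nonneg_right (hD A s hA hs.1) hs.1.le

theorem setIntegral_gaussWeight_nonneg {p A a : ℝ} (ha : 0 ≤ a) (b : ℝ) :
    0 ≤ ∫ s in Set.Ioc a b, gaussWeight p A s / s :=
  setIntegral_nonneg measurableSet_Ioc fun _ hs =>
    div_nonneg (gaussWeight_nonneg (ha.trans hs.1.le)) (ha.trans hs.1.le)

/-- The integral over `[1, t]` differs from that over `(0, ∞)` by the parts over `(0, 1]` and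
`(t, ∞)`; `D` is the constant of `exists_gaussWeight_le`. -/
theorem abs_sub_integral_gaussWeight_le {p A D : ℝ} (hp : 0 < p) (hA : 0 < A)
    (hD : ∀ A s : ℝ, 0 < A → 0 < s → gaussWeight p A s ≤ D * (A ^ (-(p / 2))) ^ 2 * s ^ p)
    {t : ℝ} (ht : 1 ≤ t) :
    |(∫ s in Set.Ioc 1 t, gaussWeight p A s / s) -
      Real.Gamma (1 + p / 2) / p * A ^ (-(p / 2))| ≤
        (D * (A ^ (-(p / 2))) ^ 2 + t ^ (-p)) / p := by
  have ht0 : 0 < t := by linarith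
  have hint := integrableOn_gaussWeight hp hA
  have h01 := setIntegral_gaussWeight_le hp hA hD (zero_le_one' ℝ)
  have h01' := setIntegral_gaussWeight_nonneg (p := p) (A := A) le_rfl 1
  have htinf : ∫ s in Set.Ioi t, gaussWeight p A s / s ≤ t ^ (-p) / p := by
    have h1 : ∫ s in Set.Ioi t, s ^ (-p - 1) = t ^ (-p) / p := by
      rw [integral_Ioi_rpow_of_lt (by linarith) ht0, sub_add_cancel, neg_div_neg_eq]
    rw [← h1]
    refine setIntegral_mono_on (hint.mono_set (Set.Ioi_subset_Ioi ht0.le))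
      (integrableOn_Ioi_rpow_of_lt (by linarith) ht0) measurableSet_Ioi fun s (hs : t < s) => ?_
    have hs0 : 0 < s := ht0.trans hs
    rw [Real.rpow_sub_one hs0.ne']
    exact div_le_div_of_nonneg_right (gaussWeight_le hA.le hs0.le) hs0.le
  have htinf' : 0 ≤ ∫ s in Set.Ioi t, gaussWeight p A s / s :=
    setIntegral_nonneg measurableSet_Ioi fun s (hs : t < s) =>
      div_nonneg (gaussWeight_nonneg (ht0.trans hs).le) (ht0.trans hs).le
  have hsplit : ∫ s in Set.Ioi (0 : ℝ), gaussWeight p A s / s =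
      (∫ s in Set.Ioc 0 1, gaussWeight p A s / s) + (∫ s in Set.Ioc 1 t, gaussWeight p A s / s) +
        ∫ s in Set.Ioi t, gaussWeight p A s / s := by
    rw [← Set.Ioc_union_Ioi_eq_Ioi (zero_le_one' ℝ), setIntegral_union
      (Set.Ioc_disjoint_Ioi le_rfl) measurableSet_Ioi (hint.mono_set Set.Ioc_subset_Ioi_self)
      (hint.mono_set (Set.Ioi_subset_Ioi (zero_le_one' ℝ))), ← Set.Ioc_union_Ioi_eq_Ioi ht,
      setIntegral_union (Set.Ioc_disjoint_Ioi le_rfl) measurableSet_Ioi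
      (hint.mono_set (Set.Ioc_subset_Ioi_self.trans (Set.Ioi_subset_Ioi (zero_le_one' ℝ))))
      (hint.mono_set (Set.Ioi_subset_Ioi ht0.le))]
    ring
  rw [← integral_gaussWeight hp hA, hsplit, add_div]
  rw [Real.one_rpow] at h01
  rw [abs_le]
  have : D * (A ^ (-(p / 2))) ^ 2 * (1 / p) = D * (A ^ (-(p / 2))) ^ 2 / p := by ring
  constructor <;> linarith

theorem sum_range_inv_sq_le (n N : ℕ) :
    ∑ k ∈ Finset.range N, (1 : ℝ) / (((k + n : ℕ) : ℝ) + 1) ^ 2 ≤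
      2 / ((n : ℝ) + 1) - 2 / ((n : ℝ) + N + 1) := by
  induction N with
  | zero => simp
  | succ N ih =>
    rw [Finset.sum_range_succ]
    have h : (1 : ℝ) / (((N + n : ℕ) : ℝ) + 1) ^ 2 ≤
        2 / ((n : ℝ) + N + 1) - 2 / ((n : ℝ) + (N + 1 : ℕ) + 1) := by
      push_cast
      rw [div_sub_div _ _ (by positivity) (by positivity),
        div_le_div_iff₀ (by positivity) (by positivity)]
      have h1 : (0 : ℝ) ≤ n := Nat.cast_nonneg n
      have h2 : (0 : ℝ) ≤ N := Nat.cast_nonneg N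
      nlinarith [mul_nonneg h1 h2, sq_nonneg ((n : ℝ) + N + 1)]
    linarith

theorem tsum_inv_sq_le (n : ℕ) : ∑' k : ℕ, (1 : ℝ) / (((k + n : ℕ) : ℝ) + 1) ^ 2 ≤
    2 / ((n : ℝ) + 1) := by
  refine Real.tsum_le_of_sum_range_le (fun k => by positivity) fun N => ?_
  refine (sum_range_inv_sq_le n N).trans ?_
  have : (0 : ℝ) ≤ 2 / ((n : ℝ) + N + 1) := by positivity
  linarith

theorem summable_inv_sq (n : ℕ) : Summable fun k : ℕ => (1 : ℝ) / (((k + n : ℕ) : ℝ) + 1) ^ 2 := by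
  refine summable_of_sum_range_le (c := 2 / ((n : ℝ) + 1)) (fun k => by positivity) fun N => ?_
  refine (sum_range_inv_sq_le n N).trans ?_
  have : (0 : ℝ) ≤ 2 / ((n : ℝ) + N + 1) := by positivity
  linarith

/-- A sum whose terms are bounded by `a` for `k < n` and by `b / (k + 1)²` for `k ≥ n`. -/
theorem norm_tsum_le_of_split {f : ℕ → ℂ} {n : ℕ} {a : ℕ → ℝ} {b : ℝ}
    (h1 : ∀ k < n, ‖f k‖ ≤ a k) (h2 : ∀ k, n ≤ k → ‖f k‖ ≤ b / (k + 1) ^ 2) :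
    Summable f ∧ ‖∑' k, f k‖ ≤ ∑ k ∈ Finset.range n, a k + b * (2 / (n + 1)) := by
  have hb : 0 ≤ b := by
    have := (norm_nonneg _).trans (h2 n le_rfl)
    have h3 : (0 : ℝ) < (n + 1) ^ 2 := by positivity
    by_contra hneg
    exact absurd (div_neg_of_neg_of_pos (not_le.1 hneg) h3) (not_lt.2 this)
  have hle : ∀ k : ℕ, ‖f (k + n)‖ ≤ b * (1 / (((k + n : ℕ) : ℝ) + 1) ^ 2) := fun k => by
    rw [mul_one_div]
    exact h2 _ (by omega)
  have hsum2 : Summable fun k : ℕ => b * ((1 : ℝ) / (((k + n : ℕ) : ℝ) + 1) ^ 2) :=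
    (summable_inv_sq n).mul_left b
  have hsum : Summable f := (summable_nat_add_iff n).1 (hsum2.of_norm_bounded hle)
  refine ⟨hsum, ?_⟩
  rw [← hsum.sum_add_tsum_nat_add n]
  refine (norm_add_le _ _).trans (add_le_add ?_ ?_)
  · exact (norm_sum_le _ _).trans (Finset.sum_le_sum fun k hk => h1 k (Finset.mem_range.1 hk))
  · refine (tsum_of_norm_bounded hsum2.hasSum hle).trans ?_
    rw [tsum_mul_left]
    exact mul_le_mul_of_nonneg_left (tsum_inv_sq_le n) hb

/-- The scaled heat trace `s ↦ s ^ (-p) ∑_k c_k exp (-A_k / s²)`, cut off to `s > 1`, which does not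
affect its values under a state at infinity. -/
noncomputable def heatMean (p : ℝ) (c : ℕ → ℂ) (A : ℕ → ℝ) : ℝ → ℂ :=
  (Set.Ioi 1).indicator fun s => ∑' k, c k * (gaussWeight p (A k) s : ℂ)

theorem norm_mul_rpow_le {p : ℝ} {A : ℕ → ℝ} (hA : ∀ k, 0 < A k) {c : ℕ → ℂ} {B : ℝ}
    (hc : ∀ k, ‖c k‖ ≤ B) {C : ℝ} (hC : ∀ k : ℕ, A k ^ (-(p / 2)) ≤ C / (k + 1)) (k : ℕ) :
    ‖c k * ((A k ^ (-(p / 2)) : ℝ) : ℂ)‖ ≤ B * C / (k + 1) := by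
  have h0 := Real.rpow_nonneg (hA k).le (-(p / 2))
  rw [norm_mul, Complex.norm_real, Real.norm_of_nonneg h0, mul_div_assoc]
  exact mul_le_mul (hc k) (hC k) h0 ((norm_nonneg _).trans (hc 0))

variable {p : ℝ} (hp : 0 < p) {A : ℕ → ℝ} (hA : ∀ k, 0 < A k) {c : ℕ → ℂ} {B : ℝ}
  (hc : ∀ k, ‖c k‖ ≤ B) {C : ℝ} (hC : ∀ k : ℕ, A k ^ (-(p / 2)) ≤ C / (k + 1))

include hp hA hc hC

/-- The sum is split at `k ≈ s ^ p`: the first terms are at most `B s ^ (-p)` each, the others are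
estimated by `exists_gaussWeight_le`. -/
theorem exists_norm_tsum_gaussWeight_le :
    ∃ K : ℝ, ∀ s : ℝ, 0 < s → Summable (fun k => c k * (gaussWeight p (A k) s : ℂ)) ∧
      ‖∑' k, c k * (gaussWeight p (A k) s : ℂ)‖ ≤ K := by
  obtain ⟨D, hD0, hD⟩ := exists_gaussWeight_le hp
  have hB : 0 ≤ B := (norm_nonneg _).trans (hc 0)
  refine ⟨B + B * D * C ^ 2 * 2, fun s hs => ?_⟩
  have hsp : 0 < s ^ p := Real.rpow_pos_of_pos hs p
  have hnorm : ∀ k, ‖c k * (gaussWeight p (A k) s : ℂ)‖ ≤ B * gaussWeight p (A k) s := fun k => by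
    have h0 := gaussWeight_nonneg (p := p) (A := A k) hs.le
    rw [norm_mul, Complex.norm_real, Real.norm_of_nonneg h0]
    exact mul_le_mul_of_nonneg_right (hc k) h0
  obtain ⟨h1, h2⟩ := norm_tsum_le_of_split (n := ⌊s ^ p⌋₊) (a := fun _ => B * s ^ (-p))
    (b := B * D * C ^ 2 * s ^ p) (fun k _ => (hnorm k).trans
      (mul_le_mul_of_nonneg_left (gaussWeight_le (hA k).le hs.le) hB)) (fun k _ => by
    refine (hnorm k).trans ?_
    have h3 := hD (A k) s (hA k) hs
    have h4 : (A k ^ (-(p / 2))) ^ 2 ≤ (C / (k + 1)) ^ 2 :=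
      pow_le_pow_left₀ (Real.rpow_nonneg (hA k).le _) (hC k) 2
    calc B * gaussWeight p (A k) s ≤ B * (D * (C / (k + 1)) ^ 2 * s ^ p) := by
          refine mul_le_mul_of_nonneg_left (h3.trans ?_) hB
          gcongr
      _ = _ := by field_simp)
  refine ⟨h1, h2.trans (add_le_add ?_ ?_)⟩
  · rw [Finset.sum_const, Finset.card_range, nsmul_eq_mul, Real.rpow_neg hs.le]
    have h5 := Nat.floor_le hsp.le
    calc (⌊s ^ p⌋₊ : ℝ) * (B * (s ^ p)⁻¹) = B * (⌊s ^ p⌋₊ / s ^ p) := by ring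
      _ ≤ B * 1 := by
        gcongr
        rwa [div_le_one hsp]
      _ = B := mul_one B
  · have h5 := (Nat.lt_floor_add_one (s ^ p)).le
    have h6 : s ^ p * (2 / (⌊s ^ p⌋₊ + 1)) ≤ 2 := by
      rw [← mul_div_assoc, div_le_iff₀ (by positivity)]
      linarith
    rw [mul_assoc]
    exact mul_le_mul_of_nonneg_left h6 (by positivity)

theorem memLp_heatMean : MemLp (heatMean p c A) ∞ halfLine := by
  obtain ⟨K, hK⟩ := exists_norm_tsum_gaussWeight_le hp hA hc hC
  have hK0 : 0 ≤ K := (norm_nonneg _).trans (hK 1 one_pos).2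
  refine memLp_top_of_bound (C := K) ?_ (Eventually.of_forall fun s => ?_)
  · refine Measurable.aestronglyMeasurable ?_
    refine measurable_of_tendsto_metrizable (f := fun n : ℕ => (Set.Ioi (1 : ℝ)).indicator fun s =>
      ∑ k ∈ Finset.range n, c k * (gaussWeight p (A k) s : ℂ)) (fun n => ?_) ?_
    · refine Measurable.indicator ?_ measurableSet_Ioi
      have := measurable_gaussWeight p
      fun_prop
    · rw [tendsto_pi_nhds]
      intro s
      by_cases hs : s ∈ Set.Ioi (1 : ℝ)
      · simp only [heatMean, Set.indicator_of_mem hs]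
        exact (hK s (one_pos.trans hs)).1.hasSum.tendsto_sum_nat
      · simp only [heatMean, Set.indicator_of_notMem hs]
        exact tendsto_const_nhds
  · by_cases hs : s ∈ Set.Ioi (1 : ℝ)
    · rw [heatMean, Set.indicator_of_mem hs]
      exact (hK s (one_pos.trans hs)).2
    · rw [heatMean, Set.indicator_of_notMem hs, norm_zero]
      exact hK0

theorem hasSum_integral_heatMean {t : ℝ} (ht : 1 ≤ t) :
    HasSum (fun k => c k * ((∫ s in Set.Ioc 1 t, gaussWeight p (A k) s / s : ℝ) : ℂ))
      (∫ s in (1 : ℝ)..t, heatMean p c A s / s) := by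
  obtain ⟨D, hD0, hD⟩ := exists_gaussWeight_le hp
  obtain ⟨K, hK⟩ := exists_norm_tsum_gaussWeight_le hp hA hc hC
  have hB : 0 ≤ B := (norm_nonneg _).trans (hc 0)
  have hsq : Summable fun k : ℕ => B * (D * (C / (k + 1)) ^ 2 * t ^ p) := by
    have := (summable_inv_sq 0).mul_left (B * D * C ^ 2 * t ^ p)
    refine this.congr fun k => ?_
    simp only [add_zero]
    field_simp
  have h := intervalIntegral.hasSum_integral_of_dominated_convergence (μ := volume) (a := 1)
    (b := t) (F := fun (k : ℕ) (s : ℝ) => c k * ((gaussWeight p (A k) s / s : ℝ) : ℂ))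
    (f := fun s => heatMean p c A s / s)
    (fun (k : ℕ) (_ : ℝ) => B * (D * (C / (k + 1)) ^ 2 * t ^ p)) (fun k => by
      refine Measurable.aestronglyMeasurable ?_
      have := measurable_gaussWeight p
      fun_prop) (fun k => Eventually.of_forall fun s hs => by
      rw [Set.uIoc_of_le ht] at hs
      have hs0 : 0 < s := one_pos.trans hs.1
      have h0 : 0 ≤ gaussWeight p (A k) s := gaussWeight_nonneg hs0.le
      rw [norm_mul, Complex.norm_real, Real.norm_of_nonneg (by positivity)]
      refine mul_le_mul (hc k) ?_ (by positivity) hB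
      have h4 : (A k ^ (-(p / 2))) ^ 2 ≤ (C / (k + 1)) ^ 2 :=
        pow_le_pow_left₀ (Real.rpow_nonneg (hA k).le _) (hC k) 2
      calc gaussWeight p (A k) s / s ≤ gaussWeight p (A k) s := div_le_self h0 hs.1.le
        _ ≤ D * (A k ^ (-(p / 2))) ^ 2 * s ^ p := hD _ _ (hA k) hs0
        _ ≤ _ := by
          gcongr
          exact hs.2) (Eventually.of_forall fun s _ => hsq) (by simp)
      (Eventually.of_forall fun s hs => by
        rw [Set.uIoc_of_le ht] at hs
        have h1 := (hK s (one_pos.trans hs.1)).1.hasSum.div_const (s : ℂ)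
        rw [heatMean, Set.indicator_of_mem (show s ∈ Set.Ioi (1 : ℝ) from hs.1)]
        refine h1.congr_fun fun k => ?_
        push_cast
        ring)
  refine h.congr_fun fun k => ?_
  rw [intervalIntegral.integral_const_mul, intervalIntegral.integral_of_le ht,
    integral_complex_ofReal]

/-- The primitive of the heat mean and the partial sums of the weighted eigenvalues differ by a
bounded amount. The sum over `k` is split at `k ≈ t ^ p`: for smaller `k` the integral over `[1, t]`
is almost the full Gamma integral, for larger `k` it is negligible. -/
theorem exists_norm_integral_heatMean_sub_le :
    ∃ K : ℝ, ∀ t : ℝ, 1 ≤ t → ‖(∫ s in (1 : ℝ)..t, heatMean p c A s / s) -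
      ((Real.Gamma (1 + p / 2) / p : ℝ) : ℂ) *
        ∑ k ∈ Finset.range ⌊t ^ p⌋₊, c k * ((A k ^ (-(p / 2)) : ℝ) : ℂ)‖ ≤ K := by
  obtain ⟨D, hD0, hD⟩ := exists_gaussWeight_le hp
  have hB : 0 ≤ B := (norm_nonneg _).trans (hc 0)
  refine ⟨B * (D * C ^ 2 * 2 + 1) / p + B * (D * C ^ 2) / p * 2, fun t ht => ?_⟩
  have ht0 : 0 < t := by linarith
  have htp : 0 < t ^ p := Real.rpow_pos_of_pos ht0 p
  set n := ⌊t ^ p⌋₊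
  set J : ℕ → ℝ := fun k => ∫ s in Set.Ioc 1 t, gaussWeight p (A k) s / s
  set g := Real.Gamma (1 + p / 2) / p
  have hsq : ∀ k : ℕ, (A k ^ (-(p / 2))) ^ 2 ≤ C ^ 2 * (1 / (k + 1) ^ 2) := fun k => by
    have := pow_le_pow_left₀ (Real.rpow_nonneg (hA k).le _) (hC k) 2
    rw [div_pow] at this
    rwa [mul_one_div]
  have hHS := hasSum_integral_heatMean hp hA hc hC ht
  have hfin : HasSum (fun k => if k < n then c k * ((g * A k ^ (-(p / 2)) : ℝ) : ℂ) else 0)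
      ((g : ℂ) * ∑ k ∈ Finset.range n, c k * ((A k ^ (-(p / 2)) : ℝ) : ℂ)) := by
    have h1 := hasSum_sum_of_ne_finset_zero (s := Finset.range n)
      (f := fun k => if k < n then c k * ((g * A k ^ (-(p / 2)) : ℝ) : ℂ) else 0)
      (L := SummationFilter.unconditional ℕ)
      fun k hk => if_neg (by simpa using hk)
    convert h1 using 1
    rw [Finset.mul_sum]
    refine Finset.sum_congr rfl fun k hk => ?_
    rw [if_pos (Finset.mem_range.1 hk)]
    push_cast
    ring
  have hsub := hHS.sub hfin
  rw [← hsub.tsum_eq]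
  have hbound := (norm_tsum_le_of_split (n := n)
    (f := fun k => c k * (J k : ℂ) - if k < n then c k * ((g * A k ^ (-(p / 2)) : ℝ) : ℂ) else 0)
    (a := fun k => B * ((D * (C ^ 2 * (1 / (k + 1) ^ 2)) + t ^ (-p)) / p))
    (b := B * (D * C ^ 2) / p * t ^ p) (fun k hk => by
      simp only [if_pos hk]
      rw [← mul_sub, ← Complex.ofReal_sub, norm_mul, Complex.norm_real, Real.norm_eq_abs]
      refine mul_le_mul (hc k) ?_ (abs_nonneg _) hB
      refine (abs_sub_integral_gaussWeight_le hp (hA k) hD ht).trans ?_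
      gcongr
      exact hsq k) (fun k hk => by
      simp only [if_neg (not_lt.2 hk), sub_zero]
      have hJ0 : 0 ≤ J k := setIntegral_gaussWeight_nonneg zero_le_one t
      have hJ1 : J k ≤ D * (A k ^ (-(p / 2))) ^ 2 * (t ^ p / p) := by
        refine le_trans ?_ (setIntegral_gaussWeight_le hp (hA k) hD ht0.le)
        refine setIntegral_mono_set ((integrableOn_gaussWeight hp (hA k)).mono_set
          Set.Ioc_subset_Ioi_self) ?_ (Eventually.of_forall
            (Set.Ioc_subset_Ioc_left zero_le_one))
        filter_upwards [ae_restrict_mem measurableSet_Ioc] with s hs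
        exact div_nonneg (gaussWeight_nonneg hs.1.le) hs.1.le
      rw [norm_mul, Complex.norm_real, Real.norm_of_nonneg hJ0]
      calc ‖c k‖ * J k ≤ B * (D * (C ^ 2 * (1 / (k + 1) ^ 2)) * (t ^ p / p)) := by
            refine mul_le_mul (hc k) (hJ1.trans ?_) hJ0 hB
            gcongr
            exact hsq k
        _ = _ := by ring)).2
  refine hbound.trans (add_le_add ?_ ?_)
  · have h1 : ∑ k ∈ Finset.range n, B * ((D * (C ^ 2 * (1 / ((k : ℝ) + 1) ^ 2)) + t ^ (-p)) / p) =
        B * (D * C ^ 2 * (∑ k ∈ Finset.range n, 1 / ((k : ℝ) + 1) ^ 2) + n * t ^ (-p)) / p := by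
      rw [← Finset.mul_sum, ← Finset.sum_div, Finset.sum_add_distrib, Finset.sum_const,
        Finset.card_range, nsmul_eq_mul, ← Finset.mul_sum, ← Finset.mul_sum]
      ring
    rw [h1]
    have h2 : ∑ k ∈ Finset.range n, 1 / ((k : ℝ) + 1) ^ 2 ≤ 2 := by
      have h3 := sum_range_inv_sq_le 0 n
      simp only [add_zero, CharP.cast_eq_zero, zero_add] at h3
      have : (0 : ℝ) ≤ 2 / (n + 1) := by positivity
      linarith
    have h4 : (n : ℝ) * t ^ (-p) ≤ 1 := by
      rw [Real.rpow_neg ht0.le, ← div_eq_mul_inv, div_le_one htp]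
      exact Nat.floor_le htp.le
    gcongr
  · have h5 := (Nat.lt_floor_add_one (t ^ p)).le
    have h6 : t ^ p * (2 / (n + 1)) ≤ 2 := by
      rw [← mul_div_assoc, div_le_iff₀ (by positivity)]
      linarith
    rw [mul_assoc]
    exact mul_le_mul_of_nonneg_left h6 (by positivity)

/-- The factor `p` in `log (t ^ p) = p log t` cancels the one of the Gamma integral. -/
theorem tendsto_logMean_heatMean_sub : Tendsto (fun t : ℝ =>
    (1 / (Real.log t : ℂ)) * (∫ s in (1 : ℝ)..t, heatMean p c A s / s) -
      (Real.Gamma (1 + p / 2) : ℂ) *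
        discreteMean (fun k => c k * ((A k ^ (-(p / 2)) : ℝ) : ℂ)) (t ^ p)) atTop (𝓝 0) := by
  obtain ⟨K, hK⟩ := exists_norm_integral_heatMean_sub_le hp hA hc hC
  have hB : 0 ≤ B := (norm_nonneg _).trans (hc 0)
  have hC0 : 0 ≤ C := by
    simpa using (Real.rpow_nonneg (hA 0).le (-(p / 2))).trans (hC 0)
  have hG : 0 < Real.Gamma (1 + p / 2) := Real.Gamma_pos_of_pos (by positivity)
  have hloginv : Tendsto (fun t : ℝ => (Real.log t)⁻¹) atTop (𝓝 0) :=
    tendsto_inv_atTop_zero.comp Real.tendsto_log_atTop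
  have hlogp : Tendsto (fun t : ℝ => (Real.log (t ^ p))⁻¹) atTop (𝓝 0) :=
    hloginv.comp (tendsto_rpow_atTop hp)
  have hlim := (hloginv.mul_const K).add
    (((hlogp.mul hlogp).add hlogp).const_mul (Real.Gamma (1 + p / 2) * (B * C)))
  simp only [zero_mul, add_zero, mul_zero] at hlim
  refine squeeze_zero_norm' ?_ hlim
  filter_upwards [eventually_gt_atTop 1] with t ht
  have ht0 : 0 < t := one_pos.trans ht
  have hlog : 0 < Real.log t := Real.log_pos ht
  set x := t ^ p with hx
  have hx1 : 1 < x := Real.one_lt_rpow ht hp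
  have hx0 : 0 < x := one_pos.trans hx1
  have hlx : 0 < Real.log x := Real.log_pos hx1
  have hlx' : Real.log x = p * Real.log t := Real.log_rpow ht0 p
  have hl1 : Real.log x ≤ Real.log (1 + x) := Real.log_le_log hx0 (by linarith)
  have hl2 : Real.log (1 + x) ≤ Real.log x + 1 := by
    have h1 : Real.log (1 + x) ≤ Real.log (Real.exp 1 * x) := by
      refine Real.log_le_log (by linarith) ?_
      have := Real.add_one_le_exp (1 : ℝ)
      nlinarith
    rw [Real.log_mul (Real.exp_pos 1).ne' hx0.ne', Real.log_exp] at h1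
    linarith
  set S := ∑ k ∈ Finset.range ⌊x⌋₊, c k * ((A k ^ (-(p / 2)) : ℝ) : ℂ) with hS
  have hSle : ‖S‖ ≤ B * C * (1 + Real.log x) := by
    calc ‖S‖ ≤ ∑ k ∈ Finset.range ⌊x⌋₊, B * C * (1 / (k + 1)) := by
          refine (norm_sum_le _ _).trans (Finset.sum_le_sum fun k _ => ?_)
          rw [mul_one_div]
          exact norm_mul_rpow_le hA hc hC k
      _ ≤ B * C * (1 + Real.log ⌊x⌋₊) := by
          rw [← Finset.mul_sum]
          exact mul_le_mul_of_nonneg_left (sum_range_inv_le _) (by positivity)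
      _ ≤ B * C * (1 + Real.log x) := by
          have : (0 : ℝ) < ⌊x⌋₊ := by exact_mod_cast Nat.floor_pos.2 hx1.le
          gcongr
          exact Nat.floor_le hx0.le
  set I := ∫ s in (1 : ℝ)..t, heatMean p c A s / s
  have hKt : ‖I - ((Real.Gamma (1 + p / 2) / p : ℝ) : ℂ) * S‖ ≤ K := hK t ht.le
  have hne1 : (Real.log t : ℂ) ≠ 0 := by exact_mod_cast hlog.ne'
  have hne2 : (p : ℂ) ≠ 0 := by exact_mod_cast hp.ne'
  have heq : (1 / (Real.log t : ℂ)) * I - (Real.Gamma (1 + p / 2) : ℂ) *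
      discreteMean (fun k => c k * ((A k ^ (-(p / 2)) : ℝ) : ℂ)) x =
      (((Real.log t)⁻¹ : ℝ) : ℂ) * (I - ((Real.Gamma (1 + p / 2) / p : ℝ) : ℂ) * S) +
      ((Real.Gamma (1 + p / 2) * ((Real.log x)⁻¹ - (Real.log (1 + x))⁻¹) : ℝ) : ℂ) * S := by
    rw [discreteMean, ← hS, hlx']
    push_cast
    field_simp
    ring
  rw [heq]
  refine (norm_add_le _ _).trans (add_le_add ?_ ?_)
  · rw [norm_mul, Complex.norm_real, Real.norm_of_nonneg (by positivity)]
    exact mul_le_mul_of_nonneg_left hKt (by positivity)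
  · have hd0 : 0 ≤ (Real.log x)⁻¹ - (Real.log (1 + x))⁻¹ :=
      sub_nonneg.2 (inv_anti₀ hlx hl1)
    have hd1 : (Real.log x)⁻¹ - (Real.log (1 + x))⁻¹ ≤ (Real.log x)⁻¹ * (Real.log x)⁻¹ := by
      rw [inv_sub_inv hlx.ne' (hlx.trans_le hl1).ne', ← mul_inv, div_eq_mul_inv]
      refine (mul_le_of_le_one_left (inv_nonneg.2 (mul_pos hlx (hlx.trans_le hl1)).le)
        (by linarith)).trans ?_
      refine inv_anti₀ (by positivity) ?_
      gcongr
    rw [norm_mul, Complex.norm_real, norm_mul, Real.norm_of_nonneg hG.le,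
      Real.norm_of_nonneg hd0]
    calc Real.Gamma (1 + p / 2) * ((Real.log x)⁻¹ - (Real.log (1 + x))⁻¹) * ‖S‖
        ≤ Real.Gamma (1 + p / 2) * ((Real.log x)⁻¹ * (Real.log x)⁻¹) *
          (B * C * (1 + Real.log x)) := by gcongr
      _ = _ := by
        field_simp

end HeatMean

section HeatFormula

variable {H : Type*} [NormedAddCommGroup H] [InnerProductSpace ℂ H] [CompleteSpace H]

/-- The Dixmier trace of `T V` is, up to a Gamma factor, the value of the state on the scaled heat
trace: the logarithmic mean of the latter is the discrete mean of the diagonal of `T V`, up to an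
error that vanishes at infinity. -/
theorem gamma_mul_dixmierTrace_eq {ω : Linfty →ₗ[ℂ] ℂ} (hω : IsState ω)
    (hω' : VanishesOnBounded ω) (hM : ∀ x : Linfty, ω (logMean x) = ω x)
    (hH : ¬ FiniteDimensional ℂ H) {p : ℝ} (hp : 0 < p) {V : H →L[ℂ] H} (hV0 : 0 ≤ V)
    {e : ℕ → H} {A : ℕ → ℝ} (hA : ∀ k, 0 < A k)
    (hV : SortedEigen V e fun k => A k ^ (-(p / 2))) {C : ℝ}
    (hC : ∀ k : ℕ, A k ^ (-(p / 2)) ≤ C / (k + 1)) (T : H →L[ℂ] H) :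
    (Real.Gamma (1 + p / 2) : ℂ) * dixmierTrace (ω ∘ₗ powAct p hp) (T * V) =
      ω (toLinfty (heatMean p (fun k => ⟪e k, T (e k)⟫_ℂ) A)) := by
  have hc : ∀ k, ‖⟪e k, T (e k)⟫_ℂ‖ ≤ ‖T‖ := fun k =>
    norm_inner_apply_self_le T (hV.orth.1 k)
  have hh := memLp_heatMean hp hA hc hC
  have hw := memLp_discreteMean (norm_mul_rpow_le hA hc hC)
  obtain ⟨hm, hlog⟩ := logMean_toLinfty hh
  rw [dixmierTrace_mul_eq (hω.comp_powAct hp) (hω'.comp_powAct hp) hH hV0 hV hC T,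
    LinearMap.comp_apply, powAct_toLinfty hw hp, ← smul_eq_mul, ← map_smul,
    ← toLinfty_const_mul (memLp_comp_rpow hw hp), ← hM (toLinfty (heatMean p _ A)), hlog,
    ← toLinfty_eq hm]
  exact (state_congr_of_tendsto hω hω' hm ((memLp_comp_rpow hw hp).const_mul _)
    (tendsto_logMean_heatMean_sub hp hA hc hC)).symm

end HeatFormula

/-! ### Diagonal operators, functional calculus and the trace -/

section Diagonal

open Filter Topology

variable {H : Type*} [NormedAddCommGroup H] [InnerProductSpace ℂ H]

theorem _root_.HilbertBasis.inner_apply_of_diag {ι : Type*} (b : HilbertBasis ι ℂ H)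
    {K : H →L[ℂ] H} {κ : ι → ℂ} (hK : ∀ i, K (b i) = κ i • b i) (i : ι) (y : H) :
    ⟪b i, K y⟫_ℂ = κ i * ⟪b i, y⟫_ℂ := by
  classical
  have h1 := ((b.hasSum_repr y).mapL K).mapL (innerSL ℂ (b i))
  have h2 : HasSum (fun j => ⟪b i, K (b.repr y j • b j)⟫_ℂ) (κ i * ⟪b i, y⟫_ℂ) := by
    have h3 := hasSum_single (L := SummationFilter.unconditional ι)
      (f := fun j => ⟪b i, K (b.repr y j • b j)⟫_ℂ) i (fun j hj => by
      rw [map_smul, hK, inner_smul_right, inner_smul_right, b.orthonormal.2 hj.symm, mul_zero,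
        mul_zero])
    convert h3 using 1
    rw [map_smul, hK, inner_smul_right, inner_smul_right, inner_self_eq_norm_sq_to_K,
      b.orthonormal.1 i, b.repr_apply_apply]
    simp [mul_comm]
  exact h1.unique h2

theorem _root_.HilbertBasis.hasSum_norm_inner_sq {ι : Type*} (b : HilbertBasis ι ℂ H) (y : H) :
    HasSum (fun i => ‖⟪b i, y⟫_ℂ‖ ^ 2) (‖y‖ ^ 2) := by
  have h := b.hasSum_inner_mul_inner y y
  rw [inner_self_eq_norm_sq_to_K] at h
  have h2 : HasSum (fun i => ((‖⟪b i, y⟫_ℂ‖ ^ 2 : ℝ) : ℂ)) ((‖y‖ ^ 2 : ℝ) : ℂ) := by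
    push_cast
    refine h.congr_fun fun i => ?_
    rw [← inner_conj_symm y (b i), Complex.conj_mul']
  exact_mod_cast h2

theorem _root_.HilbertBasis.norm_apply_le_of_diag {ι : Type*} (b : HilbertBasis ι ℂ H)
    {K : H →L[ℂ] H} {κ : ι → ℂ} (hK : ∀ i, K (b i) = κ i • b i) {d : ℝ} (hd : 0 ≤ d) (y : H)
    (h : ∀ i, ⟪b i, y⟫_ℂ = 0 ∨ ‖κ i‖ ≤ d) : ‖K y‖ ≤ d * ‖y‖ := by
  refine abs_le_of_sq_le_sq' ?_ (by positivity) |>.2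
  rw [mul_pow]
  refine hasSum_le (fun i => ?_) (b.hasSum_norm_inner_sq (K y))
    ((b.hasSum_norm_inner_sq y).mul_left (d ^ 2))
  rw [b.inner_apply_of_diag hK, norm_mul, mul_pow]
  rcases h i with h0 | h0
  · simp [h0]
  · gcongr

theorem _root_.HilbertBasis.ext_inner {ι : Type*} (b : HilbertBasis ι ℂ H) {x y : H}
    (h : ∀ i, ⟪b i, x⟫_ℂ = ⟪b i, y⟫_ℂ) : x = y := by
  refine b.repr.injective ?_
  ext i
  rw [b.repr_apply_apply, b.repr_apply_apply, h i]

theorem _root_.HilbertBasis.exists_diag [CompleteSpace H] {ι : Type*} (b : HilbertBasis ι ℂ H)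
    {κ : ι → ℝ} (h0 : ∀ i, 0 ≤ κ i) (h1 : ∀ i, κ i ≤ 1) :
    ∃ S : H →L[ℂ] H, 0 ≤ S ∧ ∀ i, S (b i) = (κ i : ℂ) • b i := by
  classical
  have hle : ∀ (f : ι → ℂ) (i : ι), ‖(κ i : ℂ) * f i‖ ≤ ‖f i‖ := fun f i => by
    rw [norm_mul, Complex.norm_real, Real.norm_of_nonneg (h0 i)]
    exact mul_le_of_le_one_left (norm_nonneg _) (h1 i)
  have hmem : ∀ f : lp (fun _ : ι => ℂ) 2, Memℓp (fun i => (κ i : ℂ) * f i) 2 := fun f => by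
    have h2 : Summable fun i => ‖f i‖ ^ (2 : ℝ≥0∞).toReal := (lp.memℓp f).summable (by norm_num)
    refine memℓp_gen (h2.of_nonneg_of_le (fun i => by positivity) fun i => ?_)
    exact Real.rpow_le_rpow (norm_nonneg _) (hle f i) (by norm_num)
  let M : lp (fun _ : ι => ℂ) 2 →ₗ[ℂ] lp (fun _ : ι => ℂ) 2 :=
    { toFun := fun f => ⟨fun i => (κ i : ℂ) * f i, hmem f⟩
      map_add' := fun f g => by
        ext i
        exact mul_add (κ i : ℂ) (f i) (g i)
      map_smul' := fun c f => by
        ext i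
        exact mul_left_comm (κ i : ℂ) c (f i) }
  let M' := M.mkContinuous 1 fun f => by
    rw [one_mul]
    exact lp.norm_mono (by norm_num) fun i => hle f i
  let S : H →L[ℂ] H := (b.repr.symm : lp (fun _ : ι => ℂ) 2 →L[ℂ] H) ∘L M' ∘L
    (b.repr : H →L[ℂ] lp (fun _ : ι => ℂ) 2)
  have hinner : ∀ i y, ⟪b i, S y⟫_ℂ = κ i * ⟪b i, y⟫_ℂ := by
    intro i y
    rw [← b.repr_apply_apply, ← b.repr_apply_apply]
    change b.repr (b.repr.symm (M (b.repr y))) i = _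
    rw [LinearIsometryEquiv.apply_symm_apply]
    rfl
  refine ⟨S, ?_, fun i => b.ext_inner fun j => ?_⟩
  · rw [ContinuousLinearMap.nonneg_iff_isPositive, ContinuousLinearMap.isPositive_iff_complex]
    intro y
    have h2 := b.hasSum_inner_mul_inner (S y) y
    have h3 : HasSum (fun i => ((κ i * ‖⟪b i, y⟫_ℂ‖ ^ 2 : ℝ) : ℂ)) ⟪S y, y⟫_ℂ := by
      refine h2.congr_fun fun i => ?_
      rw [← inner_conj_symm (S y) (b i), hinner, map_mul, Complex.conj_ofReal, mul_assoc,
        Complex.conj_mul']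
      push_cast
      rfl
    have h4 := Complex.hasSum_iff _ _ |>.1 h3
    simp only [Complex.ofReal_re, Complex.ofReal_im] at h4
    have hre : 0 ≤ (⟪S y, y⟫_ℂ).re := h4.1.nonneg fun i => mul_nonneg (h0 i) (sq_nonneg _)
    refine ⟨Complex.ext rfl ?_, hre⟩
    rw [← h4.2.tsum_eq]
    simp
  · rw [hinner, inner_smul_right]
    rcases eq_or_ne j i with rfl | hne
    · rfl
    · rw [b.orthonormal.2 hne, mul_zero, mul_zero]

/-- The trace of `T K` for a diagonal operator `K` with summable eigenvalues. In particular, it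
does not depend on the basis in the definition of `trace`. -/
theorem trace_mul_eq_tsum [CompleteSpace H] {ι : Type*} (b : HilbertBasis ι ℂ H) {K : H →L[ℂ] H}
    {κ : ι → ℝ} (h0 : ∀ i, 0 ≤ κ i) (hκ : Summable κ) (hK : ∀ i, K (b i) = (κ i : ℂ) • b i)
    (T : H →L[ℂ] H) : trace (T * K) = ∑' i, ⟪b i, T (b i)⟫_ℂ * κ i := by
  have hspec := (exists_hilbertBasis ℂ H).choose_spec
  rw [trace]
  generalize (exists_hilbertBasis ℂ H).choose = w at hspec ⊢
  obtain ⟨b', hb'⟩ := hspec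
  let F : w → ι → ℂ := fun e i => κ i * (⟪b i, b' e⟫_ℂ * ⟪b' e, T (b i)⟫_ℂ)
  have hrow : ∀ e : w, HasSum (F e) ⟪(e : H), (T * K) (e : H)⟫_ℂ := by
    intro e
    rw [← show b' e = (e : H) by rw [hb']]
    change HasSum (F e) ⟪b' e, T (K (b' e))⟫_ℂ
    rw [← ContinuousLinearMap.adjoint_inner_left]
    refine (b.hasSum_inner_mul_inner _ (K (b' e))).congr_fun fun i => ?_
    rw [b.inner_apply_of_diag hK, ContinuousLinearMap.adjoint_inner_left]
    simp only [F]
    ring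
  have hsq : ∀ (b'' : HilbertBasis w ℂ H) (x : H), Summable fun e => ‖⟪b'' e, x⟫_ℂ‖ ^ 2 :=
    fun b'' x => (HilbertBasis.hasSum_norm_inner_sq b'' x).summable
  -- the double series is dominated through `2 x y ≤ x² + y²` and Parseval's identity
  have hFn : ∀ e i, ‖F e i‖ ≤ κ i * ((‖⟪b' e, b i⟫_ℂ‖ ^ 2 + ‖⟪b' e, T (b i)⟫_ℂ‖ ^ 2) / 2) := by
    intro e i
    simp only [F]
    rw [norm_mul, norm_mul, Complex.norm_real, Real.norm_of_nonneg (h0 i),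
      norm_inner_symm]
    refine mul_le_mul_of_nonneg_left ?_ (h0 i)
    nlinarith [sq_nonneg (‖⟪b' e, b i⟫_ℂ‖ - ‖⟪b' e, T (b i)⟫_ℂ‖)]
  have hcol : ∀ i, HasSum (fun e => κ i * ((‖⟪b' e, b i⟫_ℂ‖ ^ 2 + ‖⟪b' e, T (b i)⟫_ℂ‖ ^ 2) / 2))
      (κ i * ((‖b i‖ ^ 2 + ‖T (b i)‖ ^ 2) / 2)) := fun i =>
    (((HilbertBasis.hasSum_norm_inner_sq b' _).add
      (HilbertBasis.hasSum_norm_inner_sq b' _)).div_const 2).mul_left _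
  have hsum : Summable fun q : ι × w => F q.2 q.1 := by
    have hG : Summable fun q : ι × w =>
        κ q.1 * ((‖⟪b' q.2, b q.1⟫_ℂ‖ ^ 2 + ‖⟪b' q.2, T (b q.1)⟫_ℂ‖ ^ 2) / 2) := by
      refine (summable_prod_of_nonneg fun q => ?_).2 ⟨fun i => (hcol i).summable, ?_⟩
      · exact mul_nonneg (h0 _) (by positivity)
      · refine (hκ.mul_right ((1 + ‖T‖ ^ 2) / 2)).of_nonneg_of_le
          (fun i => tsum_nonneg fun e => mul_nonneg (h0 _) (by positivity)) fun i => ?_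
        rw [(hcol i).tsum_eq]
        refine mul_le_mul_of_nonneg_left ?_ (h0 i)
        have h2 := T.le_opNorm (b i)
        rw [b.orthonormal.1 i, mul_one] at h2
        rw [b.orthonormal.1 i, one_pow]
        gcongr
    exact hG.of_norm_bounded fun q => hFn q.2 q.1
  have hcolF : ∀ i, HasSum (fun e => F e i) (⟪b i, T (b i)⟫_ℂ * κ i) := by
    intro i
    rw [mul_comm]
    exact (b'.hasSum_inner_mul_inner (b i) (T (b i))).mul_left _
  have hcomm : ∑' e : w, ∑' i, F e i = ∑' i, ∑' e : w, F e i := by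
    have hs2 : Summable (Function.uncurry F) :=
      hsum.comp_injective (i := Prod.swap) Prod.swap_injective
    exact hs2.tsum_comm.symm
  calc ∑' e : w, ⟪(e : H), (T * K) (e : H)⟫_ℂ = ∑' e : w, ∑' i, F e i :=
      tsum_congr fun e => (hrow e).tsum_eq.symm
    _ = ∑' i, ∑' e : w, F e i := hcomm
    _ = _ := tsum_congr fun i => (hcolF i).tsum_eq

theorem cfc_apply_eigenvector [CompleteSpace H] {R : H →L[ℂ] H} (hR : IsSelfAdjoint R) {r : ℝ}
    {x : H} (hx : R x = (r : ℂ) • x) {f : ℝ → ℝ} (hf : Continuous f) :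
    cfc f R x = (f r : ℂ) • x := by
  rcases eq_or_ne x 0 with rfl | hx0
  · simp
  have hmem : r ∈ spectrum ℝ R := by
    intro hu
    have h1 : (algebraMap ℝ (H →L[ℂ] H) r - R) x = 0 := by
      rw [sub_apply, hx, Algebra.algebraMap_eq_smul_one, smul_apply, one_apply_eq_self,
        Complex.coe_smul, sub_self]
    obtain ⟨u, hu⟩ := hu
    have h2 : ((u⁻¹ : (H →L[ℂ] H)ˣ) : H →L[ℂ] H) ((u : H →L[ℂ] H) x) = x := by
      change ((u⁻¹ * u : (H →L[ℂ] H)ˣ) : H →L[ℂ] H) x = x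
      rw [inv_mul_cancel]
      rfl
    rw [hu, h1, map_zero] at h2
    exact hx0 h2.symm
  rw [cfc_apply f R hR hf.continuousOn]
  suffices h : ∀ g : C(spectrum ℝ R, ℝ), cfcHom hR g x = (g ⟨r, hmem⟩ : ℂ) • x from h _
  intro g
  induction g using ContinuousMap.induction_on_of_compact with
  | const a =>
    have h1 : (ContinuousMap.const (spectrum ℝ R) a) = algebraMap ℝ C(spectrum ℝ R, ℝ) a := rfl
    rw [h1, AlgHomClass.commutes, Algebra.algebraMap_eq_smul_one, smul_apply, one_apply_eq_self,
      Algebra.algebraMap_eq_smul_one]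
    simp
  | id =>
    rw [cfcHom_id]
    exact hx
  | star_id =>
    rw [map_star, cfcHom_id, hR.star_eq]
    exact hx
  | add f g hf hg =>
    rw [map_add, add_apply, hf, hg, ← add_smul, ContinuousMap.add_apply, Complex.ofReal_add]
  | mul f g hf hg =>
    rw [map_mul, mul_apply_eq_comp, hg, map_smul, hf, smul_smul, ContinuousMap.mul_apply,
      Complex.ofReal_mul, mul_comm]
  | frequently f h =>
    refine h.mem_of_closed (s := {g : C(spectrum ℝ R, ℝ) | cfcHom hR g x = (g ⟨r, hmem⟩ : ℂ) • x})
      ?_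
    have hc1 : Continuous fun g : C(spectrum ℝ R, ℝ) => cfcHom hR g x :=
      (ContinuousLinearMap.apply ℂ H x).continuous.comp (cfcHom_continuous hR)
    have hc2 : Continuous fun g : C(spectrum ℝ R, ℝ) => (g ⟨r, hmem⟩ : ℂ) • x := by
      have : Continuous fun g : C(spectrum ℝ R, ℝ) => g ⟨r, hmem⟩ := continuous_eval_const _
      exact (Complex.continuous_ofReal.comp this).smul continuous_const
    exact isClosed_eq hc1 hc2

/-- The function of the resolvent `r = 1 / (1 + s)` that stands for `(1 + s) ^ (-q)`. -/
theorem resolventPow_fun_eq {q : ℝ} (hq : 0 < q) :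
    (fun r : ℝ => if 0 < r then (1 + (1 / r - 1)) ^ (-q) else 0) = fun r => (max r 0) ^ q := by
  funext r
  split_ifs with h
  · rw [add_sub_cancel, max_eq_left h.le, one_div, Real.inv_rpow h.le, Real.rpow_neg h.le, inv_inv]
  · rw [max_eq_right (not_lt.1 h), Real.zero_rpow hq.ne']

theorem continuous_max_rpow {q : ℝ} (hq : 0 < q) : Continuous fun r : ℝ => (max r 0) ^ q :=
  (continuous_id.max continuous_const).rpow_const fun _ => Or.inr hq.le

/-- The function of the resolvent `r = 1 / (1 + s)` that stands for `exp (-a s)`. -/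
theorem continuous_heat_fun {a : ℝ} (ha : 0 < a) :
    Continuous fun r : ℝ => if 0 < r then Real.exp (-(a * (1 / r - 1))) else 0 := by
  have h : (fun r : ℝ => if 0 < r then Real.exp (-(a * (1 / r - 1))) else 0) =
      fun r => Real.exp a * expNegInvGlue (r / a) := by
    funext r
    split_ifs with hr
    · have : ¬ r / a ≤ 0 := not_le.2 (by positivity)
      rw [expNegInvGlue, if_neg this, ← Real.exp_add]
      congr 1
      field_simp
      ring
    · have : r / a ≤ 0 := div_nonpos_of_nonpos_of_nonneg (not_lt.1 hr) ha.le
      rw [expNegInvGlue, if_pos this, mul_zero]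
  rw [h]
  exact continuous_const.mul (expNegInvGlue.contDiff.continuous (n := 0) |>.comp
    (continuous_id.div_const a))

variable [CompleteSpace H]

theorem heat_apply_eigenvector {L : H →ₗ.[ℂ] H}
    (hR : 0 ≤ boundedInverse ((LinearMap.id : H →ₗ[ℂ] H) +ᵥ L)) {A : ℝ} (hA : 0 < A) {x : H}
    (hx : boundedInverse ((LinearMap.id : H →ₗ[ℂ] H) +ᵥ L) x = ((A⁻¹ : ℝ) : ℂ) • x) {a : ℝ}
    (ha : 0 < a) : heat L a x = ((Real.exp (-(a * (A - 1))) : ℝ) : ℂ) • x := by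
  rw [heat, funcCalc, cfc_apply_eigenvector (IsSelfAdjoint.of_nonneg hR) hx
    (continuous_heat_fun ha), if_pos (inv_pos.2 hA), one_div, inv_inv]

theorem resolventPow_apply_eigenvector {L : H →ₗ.[ℂ] H}
    (hR : 0 ≤ boundedInverse ((LinearMap.id : H →ₗ[ℂ] H) +ᵥ L)) {A : ℝ} (hA : 0 < A) {x : H}
    (hx : boundedInverse ((LinearMap.id : H →ₗ[ℂ] H) +ᵥ L) x = ((A⁻¹ : ℝ) : ℂ) • x) {q : ℝ}
    (hq : 0 < q) : resolventPow L q x = ((A ^ (-q) : ℝ) : ℂ) • x := by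
  have h := cfc_apply_eigenvector (IsSelfAdjoint.of_nonneg hR) hx (continuous_max_rpow hq)
  rw [resolventPow, funcCalc, resolventPow_fun_eq hq, h, max_eq_left (inv_pos.2 hA).le,
    Real.inv_rpow hA.le, Real.rpow_neg hA.le]

theorem resolventPow_nonneg (L : H →ₗ.[ℂ] H) {q : ℝ} (hq : 0 < q) : 0 ≤ resolventPow L q := by
  rw [resolventPow, funcCalc, resolventPow_fun_eq hq]
  exact cfc_nonneg fun r _ => Real.rpow_nonneg (le_max_right _ _) _

/-- A positive injective compact operator `R` whose singular values decay like a power has a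
Hilbert basis of eigenvectors, sorted by decreasing eigenvalue. -/
theorem exists_hilbertBasis_sortedEigen (hH : ¬ FiniteDimensional ℂ H) {R : H →L[ℂ] H}
    (hRc : IsCompactOperator R) (hR0 : 0 ≤ R) (hRi : Function.Injective R) {q : ℝ} (hq : 0 < q)
    (hdecay : ∀ x : ℕ → H, ∀ l : ℕ → ℝ, SortedEigen R x l → (∀ k, 0 < l k) →
      ∃ C : ℝ, ∀ k : ℕ, l k ^ q ≤ C / (k + 1)) :
    ∃ (e : HilbertBasis ℕ ℂ H) (A : ℕ → ℝ) (C : ℝ), (∀ k, 0 < A k) ∧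
      SortedEigen R e (fun k => (A k)⁻¹) ∧ ∀ k : ℕ, A k ^ (-q) ≤ C / (k + 1) := by
  obtain ⟨x, l, h⟩ := exists_sortedEigen hRc hR0 hH
  have hl : ∀ k, 0 < l k := by
    intro k
    refine (h.nonneg k).lt_of_ne fun h0 => ?_
    have h1 := h.eig k
    rw [← h0, Complex.ofReal_zero, zero_smul, ← map_zero R] at h1
    have := h.orth.1 k
    rw [hRi h1, norm_zero] at this
    exact zero_ne_one this
  obtain ⟨C, hC⟩ := hdecay x l h hl
  have hlim : ∀ ε > 0, ∃ n, l n < ε := by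
    intro ε hε
    obtain ⟨n, hn⟩ := exists_nat_gt (C / ε ^ q)
    have hεq : 0 < ε ^ q := Real.rpow_pos_of_pos hε q
    refine ⟨n, (Real.rpow_lt_rpow_iff (hl n).le hε.le hq).1 ((hC n).trans_lt ?_)⟩
    rw [div_lt_iff₀ (by positivity)]
    rw [div_lt_iff₀ hεq] at hn
    nlinarith
  have hcomplete : (Submodule.span ℂ (Set.range x))ᗮ = ⊥ := by
    rw [Submodule.eq_bot_iff]
    intro y hy
    have hy' : ∀ k, ⟪x k, y⟫_ℂ = 0 := fun k => hy _ (Submodule.subset_span ⟨k, rfl⟩)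
    have hRy : R y = 0 := by
      refine norm_le_zero_iff.1 (le_of_forall_pos_le_add fun ε hε => ?_)
      obtain ⟨n, hn⟩ := hlim (ε / (‖y‖ + 1)) (by positivity)
      rw [zero_add]
      calc ‖R y‖ ≤ l n * ‖y‖ := h.bound n y fun k _ => hy' k
        _ ≤ ε / (‖y‖ + 1) * (‖y‖ + 1) := by
          gcongr
          linarith
        _ = ε := by field_simp
    exact hRi (hRy.trans (map_zero R).symm)
  refine ⟨HilbertBasis.mkOfOrthogonalEqBot h.orth hcomplete, fun k => (l k)⁻¹, C,
    fun k => inv_pos.2 (hl k), ?_, fun k => ?_⟩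
  · simp only [inv_inv, HilbertBasis.coe_mkOfOrthogonalEqBot]
    exact h
  · rw [Real.rpow_neg (inv_pos.2 (hl k)).le, Real.inv_rpow (hl k).le, inv_inv]
    exact hC k

theorem sortedEigen_resolventPow {L : H →ₗ.[ℂ] H}
    (hR : 0 ≤ boundedInverse ((LinearMap.id : H →ₗ[ℂ] H) +ᵥ L)) {e : HilbertBasis ℕ ℂ H}
    {A : ℕ → ℝ} (hA : ∀ k, 0 < A k)
    (h : SortedEigen (boundedInverse ((LinearMap.id : H →ₗ[ℂ] H) +ᵥ L)) e fun k => (A k)⁻¹) {q : ℝ}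
    (hq : 0 < q) : SortedEigen (resolventPow L q) e fun k => A k ^ (-q) := by
  have heig : ∀ k, resolventPow L q (e k) = ((A k ^ (-q) : ℝ) : ℂ) • e k := fun k =>
    resolventPow_apply_eigenvector hR (hA k) (h.eig k) hq
  have hanti : Antitone fun k => A k ^ (-q) := by
    intro i j hij
    simp only
    rw [Real.rpow_neg (hA i).le, Real.rpow_neg (hA j).le, ← Real.inv_rpow (hA i).le,
      ← Real.inv_rpow (hA j).le]
    exact Real.rpow_le_rpow (inv_pos.2 (hA j)).le (h.anti hij) hq.le
  refine ⟨h.orth, hanti, fun k => Real.rpow_nonneg (hA k).le _, heig, fun n y hy => ?_⟩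
  refine HilbertBasis.norm_apply_le_of_diag e heig (Real.rpow_nonneg (hA n).le _) y fun k => ?_
  rcases lt_or_ge k n with hk | hk
  · exact Or.inl (hy k hk)
  · right
    rw [Complex.norm_real, Real.norm_of_nonneg (Real.rpow_nonneg (hA k).le _)]
    exact hanti hk

end Diagonal

/-! ### Resolvents of spectral triples -/

section Resolvent

variable {H : Type*} [NormedAddCommGroup H] [InnerProductSpace ℂ H]

theorem IsBoundedInverse.boundedInverse_eq {L : H →ₗ.[ℂ] H} {R : H →L[ℂ] H}
    (h : IsBoundedInverse L R) : boundedInverse L = R := by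
  have hex : ∃ R : H →L[ℂ] H, IsBoundedInverse L R := ⟨R, h⟩
  have hb : IsBoundedInverse L (boundedInverse L) := by
    rw [boundedInverse, dif_pos hex]
    exact hex.choose_spec
  ext y
  obtain ⟨hy, hy'⟩ := h.1 y
  have h1 := hb.2 ⟨R y, hy⟩
  rwa [hy'] at h1

theorem IsBoundedInverse.injective {L : H →ₗ.[ℂ] H} {R : H →L[ℂ] H}
    (h : IsBoundedInverse L R) : Function.Injective R := by
  intro y y' hyy
  obtain ⟨h1, h2⟩ := h.1 y
  obtain ⟨h3, h4⟩ := h.1 y'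
  rw [← h2, ← h4]
  congr 1
  exact Subtype.ext hyy

theorem mem_square_domain {D : H →ₗ.[ℂ] H} {x : H} (h : x ∈ D.domain)
    (h' : D ⟨x, h⟩ ∈ D.domain) :
    ∃ hx : x ∈ (square D).domain, square D ⟨x, hx⟩ = D ⟨D ⟨x, h⟩, h'⟩ := by
  have hx : x ∈ (square D).domain := ⟨⟨x, h⟩, h', rfl⟩
  refine ⟨hx, ?_⟩
  set z := ((D.domain.comap D.toFun).equivMapOfInjective D.domain.subtype
      D.domain.injective_subtype).symm ⟨x, hx⟩ with hz
  have h1 : (D.domain.comap D.toFun).equivMapOfInjective D.domain.subtype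
      D.domain.injective_subtype z = ⟨x, hx⟩ := LinearEquiv.apply_symm_apply _ _
  have h2 : z = ⟨⟨x, h⟩, h'⟩ := by
    have h3 : ((z : D.domain) : H) = x := by
      have := Subtype.ext_iff.1 h1
      rwa [Submodule.coe_equivMapOfInjective_apply] at this
    exact Subtype.ext (Subtype.ext h3)
  change D.toFun ((D.toFun.restrict (p := D.domain.comap D.toFun) (q := D.domain)
    fun _ h => h) z) = _
  rw [h2]
  rfl

theorem exists_of_mem_square_domain {D : H →ₗ.[ℂ] H} (x : (square D).domain) :
    ∃ (h : (x : H) ∈ D.domain) (h' : D ⟨x, h⟩ ∈ D.domain), square D x = D ⟨D ⟨x, h⟩, h'⟩ := by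
  obtain ⟨x, hx⟩ := x
  obtain ⟨⟨y, hy⟩, hy', rfl⟩ := id hx
  obtain ⟨h1, h2⟩ := mem_square_domain hy hy'
  exact ⟨hy, hy', h2⟩

/-- `(1 + L)⁻¹` is a positive bounded operator, and `L` has in the Hilbert basis `e` the eigenvalues
`A k - 1`, in non-decreasing order, where `0 < A k` and `A k ^ (-q) ≤ C / (k + 1)`. All of it is
expressed through `(1 + L)⁻¹`, since the functional calculus of `L` is defined that way. -/
structure HasSortedBasis (L : H →ₗ.[ℂ] H) (q : ℝ) (e : HilbertBasis ℕ ℂ H) (A : ℕ → ℝ) (C : ℝ) :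
    Prop where
  inv : IsBoundedInverse ((LinearMap.id : H →ₗ[ℂ] H) +ᵥ L)
    (boundedInverse ((LinearMap.id : H →ₗ[ℂ] H) +ᵥ L))
  nonneg : 0 ≤ boundedInverse ((LinearMap.id : H →ₗ[ℂ] H) +ᵥ L)
  pos : ∀ k, 0 < A k
  sorted : SortedEigen (boundedInverse ((LinearMap.id : H →ₗ[ℂ] H) +ᵥ L)) e fun k => (A k)⁻¹
  decay : ∀ k : ℕ, A k ^ (-q) ≤ C / (k + 1)

theorem HasSortedBasis.apply_basis {L : H →ₗ.[ℂ] H} {q : ℝ} {e : HilbertBasis ℕ ℂ H} {A : ℕ → ℝ}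
    {C : ℝ} (h : HasSortedBasis L q e A C) (k : ℕ) :
    ∃ hk : e k ∈ L.domain, L ⟨e k, hk⟩ = ((A k - 1 : ℝ) : ℂ) • e k := by
  have hA := (h.pos k).ne'
  obtain ⟨h1, h2⟩ := h.inv.1 (((A k : ℝ) : ℂ) • e k)
  set R := boundedInverse ((LinearMap.id : H →ₗ[ℂ] H) +ᵥ L)
  have h3 : R (((A k : ℝ) : ℂ) • e k) = e k := by
    rw [map_smul, h.sorted.eig, smul_smul, ← Complex.ofReal_mul, mul_inv_cancel₀ hA,
      Complex.ofReal_one, one_smul]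
  have h4 : e k ∈ L.domain := by
    have : R (((A k : ℝ) : ℂ) • e k) ∈ L.domain := h1
    rwa [h3] at this
  refine ⟨h4, ?_⟩
  have h5 : R (((A k : ℝ) : ℂ) • e k) + L ⟨R (((A k : ℝ) : ℂ) • e k), h1⟩ =
      ((A k : ℝ) : ℂ) • e k := h2
  have h6 : (⟨R (((A k : ℝ) : ℂ) • e k), h1⟩ : L.domain) = ⟨e k, h4⟩ := Subtype.ext h3
  rw [h6, h3] at h5
  rw [eq_sub_of_add_eq' h5]
  push_cast
  rw [sub_smul, one_smul]

theorem HasSortedBasis.inner_apply {L : H →ₗ.[ℂ] H} {q : ℝ} {e : HilbertBasis ℕ ℂ H} {A : ℕ → ℝ}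
    {C : ℝ} (h : HasSortedBasis L q e A C) (k : ℕ) (x : L.domain) :
    ⟪e k, L x⟫_ℂ = ((A k - 1 : ℝ) : ℂ) * ⟪e k, (x : H)⟫_ℂ := by
  have hA : (A k : ℂ) ≠ 0 := by exact_mod_cast (h.pos k).ne'
  have h1 : boundedInverse ((LinearMap.id : H →ₗ[ℂ] H) +ᵥ L) ((x : H) + L x) = x := h.inv.2 x
  have h2 : ⟪e k, boundedInverse ((LinearMap.id : H →ₗ[ℂ] H) +ᵥ L) ((x : H) + L x)⟫_ℂ =
      ⟪e k, (x : H)⟫_ℂ := by rw [h1]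
  rw [← inner_apply_right_of_nonneg h.nonneg, h.sorted.eig, inner_smul_left, Complex.conj_ofReal,
    inner_add_right] at h2
  push_cast at h2 ⊢
  field_simp at h2
  linear_combination h2

variable [CompleteSpace H]

theorem symmetric_of_isSelfAdjoint {D : H →ₗ.[ℂ] H} (hD : IsSelfAdjoint D) (x y : D.domain) :
    ⟪D x, (y : H)⟫_ℂ = ⟪(x : H), D y⟫_ℂ := by
  have h := LinearPMap.adjoint_isFormalAdjoint hD.dense_domain
  rw [LinearPMap.isSelfAdjoint_def.1 hD] at h
  exact h x y

theorem square_form_eq {D : H →ₗ.[ℂ] H} (hD : IsSelfAdjoint D) (x : (square D).domain) :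
    ∃ r : ℝ, 0 ≤ r ∧ ⟪(x : H), square D x⟫_ℂ = r := by
  obtain ⟨h, h', hx⟩ := exists_of_mem_square_domain x
  refine ⟨‖D ⟨x, h⟩‖ ^ 2, sq_nonneg _, ?_⟩
  rw [hx, ← symmetric_of_isSelfAdjoint hD ⟨x, h⟩ ⟨_, h'⟩, inner_self_eq_norm_sq_to_K]
  simp

/-- The adjoint of `(D + i)⁻¹` maps into the domain of `D` and inverts `D - i` from the right. -/
theorem adjoint_resolvent {D : H →ₗ.[ℂ] H} (hD : IsSelfAdjoint D) {R : H →L[ℂ] H}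
    (hR : IsBoundedInverse ((Complex.I • (LinearMap.id : H →ₗ[ℂ] H)) +ᵥ D) R) (y : H) :
    ∃ h : star R y ∈ D.domain, D ⟨star R y, h⟩ = y + Complex.I • star R y := by
  have key : ∀ x : D.domain, ⟪y + Complex.I • star R y, (x : H)⟫_ℂ = ⟪star R y, D x⟫_ℂ := by
    intro x
    have h1 : R (Complex.I • (x : H) + D x) = x := hR.2 x
    have h2 : ⟪star R y, Complex.I • (x : H) + D x⟫_ℂ = ⟪y, (x : H)⟫_ℂ := by
      rw [ContinuousLinearMap.star_eq_adjoint, ContinuousLinearMap.adjoint_inner_left, h1]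
    rw [inner_add_right, inner_smul_right] at h2
    rw [inner_add_left, inner_smul_left, Complex.conj_I, ← h2]
    ring
  have hmem : star R y ∈ (LinearPMap.adjoint D).domain :=
    LinearPMap.mem_adjoint_domain_of_exists _ ⟨_, key⟩
  have happ := LinearPMap.adjoint_apply_eq hD.dense_domain ⟨star R y, hmem⟩ key
  have hDD := LinearPMap.isSelfAdjoint_def.1 hD
  generalize hE : LinearPMap.adjoint D = E at hmem happ hDD
  subst hDD
  exact ⟨hmem, happ⟩

/-- With `R = (D + i)⁻¹` one has `(1 + D²)⁻¹ = (D + i)⁻¹ (D - i)⁻¹ = R R*`. -/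
theorem isBoundedInverse_square {D : H →ₗ.[ℂ] H} (hD : IsSelfAdjoint D) {R : H →L[ℂ] H}
    (hR : IsBoundedInverse ((Complex.I • (LinearMap.id : H →ₗ[ℂ] H)) +ᵥ D) R) :
    IsBoundedInverse ((LinearMap.id : H →ₗ[ℂ] H) +ᵥ square D) (R * star R) := by
  have hright : ∀ y : H, ∃ h : (R * star R) y ∈ (square D).domain,
      (R * star R) y + square D ⟨(R * star R) y, h⟩ = y := by
    intro y
    obtain ⟨hw, hDw⟩ := adjoint_resolvent hD hR y
    set w := star R y with hwdef
    obtain ⟨hu, hDu⟩ := hR.1 w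
    have hu' : R w ∈ D.domain := hu
    have hDu' : Complex.I • R w + D ⟨R w, hu'⟩ = w := hDu
    have hDu2 : D ⟨R w, hu'⟩ = w - Complex.I • R w := eq_sub_of_add_eq' hDu'
    have hmem : D ⟨R w, hu'⟩ ∈ D.domain := by
      rw [hDu2]
      exact D.domain.sub_mem hw (D.domain.smul_mem _ hu')
    obtain ⟨hx, hsq⟩ := mem_square_domain hu' hmem
    refine ⟨hx, ?_⟩
    change R w + square D ⟨R w, hx⟩ = y
    have h1 : (⟨D ⟨R w, hu'⟩, hmem⟩ : D.domain) = ⟨w, hw⟩ - Complex.I • ⟨R w, hu'⟩ :=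
      Subtype.ext hDu2
    rw [hsq, h1, LinearPMap.map_sub, LinearPMap.map_smul, hDw, hDu2, smul_sub, smul_smul,
      Complex.I_mul_I, ← hwdef, neg_one_smul]
    abel
  refine ⟨hright, fun x => ?_⟩
  change (R * star R) ((x : H) + square D x) = x
  obtain ⟨h, hy⟩ := hright ((x : H) + square D x)
  set u : (square D).domain := ⟨_, h⟩ with hu
  have hz : ((u - x : (square D).domain) : H) + square D (u - x) = 0 := by
    rw [LinearPMap.map_sub, Submodule.coe_sub]
    have hy' : (u : H) + square D u = (x : H) + square D x := hy
    rw [sub_add_sub_comm, hy', sub_self]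
  obtain ⟨r, hr0, hr⟩ := square_form_eq hD (u - x)
  have h2 : ⟪((u - x : (square D).domain) : H),
      ((u - x : (square D).domain) : H) + square D (u - x)⟫_ℂ = 0 := by
    rw [hz, inner_zero_right]
  rw [inner_add_right, hr, inner_self_eq_norm_sq_to_K] at h2
  have h3 : ‖((u - x : (square D).domain) : H)‖ ^ 2 + r = 0 := by
    have h5 : ((‖((u - x : (square D).domain) : H)‖ ^ 2 + r : ℝ) : ℂ) = 0 := by
      push_cast
      exact h2
    exact_mod_cast h5
  have h4 : ‖((u - x : (square D).domain) : H)‖ = 0 := by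
    have := sq_nonneg ‖((u - x : (square D).domain) : H)‖
    exact pow_eq_zero_iff two_ne_zero |>.1 (by linarith)
  rw [norm_eq_zero, Submodule.coe_sub, sub_eq_zero] at h4
  exact h4

theorem SpectralTriple.exists_hasSortedBasis (hH : ¬ FiniteDimensional ℂ H) (X : SpectralTriple H)
    {p : ℝ} (hp : 0 < p) (hX : X.IsSummable p) :
    ∃ (e : HilbertBasis ℕ ℂ H) (A : ℕ → ℝ) (C : ℝ),
      HasSortedBasis (square X.D) (p / 2) e A C ∧ ∀ k, 1 ≤ A k := by
  have hq : 0 < p / 2 := by positivity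
  obtain ⟨R₀, hR₀c, hR₀⟩ := X.compact_resolvent
  have hinv := isBoundedInverse_square X.selfAdjoint hR₀
  have heq := hinv.boundedInverse_eq
  have hinv' := hinv
  rw [← heq] at hinv'
  have hR0 : 0 ≤ boundedInverse ((LinearMap.id : H →ₗ[ℂ] H) +ᵥ square X.D) := by
    rw [heq]
    exact mul_star_self_nonneg R₀
  have hRc : IsCompactOperator (boundedInverse ((LinearMap.id : H →ₗ[ℂ] H) +ᵥ square X.D)) := by
    rw [heq]
    exact hR₀c.comp_clm (star R₀)
  obtain ⟨e, A, C, hA, hs, hC⟩ := exists_hilbertBasis_sortedEigen hH hRc hR0 hinv'.injective hq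
    (fun x l h hl => by
      obtain ⟨C, hC⟩ := hX
      refine ⟨C, fun k => le_trans ?_ (hC k)⟩
      refine le_singularValue (v := fun i : Fin (k + 1) => x i)
        (m := fun i => ((l i ^ (p / 2) : ℝ) : ℂ)) (h.orth.comp _ Fin.val_injective)
        (fun i => ?_) fun i => ?_
      · have h1 := resolventPow_apply_eigenvector (L := square X.D) hR0 (A := (l i)⁻¹)
          (inv_pos.2 (hl i)) (x := x i) (by rw [inv_inv]; exact h.eig i) hq
        rwa [Real.rpow_neg (inv_pos.2 (hl i)).le, Real.inv_rpow (hl i).le, inv_inv] at h1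
      · rw [Complex.norm_real, Real.norm_of_nonneg (Real.rpow_nonneg (hl _).le _)]
        exact Real.rpow_le_rpow (hl k).le (h.anti (by omega)) hq.le)
  have hbasis : HasSortedBasis (square X.D) (p / 2) e A C := ⟨hinv', hR0, hA, hs, hC⟩
  refine ⟨e, A, C, hbasis, fun k => ?_⟩
  obtain ⟨hk, hk'⟩ := hbasis.apply_basis k
  obtain ⟨r, hr0, hr⟩ := square_form_eq X.selfAdjoint ⟨e k, hk⟩
  rw [hk', inner_smul_right, inner_self_eq_norm_sq_to_K, e.orthonormal.1 k] at hr
  have h1 : A k - 1 = r := by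
    have : ((A k - 1 : ℝ) : ℂ) = r := by simpa using hr
    exact_mod_cast this
  linarith

end Resolvent

/-! ### The tensor product of two operators with sorted eigenbases -/

section TensorBasis

variable {H₁ H₂ : Type*} [NormedAddCommGroup H₁] [InnerProductSpace ℂ H₁]
  [NormedAddCommGroup H₂] [InnerProductSpace ℂ H₂]

theorem inner_tmul_tmul (x x' : H₁) (y y' : H₂) :
    ⟪tmul x y, tmul x' y'⟫_ℂ = ⟪x, x'⟫_ℂ * ⟪y, y'⟫_ℂ := by
  rw [tmul, tmul, UniformSpace.Completion.inner_coe, TensorProduct.inner_tmul]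

theorem tmul_smul_left (c : ℂ) (x : H₁) (y : H₂) : tmul (c • x) y = c • tmul x y := by
  rw [tmul, tmul, ← UniformSpace.Completion.coe_smul, TensorProduct.smul_tmul']

theorem tmul_smul_right (c : ℂ) (x : H₁) (y : H₂) : tmul x (c • y) = c • tmul x y := by
  rw [tmul, tmul, ← UniformSpace.Completion.coe_smul, TensorProduct.tmul_smul]

theorem tensorOp_tmul [CompleteSpace H₁] [CompleteSpace H₂] (T₁ : H₁ →L[ℂ] H₁)
    (T₂ : H₂ →L[ℂ] H₂) (x : H₁) (y : H₂) :
    tensorOp T₁ T₂ (tmul x y) = tmul (T₁ x) (T₂ y) := by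
  rw [tensorOp, tmul, ContinuousLinearMap.completion_apply_coe]
  rfl

theorem orthonormal_tmul {ι κ : Type*} {e : ι → H₁} {f : κ → H₂} (he : Orthonormal ℂ e)
    (hf : Orthonormal ℂ f) : Orthonormal ℂ fun q : ι × κ => tmul (e q.1) (f q.2) := by
  classical
  rw [orthonormal_iff_ite] at he hf ⊢
  rintro ⟨i, j⟩ ⟨i', j'⟩
  rw [inner_tmul_tmul, he, hf]
  by_cases h1 : i = i' <;> by_cases h2 : j = j' <;> simp [h1, h2]

theorem span_tmul_orthogonal {ι κ : Type*} (e : HilbertBasis ι ℂ H₁) (f : HilbertBasis κ ℂ H₂) :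
    (Submodule.span ℂ (Set.range fun q : ι × κ => tmul (e q.1) (f q.2)))ᗮ = ⊥ := by
  rw [Submodule.eq_bot_iff]
  intro z hz
  have h1 : ∀ i j, ⟪tmul (e i) (f j), z⟫_ℂ = 0 := fun i j =>
    hz _ (Submodule.subset_span ⟨(i, j), rfl⟩)
  have hcont : Continuous fun q : H₁ × H₂ => ⟪tmul q.1 q.2, z⟫_ℂ := by
    have h0 : Continuous fun q : H₁ × H₂ => (tmul q.1 q.2 : HilbertTensor H₁ H₂) :=
      (UniformSpace.Completion.continuous_coe (H₁ ⊗[ℂ] H₂)).comp TensorProduct.continuous_tmul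
    exact h0.inner continuous_const
  -- pass from basis vectors to arbitrary vectors in one factor after the other
  have h2 : ∀ i y, ⟪tmul (e i) y, z⟫_ℂ = 0 := by
    intro i y
    have hs := f.hasSum_repr y
    have hc : Continuous fun y : H₂ => ⟪tmul (e i) y, z⟫_ℂ :=
      Continuous.comp (g := fun q : H₁ × H₂ => ⟪tmul q.1 q.2, z⟫_ℂ) (f := fun y => (e i, y)) hcont
        (Continuous.prodMk continuous_const continuous_id)
    have hclosed : IsClosed {y : H₂ | ⟪tmul (e i) y, z⟫_ℂ = 0} := isClosed_eq hc continuous_const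
    refine hclosed.mem_of_tendsto hs (Filter.Eventually.of_forall fun s => ?_)
    change ⟪tmul (e i) (∑ j ∈ s, f.repr y j • f j), z⟫_ℂ = 0
    rw [tmul, TensorProduct.tmul_sum, ← UniformSpace.Completion.coe_toComplₗᵢ (𝕜 := ℂ), map_sum,
      sum_inner]
    refine Finset.sum_eq_zero fun j _ => ?_
    change ⟪tmul (e i) (f.repr y j • f j), z⟫_ℂ = 0
    rw [tmul_smul_right, inner_smul_left, h1, mul_zero]
  have h3 : ∀ x y, ⟪tmul x y, z⟫_ℂ = 0 := by
    intro x y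
    have hs := e.hasSum_repr x
    have hc : Continuous fun x : H₁ => ⟪tmul x y, z⟫_ℂ :=
      Continuous.comp (g := fun q : H₁ × H₂ => ⟪tmul q.1 q.2, z⟫_ℂ) (f := fun x => (x, y)) hcont
        (Continuous.prodMk continuous_id continuous_const)
    have hclosed : IsClosed {x : H₁ | ⟪tmul x y, z⟫_ℂ = 0} := isClosed_eq hc continuous_const
    refine hclosed.mem_of_tendsto hs (Filter.Eventually.of_forall fun s => ?_)
    change ⟪tmul (∑ j ∈ s, e.repr x j • e j) y, z⟫_ℂ = 0
    rw [tmul, TensorProduct.sum_tmul, ← UniformSpace.Completion.coe_toComplₗᵢ (𝕜 := ℂ), map_sum,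
      sum_inner]
    refine Finset.sum_eq_zero fun j _ => ?_
    change ⟪tmul (e.repr x j • e j) y, z⟫_ℂ = 0
    rw [tmul_smul_left, inner_smul_left, h2, mul_zero]
  have h4 : ∀ w : HilbertTensor H₁ H₂, ⟪w, z⟫_ℂ = 0 := by
    intro w
    refine UniformSpace.Completion.induction_on w
      (isClosed_eq (continuous_id.inner continuous_const) continuous_const) fun a => ?_
    induction a with
    | zero => rw [UniformSpace.Completion.coe_zero, inner_zero_left]
    | add a b ha hb => rw [UniformSpace.Completion.coe_add, inner_add_left, ha, hb, add_zero]
    | tmul x y => exact h3 x y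
  exact inner_self_eq_zero.1 (h4 z)

/-- The Hilbert basis `e i ⊗ f j` of the Hilbert space tensor product. -/
noncomputable def tensorBasis {ι κ : Type*} (e : HilbertBasis ι ℂ H₁) (f : HilbertBasis κ ℂ H₂) :
    HilbertBasis (ι × κ) ℂ (HilbertTensor H₁ H₂) :=
  HilbertBasis.mkOfOrthogonalEqBot (orthonormal_tmul e.orthonormal f.orthonormal)
    (span_tmul_orthogonal e f)

theorem tensorBasis_apply {ι κ : Type*} (e : HilbertBasis ι ℂ H₁) (f : HilbertBasis κ ℂ H₂)
    (q : ι × κ) : tensorBasis e f q = tmul (e q.1) (f q.2) := by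
  rw [tensorBasis, HilbertBasis.coe_mkOfOrthogonalEqBot]

variable {L₁ : H₁ →ₗ.[ℂ] H₁} {L₂ : H₂ →ₗ.[ℂ] H₂} {q₁ q₂ : ℝ} {e : HilbertBasis ℕ ℂ H₁}
  {f : HilbertBasis ℕ ℂ H₂} {A B : ℕ → ℝ} {C₁ C₂ : ℝ}

/-- A bounded operator with the right eigenvalues on the basis `e i ⊗ f j` inverts the closure of
`1 + L₁ ⊗ 1 + 1 ⊗ L₂`. In particular the closure of the graph is a graph, so that `tensorSum` is not
a junk value. -/
theorem isBoundedInverse_tensorSum (h₁ : HasSortedBasis L₁ q₁ e A C₁)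
    (h₂ : HasSortedBasis L₂ q₂ f B C₂) (hA : ∀ k, 1 ≤ A k) (hB : ∀ k, 1 ≤ B k)
    {S : HilbertTensor H₁ H₂ →L[ℂ] HilbertTensor H₁ H₂}
    (hS : ∀ q, S (tensorBasis e f q) = (((A q.1 + B q.2 - 1)⁻¹ : ℝ) : ℂ) • tensorBasis e f q) :
    IsBoundedInverse ((LinearMap.id : HilbertTensor H₁ H₂ →ₗ[ℂ] HilbertTensor H₁ H₂) +ᵥ
      tensorSum L₁ L₂) S := by
  set b := tensorBasis e f
  have hpos : ∀ q : ℕ × ℕ, (((A q.1 + B q.2 - 1 : ℝ) : ℂ)) ≠ 0 := fun q => by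
    have h1 := hA q.1
    have h2 := hB q.2
    have : A q.1 + B q.2 - 1 ≠ 0 := by linarith
    exact_mod_cast this
  set G := Submodule.span ℂ (Set.range fun v : L₁.domain × L₂.domain =>
    (tmul (v.1 : H₁) (v.2 : H₂),
      tmul (L₁ v.1) (v.2 : H₂) + tmul (v.1 : H₁) (L₂ v.2))) with hG
  have key1 : ∀ z ∈ G.topologicalClosure, S (z.1 + z.2) = z.1 := by
    let Φ : (HilbertTensor H₁ H₂ × HilbertTensor H₁ H₂) →L[ℂ] HilbertTensor H₁ H₂ :=
      S ∘L (ContinuousLinearMap.fst ℂ _ _ + ContinuousLinearMap.snd ℂ _ _) -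
        ContinuousLinearMap.fst ℂ _ _
    have hle : G.topologicalClosure ≤ LinearMap.ker
        (Φ : (HilbertTensor H₁ H₂ × HilbertTensor H₁ H₂) →ₗ[ℂ] HilbertTensor H₁ H₂) := by
      refine Submodule.topologicalClosure_minimal _ ?_ Φ.isClosed_ker
      rw [hG, Submodule.span_le]
      rintro _ ⟨⟨x, y⟩, rfl⟩
      refine LinearMap.mem_ker.2 (sub_eq_zero.2 (b.ext_inner fun q => ?_))
      change ⟪b q, S (tmul (x : H₁) (y : H₂) +
        (tmul (L₁ x) (y : H₂) + tmul (x : H₁) (L₂ y)))⟫_ℂ = ⟪b q, tmul (x : H₁) (y : H₂)⟫_ℂ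
      rw [b.inner_apply_of_diag hS, inner_add_right, inner_add_right, tensorBasis_apply,
        inner_tmul_tmul, inner_tmul_tmul, inner_tmul_tmul, h₁.inner_apply, h₂.inner_apply]
      have := hpos q
      push_cast at this ⊢
      field_simp
      ring
    intro z hz
    exact sub_eq_zero.1 (LinearMap.mem_ker.1 (hle hz))
  have hSinj : ∀ z, S z = 0 → z = 0 := by
    intro z hz
    refine b.ext_inner fun q => ?_
    have h1 := b.inner_apply_of_diag hS q z
    rw [hz, inner_zero_right] at h1
    rw [inner_zero_right]
    refine (mul_eq_zero.1 h1.symm).resolve_left ?_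
    rw [Complex.ofReal_inv]
    exact inv_ne_zero (hpos q)
  have hgraph : (tensorSum L₁ L₂).graph = G.topologicalClosure := by
    refine Submodule.toLinearPMap_graph_eq _ fun z hz hz0 => ?_
    have h1 := key1 z hz
    rw [hz0, zero_add] at h1
    exact hSinj _ h1
  have key2 : ∀ z, (S z, z - S z) ∈ G.topologicalClosure := by
    let Ψ : HilbertTensor H₁ H₂ →L[ℂ] HilbertTensor H₁ H₂ × HilbertTensor H₁ H₂ :=
      S.prod (ContinuousLinearMap.id ℂ _ - S)
    have hle : (Submodule.span ℂ (Set.range b)).topologicalClosure ≤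
        G.topologicalClosure.comap
          (Ψ : HilbertTensor H₁ H₂ →ₗ[ℂ] HilbertTensor H₁ H₂ × HilbertTensor H₁ H₂) := by
      refine Submodule.topologicalClosure_minimal _ ?_
        (G.isClosed_topologicalClosure.preimage Ψ.continuous)
      rw [Submodule.span_le]
      rintro _ ⟨q, rfl⟩
      change (S (b q), b q - S (b q)) ∈ G.topologicalClosure
      refine G.le_topologicalClosure ?_
      obtain ⟨hx, hx'⟩ := h₁.apply_basis q.1
      obtain ⟨hy, hy'⟩ := h₂.apply_basis q.2
      have h1 : (tmul (e q.1) (f q.2),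
          tmul (L₁ ⟨e q.1, hx⟩) (f q.2) + tmul (e q.1) (L₂ ⟨f q.2, hy⟩)) ∈ G :=
        Submodule.subset_span ⟨(⟨e q.1, hx⟩, ⟨f q.2, hy⟩), rfl⟩
      have h2 := G.smul_mem (((A q.1 + B q.2 - 1)⁻¹ : ℝ) : ℂ) h1
      rw [hx', hy', tmul_smul_left, tmul_smul_right, ← add_smul, ← tensorBasis_apply] at h2
      convert h2 using 1
      refine Prod.ext (hS q) ?_
      change b q - S (b q) = (((A q.1 + B q.2 - 1)⁻¹ : ℝ) : ℂ) •
        (((A q.1 - 1 : ℝ) : ℂ) + ((B q.2 - 1 : ℝ) : ℂ)) • b q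
      rw [hS, smul_smul]
      nth_rw 1 [← one_smul ℂ (b q)]
      rw [← sub_smul]
      congr 1
      have := hpos q
      push_cast at this ⊢
      field_simp
      ring
    intro z
    have : z ∈ (Submodule.span ℂ (Set.range b)).topologicalClosure := by
      rw [b.dense_span]
      trivial
    exact hle this
  refine ⟨fun y => ?_, fun x => ?_⟩
  · have h1 := key2 y
    rw [← hgraph, LinearPMap.mem_graph_iff] at h1
    obtain ⟨u, hu1, hu2⟩ := h1
    have hmem : S y ∈ (tensorSum L₁ L₂).domain := by
      have := u.2
      rwa [hu1] at this
    refine ⟨hmem, ?_⟩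
    change S y + tensorSum L₁ L₂ ⟨S y, hmem⟩ = y
    have hu3 : u = ⟨S y, hmem⟩ := Subtype.ext hu1
    rw [← hu3, hu2]
    exact add_sub_cancel _ _
  · have h1 := (tensorSum L₁ L₂).mem_graph x
    rw [hgraph] at h1
    exact key1 _ h1

/-- Counting of eigenvalues: `(A i + B j - 1)⁻¹ ≥ 1 / u` forces `A i ≤ u` and `B j ≤ u`, which
leaves at most `C₁ u ^ q₁ · C₂ u ^ q₂` pairs `(i, j)`. -/
theorem singularValue_tensor_le (hq₁ : 0 < q₁) (hq₂ : 0 < q₂) (h₁ : HasSortedBasis L₁ q₁ e A C₁)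
    (h₂ : HasSortedBasis L₂ q₂ f B C₂) (hA : ∀ k, 1 ≤ A k) (hB : ∀ k, 1 ≤ B k)
    {S : HilbertTensor H₁ H₂ →L[ℂ] HilbertTensor H₁ H₂}
    (hS : ∀ q, S (tensorBasis e f q) = (((A q.1 + B q.2 - 1)⁻¹ : ℝ) : ℂ) • tensorBasis e f q)
    (k : ℕ) : singularValue k S ^ (q₁ + q₂) ≤ 2 * (C₁ * C₂) / (k + 1) := by
  have hq : 0 < q₁ + q₂ := add_pos hq₁ hq₂
  have hC₁ : 0 < C₁ := by
    have := (Real.rpow_pos_of_pos (h₁.pos 0) (-q₁)).trans_le (h₁.decay 0)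
    simpa using this
  have hC₂ : 0 < C₂ := by
    have := (Real.rpow_pos_of_pos (h₂.pos 0) (-q₂)).trans_le (h₂.decay 0)
    simpa using this
  -- `u ^ (q₁ + q₂) = w` is chosen such that at most `(k + 1) / 2`, hence at most `k`, pairs remain
  set w : ℝ := (k + 1) / (2 * (C₁ * C₂)) with hw
  have hw0 : 0 < w := by positivity
  set u := w ^ (q₁ + q₂)⁻¹ with hu
  have hu0 : 0 < u := Real.rpow_pos_of_pos hw0 _
  have huq : u ^ (q₁ + q₂) = w := Real.rpow_inv_rpow hw0.le hq.ne'
  have hlarge : ∀ {a q C : ℝ} {n : ℕ}, 0 < q → 0 < C → 0 < a → a ^ (-q) ≤ C / (n + 1) →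
      ⌊C * u ^ q⌋₊ ≤ n → u ≤ a := by
    intro a q C n hq hC ha h hn
    have hup : 0 < u ^ q := Real.rpow_pos_of_pos hu0 q
    have hn' : (⌊C * u ^ q⌋₊ : ℝ) ≤ n := by exact_mod_cast hn
    have h1 : C * u ^ q < n + 1 := by linarith [Nat.lt_floor_add_one (C * u ^ q)]
    refine (Real.rpow_le_rpow_iff hu0.le ha.le hq).1 ?_
    rw [Real.rpow_neg ha.le, le_div_iff₀ (by positivity)] at h
    have hap : 0 < a ^ q := Real.rpow_pos_of_pos ha q
    rw [inv_mul_le_iff₀ hap] at h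
    nlinarith
  set s : Finset (ℕ × ℕ) := Finset.range ⌊C₁ * u ^ q₁⌋₊ ×ˢ Finset.range ⌊C₂ * u ^ q₂⌋₊ with hs
  have hcard : s.card ≤ k := by
    have h1 : (s.card : ℝ) ≤ (k + 1) / 2 := by
      rw [hs, Finset.card_product, Finset.card_range, Finset.card_range]
      push_cast
      calc (⌊C₁ * u ^ q₁⌋₊ : ℝ) * ⌊C₂ * u ^ q₂⌋₊ ≤ (C₁ * u ^ q₁) * (C₂ * u ^ q₂) := by
            gcongr
            · exact Nat.floor_le (by positivity)
            · exact Nat.floor_le (by positivity)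
        _ = C₁ * C₂ * u ^ (q₁ + q₂) := by
            rw [Real.rpow_add hu0]
            ring
        _ = (k + 1) / 2 := by
            rw [huq, hw]
            field_simp
    have h2 : 2 * s.card ≤ k + 1 := by
      have : (2 * s.card : ℝ) ≤ k + 1 := by linarith
      exact_mod_cast this
    omega
  have hbound : singularValue s.card S ≤ u⁻¹ := by
    refine singularValue_le_of_bound (tensorBasis e f).orthonormal s (inv_pos.2 hu0).le
      fun y hy => ?_
    refine (tensorBasis e f).norm_apply_le_of_diag hS (inv_pos.2 hu0).le y fun q => ?_
    by_cases hqs : q ∈ s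
    · exact Or.inl (hy q hqs)
    · right
      have hA1 := hA q.1
      have hB1 := hB q.2
      have hmain : u ≤ A q.1 + B q.2 - 1 := by
        rw [hs, Finset.mem_product, Finset.mem_range, Finset.mem_range, not_and_or, not_lt,
          not_lt] at hqs
        rcases hqs with h | h
        · linarith [hlarge hq₁ hC₁ (h₁.pos _) (h₁.decay _) h]
        · linarith [hlarge hq₂ hC₂ (h₂.pos _) (h₂.decay _) h]
      rw [Complex.norm_real, Real.norm_of_nonneg (inv_nonneg.2 (by linarith))]
      exact inv_anti₀ hu0 hmain
  have h3 := (singularValue_antitone S hcard).trans hbound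
  refine (Real.rpow_le_rpow (singularValue_nonneg _ _) h3 hq.le).trans (le_of_eq ?_)
  rw [Real.inv_rpow hu0.le, huq, hw, inv_div]

theorem not_finiteDimensional_of_hilbertBasis {H ι : Type*} [NormedAddCommGroup H]
    [InnerProductSpace ℂ H] [Infinite ι] (b : HilbertBasis ι ℂ H) : ¬ FiniteDimensional ℂ H := by
  intro h
  exact not_finite_iff_infinite.2 ‹Infinite ι› b.orthonormal.linearIndependent.finite

theorem exists_hasSortedBasis_tensorSum (hq₁ : 0 < q₁) (hq₂ : 0 < q₂)
    (h₁ : HasSortedBasis L₁ q₁ e A C₁) (h₂ : HasSortedBasis L₂ q₂ f B C₂) (hA : ∀ k, 1 ≤ A k)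
    (hB : ∀ k, 1 ≤ B k) :
    ∃ (g : HilbertBasis ℕ ℂ (HilbertTensor H₁ H₂)) (E : ℕ → ℝ) (C : ℝ),
      HasSortedBasis (tensorSum L₁ L₂) (q₁ + q₂) g E C ∧
      ∀ q, boundedInverse ((LinearMap.id : HilbertTensor H₁ H₂ →ₗ[ℂ] HilbertTensor H₁ H₂) +ᵥ
        tensorSum L₁ L₂) (tensorBasis e f q) =
          (((A q.1 + B q.2 - 1)⁻¹ : ℝ) : ℂ) • tensorBasis e f q := by
  have hq : 0 < q₁ + q₂ := add_pos hq₁ hq₂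
  have hone : ∀ q : ℕ × ℕ, 1 ≤ A q.1 + B q.2 - 1 := fun q => by linarith [hA q.1, hB q.2]
  obtain ⟨S, hS0, hS⟩ := (tensorBasis e f).exists_diag (κ := fun q => (A q.1 + B q.2 - 1)⁻¹)
    (fun q => inv_nonneg.2 (by linarith [hone q])) (fun q => inv_le_one_of_one_le₀ (hone q))
  have hinv := isBoundedInverse_tensorSum h₁ h₂ hA hB hS
  have heq := hinv.boundedInverse_eq
  have hsv := singularValue_tensor_le hq₁ hq₂ h₁ h₂ hA hB hS
  have hSc : IsCompactOperator S := by
    refine isCompactOperator_of_singularValue fun ε hε => ?_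
    have hεq : 0 < ε ^ (q₁ + q₂) := Real.rpow_pos_of_pos hε _
    obtain ⟨n, hn⟩ := exists_nat_gt (2 * (C₁ * C₂) / ε ^ (q₁ + q₂))
    refine ⟨n, (Real.rpow_lt_rpow_iff (singularValue_nonneg _ _) hε.le hq).1
      ((hsv n).trans_lt ?_)⟩
    rw [div_lt_iff₀ (by positivity)]
    rw [div_lt_iff₀ hεq] at hn
    nlinarith
  obtain ⟨g, E, C, hE, hs, hC⟩ := exists_hilbertBasis_sortedEigen
    (not_finiteDimensional_of_hilbertBasis (tensorBasis e f)) hSc hS0 hinv.injective hq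
    (fun x l h _ => ⟨_, fun k => by
      rw [← h.singularValue_eq k]
      exact hsv k⟩)
  refine ⟨g, E, C, ⟨?_, ?_, hE, ?_, hC⟩, ?_⟩
  · rw [heq]
    exact hinv
  · rw [heq]
    exact hS0
  · rw [heq]
    exact hs
  · rw [heq]
    exact hS

end TensorBasis

open MeasureTheory Filter Topology

/-! ### Heat traces -/

theorem gaussWeight_eq (p A s : ℝ) :
    gaussWeight p A s = s ^ (-p) * Real.exp (-s⁻¹ ^ 2) * Real.exp (-(s⁻¹ ^ 2 * (A - 1))) := by
  rw [gaussWeight, mul_assoc, ← Real.exp_add]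
  congr 2
  rw [inv_pow]
  ring

section HeatTrace

variable {H : Type*} [NormedAddCommGroup H] [InnerProductSpace ℂ H]

variable {L : H →ₗ.[ℂ] H} {p : ℝ} {e : HilbertBasis ℕ ℂ H} {A : ℕ → ℝ} {C : ℝ}

theorem HasSortedBasis.summable_exp (h : HasSortedBasis L (p / 2) e A C) (hp : 0 < p) {s : ℝ}
    (hs : 0 < s) : Summable fun k => Real.exp (-(s⁻¹ ^ 2 * (A k - 1))) := by
  obtain ⟨K, hK⟩ := exists_norm_tsum_gaussWeight_le hp h.pos (c := fun _ => 1) (B := 1)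
    (fun _ => norm_one.le) h.decay
  have h1 := (hK s hs).1
  simp only [one_mul] at h1
  have h2 : Summable fun k => gaussWeight p (A k) s := by exact_mod_cast h1
  simp only [gaussWeight_eq] at h2
  have hne : s ^ (-p) * Real.exp (-s⁻¹ ^ 2) ≠ 0 :=
    (mul_pos (Real.rpow_pos_of_pos hs _) (Real.exp_pos _)).ne'
  exact (summable_mul_left_iff hne).1 h2

theorem HasSortedBasis.memLp_heatMean (h : HasSortedBasis L (p / 2) e A C) (hp : 0 < p)
    (T : H →L[ℂ] H) : MemLp (heatMean p (fun k => ⟪e k, T (e k)⟫_ℂ) A) ∞ halfLine :=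
  NCG.memLp_heatMean hp h.pos (fun k => norm_inner_apply_self_le T (e.orthonormal.1 k)) h.decay

theorem HasSortedBasis.exists_norm_heatMean_le (h : HasSortedBasis L (p / 2) e A C) (hp : 0 < p)
    (T : H →L[ℂ] H) :
    ∃ K, ∀ s, 1 < s → ‖heatMean p (fun k => ⟪e k, T (e k)⟫_ℂ) A s‖ ≤ K := by
  obtain ⟨K, hK⟩ := exists_norm_tsum_gaussWeight_le hp h.pos
    (fun k => norm_inner_apply_self_le T (e.orthonormal.1 k)) h.decay
  refine ⟨K, fun s hs => ?_⟩
  rw [heatMean, Set.indicator_of_mem (Set.mem_Ioi.2 hs)]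
  exact (hK s (one_pos.trans hs)).2

variable [CompleteSpace H]

theorem HasSortedBasis.trace_mul_heat (h : HasSortedBasis L (p / 2) e A C) (hp : 0 < p) {s : ℝ}
    (hs : 0 < s) (T : H →L[ℂ] H) : trace (T * heat L (s⁻¹ ^ 2)) =
      ∑' k, ⟪e k, T (e k)⟫_ℂ * (Real.exp (-(s⁻¹ ^ 2 * (A k - 1))) : ℂ) := by
  have ha : 0 < s⁻¹ ^ 2 := by positivity
  have h1 := trace_mul_eq_tsum e (fun k => (Real.exp_pos _).le) (h.summable_exp hp hs)
    (fun k => heat_apply_eigenvector h.nonneg (h.pos k) (h.sorted.eig k) ha) T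
  exact h1

/-- The function whose `ω`-value computes the Dixmier trace is a rescaled heat trace. -/
theorem HasSortedBasis.heatMean_eq (h : HasSortedBasis L (p / 2) e A C) (hp : 0 < p) {s : ℝ}
    (hs : 1 < s) (T : H →L[ℂ] H) : heatMean p (fun k => ⟪e k, T (e k)⟫_ℂ) A s =
      (s ^ (-p) : ℝ) * (Real.exp (-s⁻¹ ^ 2) : ℝ) * trace (T * heat L (s⁻¹ ^ 2)) := by
  rw [heatMean, Set.indicator_of_mem (Set.mem_Ioi.2 hs),
    h.trace_mul_heat hp (one_pos.trans hs), ← tsum_mul_left]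
  refine tsum_congr fun k => ?_
  rw [gaussWeight_eq]
  push_cast
  ring

theorem tendsto_exp_neg_inv_sq : Tendsto (fun s : ℝ => Real.exp (-s⁻¹ ^ 2)) atTop (𝓝 1) := by
  have h : Tendsto (fun s : ℝ => Real.exp (-s⁻¹ ^ 2)) atTop (𝓝 (Real.exp (-0 ^ 2))) :=
    (Real.continuous_exp.tendsto _).comp ((tendsto_inv_atTop_zero.pow 2).neg)
  simpa using h

/-- Convergence of `t ^ p Tr (T exp (-t² L))` as `t → 0⁺` is convergence of the heat mean at
infinity, under `t = 1 / s`. -/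
theorem HasSortedBasis.tendsto_heatMean (h : HasSortedBasis L (p / 2) e A C) (hp : 0 < p)
    {T : H →L[ℂ] H} {c : ℂ} (hc : Tendsto
      (fun t : ℝ => ((t ^ p : ℝ) : ℂ) * trace (T * heat L (t ^ 2))) (𝓝[>] 0) (𝓝 c)) :
    Tendsto (heatMean p (fun k => ⟪e k, T (e k)⟫_ℂ) A) atTop (𝓝 c) := by
  have h1 := hc.comp tendsto_inv_atTop_nhdsGT_zero
  have h2 : Tendsto (fun s : ℝ => ((Real.exp (-s⁻¹ ^ 2) : ℝ) : ℂ)) atTop (𝓝 ((1 : ℝ) : ℂ)) :=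
    (Complex.continuous_ofReal.tendsto _).comp tendsto_exp_neg_inv_sq
  have h3 := h2.mul h1
  rw [Complex.ofReal_one, one_mul] at h3
  refine h3.congr' ?_
  filter_upwards [eventually_gt_atTop 1] with s hs
  rw [h.heatMean_eq hp hs, Function.comp_apply, Real.inv_rpow (one_pos.trans hs).le,
    ← Real.rpow_neg (one_pos.trans hs).le]
  ring

/-- The Dixmier trace of `T (1 + L) ^ (-p / 2)` is the value of the state on a scaled heat trace. -/
theorem HasSortedBasis.gamma_mul_dixmierTrace {ω : Linfty →ₗ[ℂ] ℂ} (hω : IsState ω)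
    (hω' : VanishesOnBounded ω) (hM : ∀ x : Linfty, ω (logMean x) = ω x)
    (h : HasSortedBasis L (p / 2) e A C) (hp : 0 < p) (T : H →L[ℂ] H) :
    (Real.Gamma (1 + p / 2) : ℂ) *
        dixmierTrace (ω ∘ₗ powAct p hp) (T * resolventPow L (p / 2)) =
      ω (toLinfty (heatMean p (fun k => ⟪e k, T (e k)⟫_ℂ) A)) :=
  gamma_mul_dixmierTrace_eq hω hω' hM (not_finiteDimensional_of_hilbertBasis e) hp
    (resolventPow_nonneg L (half_pos hp)) h.pos
    (sortedEigen_resolventPow h.nonneg h.pos h.sorted (half_pos hp)) h.decay T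

theorem HasSortedBasis.isWeakL1 (h : HasSortedBasis L (p / 2) e A C) (hp : 0 < p)
    (T : H →L[ℂ] H) : IsWeakL1 (T * resolventPow L (p / 2)) := by
  refine IsWeakL1.mul_left ⟨C, fun k => ?_⟩ T
  rw [(sortedEigen_resolventPow h.nonneg h.pos h.sorted (half_pos hp)).singularValue_eq k]
  exact h.decay k

end HeatTrace

section TensorHeat

variable {H₁ H₂ : Type*} [NormedAddCommGroup H₁] [InnerProductSpace ℂ H₁] [CompleteSpace H₁]
  [NormedAddCommGroup H₂] [InnerProductSpace ℂ H₂] [CompleteSpace H₂]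
  {L₁ : H₁ →ₗ.[ℂ] H₁} {L₂ : H₂ →ₗ.[ℂ] H₂} {p₁ p₂ : ℝ} {e : HilbertBasis ℕ ℂ H₁}
  {f : HilbertBasis ℕ ℂ H₂} {A B : ℕ → ℝ} {C₁ C₂ : ℝ}

/-- The heat trace of `L₁ ⊗ 1 + 1 ⊗ L₂` factorises, as its eigenvalues are
`(A i - 1) + (B j - 1)`. -/
theorem trace_tensorOp_mul_heat (hp₁ : 0 < p₁) (hp₂ : 0 < p₂)
    (h₁ : HasSortedBasis L₁ (p₁ / 2) e A C₁) (h₂ : HasSortedBasis L₂ (p₂ / 2) f B C₂)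
    (hA : ∀ k, 1 ≤ A k) (hB : ∀ k, 1 ≤ B k)
    (h0 : 0 ≤ boundedInverse ((LinearMap.id : HilbertTensor H₁ H₂ →ₗ[ℂ] HilbertTensor H₁ H₂) +ᵥ
        tensorSum L₁ L₂))
    (h : ∀ q, boundedInverse ((LinearMap.id : HilbertTensor H₁ H₂ →ₗ[ℂ] HilbertTensor H₁ H₂) +ᵥ
        tensorSum L₁ L₂) (tensorBasis e f q) =
          (((A q.1 + B q.2 - 1)⁻¹ : ℝ) : ℂ) • tensorBasis e f q)
    {s : ℝ} (hs : 0 < s) (T₁ : H₁ →L[ℂ] H₁) (T₂ : H₂ →L[ℂ] H₂) :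
    trace (tensorOp T₁ T₂ * heat (tensorSum L₁ L₂) (s⁻¹ ^ 2)) =
      trace (T₁ * heat L₁ (s⁻¹ ^ 2)) * trace (T₂ * heat L₂ (s⁻¹ ^ 2)) := by
  have ha : 0 < s⁻¹ ^ 2 := by positivity
  have hs₁ := h₁.summable_exp hp₁ hs
  have hs₂ := h₂.summable_exp hp₂ hs
  have hsplit : ∀ q : ℕ × ℕ, Real.exp (-(s⁻¹ ^ 2 * (A q.1 + B q.2 - 1 - 1))) =
      Real.exp (-(s⁻¹ ^ 2 * (A q.1 - 1))) * Real.exp (-(s⁻¹ ^ 2 * (B q.2 - 1))) := fun q => by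
    rw [← Real.exp_add]
    congr 1
    ring
  have hsum : Summable fun q : ℕ × ℕ => Real.exp (-(s⁻¹ ^ 2 * (A q.1 + B q.2 - 1 - 1))) := by
    simp only [hsplit]
    exact hs₁.mul_of_nonneg hs₂ (fun _ => (Real.exp_pos _).le) fun _ => (Real.exp_pos _).le
  have hpos : ∀ q : ℕ × ℕ, 0 < A q.1 + B q.2 - 1 := fun q => by linarith [hA q.1, hB q.2]
  have hnorm : ∀ {c : ℕ → ℂ} {x : ℕ → ℝ} {K : ℝ}, (∀ k, ‖c k‖ ≤ K) → (∀ k, 0 ≤ x k) → Summable x →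
      Summable fun k => ‖c k * (x k : ℂ)‖ := by
    intro c x K hc hx hsx
    refine (hsx.mul_left K).of_nonneg_of_le (fun _ => norm_nonneg _) fun k => ?_
    rw [norm_mul, Complex.norm_real, Real.norm_of_nonneg (hx k)]
    exact mul_le_mul_of_nonneg_right (hc k) (hx k)
  have hexp : ∀ x : ℕ → ℝ, ∀ k, 0 ≤ Real.exp (-(s⁻¹ ^ 2 * (x k - 1))) := fun _ _ =>
    (Real.exp_pos _).le
  rw [h₁.trace_mul_heat hp₁ hs, h₂.trace_mul_heat hp₂ hs,
    tsum_mul_tsum_of_summable_norm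
      (hnorm (fun k => norm_inner_apply_self_le T₁ (e.orthonormal.1 k)) (hexp A) hs₁)
      (hnorm (fun k => norm_inner_apply_self_le T₂ (f.orthonormal.1 k)) (hexp B) hs₂),
    trace_mul_eq_tsum (tensorBasis e f) (fun q => (Real.exp_pos _).le) hsum
      (fun q => heat_apply_eigenvector h0 (hpos q) (h q) ha)]
  refine tsum_congr fun q => ?_
  rw [tensorBasis_apply, tensorOp_tmul, inner_tmul_tmul, hsplit]
  push_cast
  ring

end TensorHeat

/-! ### Products with a convergent factor -/

theorem norm_mul_sub_mul_tendsto_zero {a b : ℝ → ℂ} {c : ℂ} {K : ℝ} (ha : Tendsto a atTop (𝓝 c))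
    (hb : ∀ s, 1 < s → ‖b s‖ ≤ K) : Tendsto (fun s => (a s - c) * b s) atTop (𝓝 0) := by
  have h1 : Tendsto (fun s => a s - c) atTop (𝓝 0) := by
    simpa using ha.sub_const c
  refine h1.zero_mul_isBoundedUnder_le ⟨K, ?_⟩
  rw [eventually_map]
  filter_upwards [eventually_gt_atTop 1] with s hs
  exact hb s hs

/-- A state at infinity is multiplicative on a product of two bounded functions one of which
converges. -/
theorem state_mul_of_tendsto {ω : Linfty →ₗ[ℂ] ℂ} (hω : IsState ω) (hω' : VanishesOnBounded ω)
    {a b h : ℝ → ℂ} {ρ : ℝ → ℂ} {c : ℂ} {K : ℝ} (ham : MemLp a ∞ halfLine)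
    (hbm : MemLp b ∞ halfLine) (hhm : MemLp h ∞ halfLine) (ha : Tendsto a atTop (𝓝 c))
    (hb : ∀ s, 1 < s → ‖b s‖ ≤ K) (hρ : Tendsto ρ atTop (𝓝 1))
    (hh : ∀ s, 1 < s → h s = ρ s * a s * b s) :
    ω (toLinfty h) = ω (toLinfty a) * ω (toLinfty b) := by
  have hωa : ω (toLinfty a) = c := by
    have h1 := state_congr_of_tendsto hω hω' ham (memLp_const_halfLine c)
      (by simpa using ha.sub_const c)
    have h2 := toLinfty_const_mul (memLp_const_halfLine 1) c
    simp only [mul_one] at h2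
    rw [h1, h2, map_smul, hω.map_one, smul_eq_mul, mul_one]
  have hρa : Tendsto (fun s => ρ s * a s) atTop (𝓝 c) := by
    simpa using hρ.mul ha
  have h1 := state_congr_of_tendsto hω hω' hhm (hbm.const_mul c)
    ((norm_mul_sub_mul_tendsto_zero hρa hb).congr' (by
      filter_upwards [eventually_gt_atTop 1] with s hs
      rw [hh s hs]
      ring))
  rw [h1, toLinfty_const_mul hbm, map_smul, smul_eq_mul, hωa]

end NCG

theorem theorem1p8
    {H₁ : Type*} [NormedAddCommGroup H₁] [InnerProductSpace ℂ H₁] [CompleteSpace H₁]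
    [TopologicalSpace.SeparableSpace H₁] (hH₁ : ¬ FiniteDimensional ℂ H₁)
    {H₂ : Type*} [NormedAddCommGroup H₂] [InnerProductSpace ℂ H₂] [CompleteSpace H₂]
    [TopologicalSpace.SeparableSpace H₂] (hH₂ : ¬ FiniteDimensional ℂ H₂)
    (ω : NCG.Linfty →ₗ[ℂ] ℂ) (hω : NCG.IsState ω) (hω_inf : NCG.VanishesOnBounded ω)
    (hω_mean : ∀ x : NCG.Linfty, ω (NCG.logMean x) = ω x)
    (X₁ : NCG.SpectralTriple H₁) (X₂ : NCG.SpectralTriple H₂)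
    (p₁ p₂ : ℝ) (hp₁ : 0 < p₁) (hp₂ : 0 < p₂)
    (hX₁ : X₁.IsSummable p₁) (hX₂ : X₂.IsSummable p₂)
    (hX : X₁.ThetaConvergent p₁ ∨ X₂.ThetaConvergent p₂)
    (T₁ : H₁ →L[ℂ] H₁) (hT₁ : T₁ ∈ X₁.alg) (T₂ : H₂ →L[ℂ] H₂) (hT₂ : T₂ ∈ X₂.alg) :
    NCG.IsWeakL1 (NCG.tensorOp T₁ T₂ * NCG.resolventPow
        (NCG.tensorSum (NCG.square X₁.D) (NCG.square X₂.D)) ((p₁ + p₂) / 2)) ∧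
    (Real.Gamma (1 + (p₁ + p₂) / 2) : ℂ) *
        NCG.dixmierTrace (ω ∘ₗ NCG.powAct (p₁ + p₂) (add_pos hp₁ hp₂))
          (NCG.tensorOp T₁ T₂ * NCG.resolventPow
            (NCG.tensorSum (NCG.square X₁.D) (NCG.square X₂.D)) ((p₁ + p₂) / 2)) =
      ((Real.Gamma (1 + p₁ / 2) : ℂ) *
        NCG.dixmierTrace (ω ∘ₗ NCG.powAct p₁ hp₁)
          (T₁ * NCG.resolventPow (NCG.square X₁.D) (p₁ / 2))) *
      ((Real.Gamma (1 + p₂ / 2) : ℂ) *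
        NCG.dixmierTrace (ω ∘ₗ NCG.powAct p₂ hp₂)
          (T₂ * NCG.resolventPow (NCG.square X₂.D) (p₂ / 2))) := by
  open NCG Filter Topology in
  have hp := add_pos hp₁ hp₂
  obtain ⟨e, A, C₁, h₁, hA⟩ := X₁.exists_hasSortedBasis hH₁ hp₁ hX₁
  obtain ⟨f, B, C₂, h₂, hB⟩ := X₂.exists_hasSortedBasis hH₂ hp₂ hX₂
  obtain ⟨g, E, C, h, hdiag⟩ :=
    exists_hasSortedBasis_tensorSum (half_pos hp₁) (half_pos hp₂) h₁ h₂ hA hB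
  -- the summability exponent `p₁ / 2 + p₂ / 2` as `(p₁ + p₂) / 2`
  rw [← add_div] at h
  refine ⟨h.isWeakL1 hp _, ?_⟩
  rw [h.gamma_mul_dixmierTrace hω hω_inf hω_mean hp,
    h₁.gamma_mul_dixmierTrace hω hω_inf hω_mean hp₁,
    h₂.gamma_mul_dixmierTrace hω hω_inf hω_mean hp₂]
  have hρ : Tendsto (fun s : ℝ => ((Real.exp (-s⁻¹ ^ 2) : ℝ) : ℂ)⁻¹) atTop (𝓝 1) := by
    have h3 := ((Complex.continuous_ofReal.tendsto _).comp tendsto_exp_neg_inv_sq).inv₀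
      (Complex.ofReal_ne_zero.2 one_ne_zero)
    simpa using h3
  -- each heat mean contains a factor `exp (-1 / s²)`, from `1 + L` in place of `L`; the heat traces
  -- themselves multiply
  have hprod : ∀ s : ℝ, 1 < s →
      heatMean (p₁ + p₂) (fun k => inner ℂ (g k) (tensorOp T₁ T₂ (g k))) E s =
        ((Real.exp (-s⁻¹ ^ 2) : ℝ) : ℂ)⁻¹ *
          heatMean p₁ (fun k => inner ℂ (e k) (T₁ (e k))) A s *
          heatMean p₂ (fun k => inner ℂ (f k) (T₂ (f k))) B s := by
    intro s hs
    have hs0 : 0 < s := one_pos.trans hs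
    have hne : ((Real.exp (-s⁻¹ ^ 2) : ℝ) : ℂ) ≠ 0 :=
      Complex.ofReal_ne_zero.2 (Real.exp_pos _).ne'
    rw [h.heatMean_eq hp hs, h₁.heatMean_eq hp₁ hs, h₂.heatMean_eq hp₂ hs,
      trace_tensorOp_mul_heat hp₁ hp₂ h₁ h₂ hA hB h.nonneg hdiag hs0, neg_add,
      Real.rpow_add hs0, Complex.ofReal_mul]
    field_simp
  rcases hX with hX | hX
  · obtain ⟨c, hc⟩ := hX T₁ hT₁
    obtain ⟨K, hK⟩ := h₂.exists_norm_heatMean_le hp₂ T₂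
    exact state_mul_of_tendsto hω hω_inf (h₁.memLp_heatMean hp₁ T₁) (h₂.memLp_heatMean hp₂ T₂)
      (h.memLp_heatMean hp _) (h₁.tendsto_heatMean hp₁ hc) hK hρ hprod
  · obtain ⟨c, hc⟩ := hX T₂ hT₂
    obtain ⟨K, hK⟩ := h₁.exists_norm_heatMean_le hp₁ T₁
    rw [mul_comm (ω _)]
    exact state_mul_of_tendsto hω hω_inf (h₂.memLp_heatMean hp₂ T₂) (h₁.memLp_heatMean hp₁ T₁)
      (h.memLp_heatMean hp _) (h₂.tendsto_heatMean hp₂ hc) hK hρ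
      fun s hs => (hprod s hs).trans (mul_right_comm _ _ _)
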